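/- **Setting.** Let $\omega=e^{2\pi i/3}$, $\Lambda=\omega\mathbb Z\oplus\mathbb Z$, $\langle z,w\rangle=\operatorname{Re}(z\bar w)$, $\Lambda^*=\frac{4\pi i}{\sqrt3}\Lambda$, $K=\frac43\pi$ and $\mathcal K_0=\{K,-K\}+\Lambda^*$. Let $U_\pm:\mathbb C\to\mathbb C$ be continuous functions (for instance real analytic ones) with $$U_\pm(\omega z)=\omega U_\pm(z),\qquad U_\pm(z+\gamma)=e^{\pm i\langle\gamma,K\rangle}U_\pm(z)\quad(z\in\mathbb C,\ \gamma\in\Lambda),\qquad V(z)=\begin{pmatrix}0&U_+(z)\\U_-(z)&0\end{pmatrix}.$$ For $p\in\mathbb C$ let $L^2_p=L^2_p(\mathbb C/\Lambda;\mathbb C^2)$ be the space of all $u\in L^2_{\rm loc}(\mathbb C;\mathbb C^2)$ such that, for every $\gamma\in\Lambda$, $$\operatorname{diag}\big(e^{i\langle\gamma,K\rangle},e^{-i\langle\gamma,K\rangle}\big)\,u(z+\gamma)=e^{i\langle p,\gamma\rangle}u(z)\quad\text{for a.e. }z,$$ with the $L^2$ norm over a fundamental cell of $\Lambda$, and let $H^1_p=L^2_p\cap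 H^1_{\rm loc}$. Write $2D_{\bar z}=-i(\partial_x+i\partial_y)$ and $2D_z=-i(\partial_x-i\partial_y)$. For $\alpha\in\mathbb C$ put $$D_V(\alpha)=2D_{\bar z}+\alpha V,\qquad D_V(\alpha)^*=2D_z+\bar\alpha V^*,\qquad H(\alpha)=\begin{pmatrix}0&D_V(\alpha)^*\\D_V(\alpha)&0\end{pmatrix}.$$ On $L^2_p$ the operators $2D_{\bar z}$ and $D_V(\alpha)$ have domain $H^1_p$. On $L^2_k\times L^2_k$ the operator $H(\alpha)$ has domain $H^1_k\times H^1_k$, and $E_1(\alpha,k)$ denotes its smallest non-negative eigenvalue. The magic set is $$\mathcal A(V)=\{\alpha\in\mathbb C:\ E_1(\alpha,k)=0\ \text{for all }k\in\mathbb C\}.$$ **Proposition 2.2.** For $p\in\mathbb C$ and $k\in\mathbb C\setminus(\mathcal K_0+p)$ the resolvent $R(k)=(2D_{\bar z}-k)^{-1}:L^2_p\to L^2_p$ exists, and the operator $$T_k:=R(k)V:L^2_p\to L^2_p$$ is well defined and compact. Moreover: 1. $\operatorname{Spec}_{L^2_p}(T_k)=\operatorname{Spec}_{L^2_q}(T_{k'})$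 for all $p,q\in\mathbb C$, $k\notin\mathcal K_0+p$ and $k'\notin\mathcal K_0+q$. 2. $\mathcal A(V)=\{\alpha\in\mathbb C\setminus\{0\}:\ \alpha^{-1}\in\operatorname{Spec}_{L^2_p}(T_k)\}$ for all $p\in\mathbb C$ and $k\notin\mathcal K_0+p$. 3. If $\alpha\notin\mathcal A(V)$, then the spectrum of $D_V(\alpha)$ on $L^2_0$ is $\mathcal K_0$, and every point of it is a simple eigenvalue (of algebraic multiplicity one). If $\alpha\in\mathcal A(V)$, then the spectrum of $D_V(\alpha)$ on $L^2_0$ is $\mathbb C$. -/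

import Mathlib

open MeasureTheory Complex
open scoped ContDiff ComplexConjugate Real

noncomputable section

namespace ChiralTBG

/-! ### The lattices -/

/-- `ω = e^{2πi/3}`. -/
def omega : ℂ := exp (2 * π * I / 3)

theorem omega_re : omega.re = -(1 / 2) := by
  have h : (2 * π * I / 3 : ℂ) = ((2 * π / 3 : ℝ) : ℂ) * I := by push_cast; ring
  rw [omega, h, exp_ofReal_mul_I_re]
  have : (2 * π / 3 : ℝ) = π - π / 3 := by ring
  rw [this, Real.cos_pi_sub, Real.cos_pi_div_three]

theorem omega_im : omega.im = √3 / 2 := by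
  have h : (2 * π * I / 3 : ℂ) = ((2 * π / 3 : ℝ) : ℂ) * I := by push_cast; ring
  rw [omega, h, exp_ofReal_mul_I_im]
  have : (2 * π / 3 : ℝ) = π - π / 3 := by ring
  rw [this, Real.sin_pi_sub, Real.sin_pi_div_three]

/-- The pair of periods `ω`, `1`. -/
def periods : PeriodPair where
  ω₁ := omega
  ω₂ := 1
  indep := by
    rw [LinearIndependent.pair_iff]
    intro s t h
    have him := congrArg Complex.im h
    have hre := congrArg Complex.re h
    simp [omega_re, omega_im] at him hre
    subst him
    simpa using hre

/-- `Λ = ωℤ ⊕ ℤ`. -/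
abbrev lattice : Submodule ℤ ℂ := periods.lattice

/-- A fundamental cell `{sω + t : 0 ≤ s, t < 1}` of `Λ`. -/
def cell : Set ℂ := ZSpan.fundamentalDomain periods.basis

/-- `⟨z, w⟩ = Re (z w̄)`. -/
def pairing (z w : ℂ) : ℝ := (z * conj w).re

/-- `Λ* = (4πi/√3) Λ`. -/
def dualLattice : Set ℂ := {q | ∃ γ ∈ lattice, q = 4 * π * I / (√3 : ℝ) * γ}

/-- The Dirac point `K = 4π/3`. -/
def K : ℂ := 4 / 3 * π

/-- `𝒦₀ = {K, -K} + Λ*`. -/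
def diracPoints : Set ℂ := {q | q - K ∈ dualLattice ∨ q + K ∈ dualLattice}

theorem exp_three_pairing {γ : ℂ} (hγ : γ ∈ lattice) :
    exp (I * pairing γ K) * exp (I * pairing γ K) * exp (I * pairing γ K) = 1 := by
  obtain ⟨m, n, rfl⟩ := PeriodPair.mem_lattice.mp hγ
  rw [← exp_add, ← exp_add, exp_eq_one_iff]
  refine ⟨2 * n - m, ?_⟩
  have h : pairing (m * periods.ω₁ + n * periods.ω₂) K = 4 / 3 * π * (n - m / 2) := by
    have hK : K = ((4 / 3 * π : ℝ) : ℂ) := by simp [K]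
    rw [pairing, hK, conj_ofReal]
    simp [periods, omega_re]
    ring
  rw [h]
  push_cast
  ring

/-! ### The spaces `L²_p` -/

/-- `ℂ²` with its Euclidean norm. -/
abbrev C2 : Type := EuclideanSpace ℂ (Fin 2)

/-- The action of a `2 × 2` matrix on `ℂ²`. -/
abbrev act (M : Matrix (Fin 2) (Fin 2) ℂ) : C2 →L[ℂ] C2 := Matrix.toEuclideanCLM (𝕜 := ℂ) M

/-- The matrix `diag (e^{i⟨γ,K⟩}, e^{-i⟨γ,K⟩})`. -/
def twist (γ : ℂ) : Matrix (Fin 2) (Fin 2) ℂ :=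
  !![exp (I * pairing γ K), 0; 0, exp (-(I * pairing γ K))]

/-- `(𝓛_γ f)(z) = diag (e^{i⟨γ,K⟩}, e^{-i⟨γ,K⟩}) f(z + γ)`. -/
def translate (γ : ℂ) (f : ℂ → C2) : ℂ → C2 := fun z => act (twist γ) (f (z + γ))

/-- `f ∈ L²_loc(ℂ; ℂ²)`. -/
def LocL2 (f : ℂ → C2) : Prop := ∀ S : Set ℂ, IsCompact S → MemLp f 2 (volume.restrict S)

theorem LocL2.congr {f g : ℂ → C2} (hf : LocL2 f) (h : f =ᵐ[volume] g) : LocL2 g :=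
  fun S hS => (memLp_congr_ae (ae_restrict_of_ae h)).mp (hf S hS)

theorem LocL2.add {f g : ℂ → C2} (hf : LocL2 f) (hg : LocL2 g) : LocL2 (f + g) :=
  fun S hS => (hf S hS).add (hg S hS)

theorem LocL2.const_smul {f : ℂ → C2} (hf : LocL2 f) (c : ℂ) : LocL2 (c • f) :=
  fun S hS => (hf S hS).const_smul c

theorem LocL2.locallyIntegrable {f : ℂ → C2} (hf : LocL2 f) : LocallyIntegrable f volume := by
  rw [locallyIntegrable_iff]
  intro S hS
  have : IsFiniteMeasure (volume.restrict S) :=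
    ⟨by rw [Measure.restrict_apply_univ]; exact hS.measure_lt_top⟩
  exact (hf S hS).integrable (by norm_num)

theorem LocL2.aestronglyMeasurable {f : ℂ → C2} (hf : LocL2 f) :
    AEStronglyMeasurable f volume := hf.locallyIntegrable.aestronglyMeasurable

theorem ae_translate {P : ℂ → Prop} (γ : ℂ) (h : ∀ᵐ z, P z) : ∀ᵐ z : ℂ, P (z + γ) :=
  (measurePreserving_add_right volume γ).quasiMeasurePreserving.ae h

/-- The condition `𝓛_γ f = e^{i⟨p,γ⟩} f` for all `γ ∈ Λ`. -/
def QuasiPeriodic (p : ℂ) (f : ℂ → C2) : Prop :=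
  ∀ γ ∈ lattice, translate γ f =ᵐ[volume] fun z => exp (I * pairing p γ) • f z

theorem QuasiPeriodic.congr {p : ℂ} {f g : ℂ → C2} (hf : QuasiPeriodic p f)
    (h : f =ᵐ[volume] g) : QuasiPeriodic p g := by
  intro γ hγ
  filter_upwards [hf γ hγ, h, ae_translate γ h] with z h1 h2 h3
  simp only [translate] at h1 ⊢
  rw [← h3, h1, h2]

theorem QuasiPeriodic.add {p : ℂ} {f g : ℂ → C2} (hf : QuasiPeriodic p f)
    (hg : QuasiPeriodic p g) : QuasiPeriodic p (f + g) := by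
  intro γ hγ
  filter_upwards [hf γ hγ, hg γ hγ] with z h1 h2
  simp only [translate, Pi.add_apply, map_add, smul_add] at h1 h2 ⊢
  rw [h1, h2]

theorem QuasiPeriodic.const_smul {p : ℂ} {f : ℂ → C2} (hf : QuasiPeriodic p f) (c : ℂ) :
    QuasiPeriodic p (c • f) := by
  intro γ hγ
  filter_upwards [hf γ hγ] with z h1
  simp only [translate, Pi.smul_apply, map_smul] at h1 ⊢
  rw [h1, smul_comm]

/-- The space `L²_p(ℂ/Λ; ℂ²)` of the `u ∈ L²_loc(ℂ; ℂ²)` with `𝓛_γ u = e^{i⟨p,γ⟩} u` for all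
`γ ∈ Λ`. -/
def L2 (p : ℂ) : Submodule ℂ (ℂ →ₘ[volume] C2) where
  carrier := {u | LocL2 u ∧ QuasiPeriodic p u}
  zero_mem' := by
    have h0 : (fun _ => 0 : ℂ → C2) =ᵐ[volume] (0 : ℂ →ₘ[volume] C2) :=
      (AEEqFun.coeFn_zero (α := ℂ) (β := C2) (μ := volume)).symm
    refine ⟨LocL2.congr (fun S _ => MemLp.zero') h0, QuasiPeriodic.congr (fun γ _ => ?_) h0⟩
    exact Filter.Eventually.of_forall fun z => by simp [translate]
  add_mem' {u v} hu hv :=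
    ⟨(hu.1.add hv.1).congr (AEEqFun.coeFn_add u v).symm,
      (hu.2.add hv.2).congr (AEEqFun.coeFn_add u v).symm⟩
  smul_mem' c u hu :=
    ⟨(hu.1.const_smul c).congr (AEEqFun.coeFn_smul c u).symm,
      (hu.2.const_smul c).congr (AEEqFun.coeFn_smul c u).symm⟩

/-- The element of `L²_p` given by a function. -/
def L2.mk {p : ℂ} (f : ℂ → C2) (h1 : LocL2 f) (h2 : QuasiPeriodic p f) : L2 p :=
  ⟨AEEqFun.mk f h1.aestronglyMeasurable,
    h1.congr (AEEqFun.coeFn_mk f h1.aestronglyMeasurable).symm,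
    h2.congr (AEEqFun.coeFn_mk f h1.aestronglyMeasurable).symm⟩

theorem L2.coeFn_mk {p : ℂ} (f : ℂ → C2) (h1 : LocL2 f) (h2 : QuasiPeriodic p f) :
    (L2.mk f h1 h2 : L2 p).1 =ᵐ[volume] f :=
  AEEqFun.coeFn_mk f h1.aestronglyMeasurable

theorem LocL2.memLp_cell {f : ℂ → C2} (hf : LocL2 f) : MemLp f 2 (volume.restrict cell) := by
  have hb : Bornology.IsBounded cell := ZSpan.fundamentalDomain_isBounded periods.basis
  exact (hf (closure cell) hb.isCompact_closure).mono_measure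
    (Measure.restrict_mono subset_closure le_rfl)

/-- The restriction of `u ∈ L²_p` to a fundamental cell. -/
def restrictCell (p : ℂ) : L2 p →ₗ[ℂ] Lp C2 2 (volume.restrict cell) where
  toFun u := u.2.1.memLp_cell.toLp u.1
  map_add' u v := by
    rw [← MemLp.toLp_add]
    exact MemLp.toLp_congr _ _ (ae_restrict_of_ae (AEEqFun.coeFn_add u.1 v.1))
  map_smul' c u := by
    rw [RingHom.id_apply, ← MemLp.toLp_const_smul]
    exact MemLp.toLp_congr _ _ (ae_restrict_of_ae (AEEqFun.coeFn_smul c u.1))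

theorem act_twist_injective (γ : ℂ) : Function.Injective (act (twist γ)) := by
  intro x y h
  have h0 := congrArg (fun w : C2 => w 0) h
  have h1 := congrArg (fun w : C2 => w 1) h
  simp [twist, Matrix.mulVec, dotProduct,
    Fin.sum_univ_two, exp_ne_zero] at h0 h1
  ext i
  fin_cases i
  · exact h0
  · exact h1

theorem restrictCell_injective (p : ℂ) : Function.Injective (restrictCell p) := by
  rw [injective_iff_map_eq_zero]
  intro u hu
  have hmeas : MeasurableSet cell := ZSpan.fundamentalDomain_measurableSet periods.basis
  have h0 : ∀ᵐ z : ℂ, z ∈ cell → u.1 z = 0 := by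
    rw [← ae_restrict_iff' hmeas]
    have h1 : u.2.1.memLp_cell.toLp u.1 = 0 := hu
    have h2 := u.2.1.memLp_cell.coeFn_toLp
    rw [h1] at h2
    filter_upwards [h2, Lp.coeFn_zero C2 2 (volume.restrict cell)] with z h3 h4
    rw [← h3, h4]; rfl
  have : Countable lattice := inferInstance
  have h1 : ∀ᵐ z : ℂ, ∀ γ : lattice, z + γ ∈ cell → u.1 (z + γ) = 0 :=
    ae_all_iff.mpr fun γ => ae_translate (P := fun z => z ∈ cell → u.1 z = 0) γ h0
  have h2 : ∀ᵐ z : ℂ, ∀ γ : lattice,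
      translate γ u.1 z = exp (I * pairing p γ) • u.1 z :=
    ae_all_iff.mpr fun γ => u.2.2 γ γ.2
  apply Subtype.ext
  apply AEEqFun.ext
  filter_upwards [h1, h2, AEEqFun.coeFn_zero (α := ℂ) (β := C2) (μ := volume)] with z h3 h4 h5
  rw [show ((0 : L2 p) : ℂ →ₘ[volume] C2) = 0 from rfl, h5]
  obtain ⟨γ, hγ, -⟩ := ZSpan.exist_unique_vadd_mem_fundamentalDomain periods.basis z
  have hγ' : (γ : ℂ) ∈ lattice := by
    rw [lattice, PeriodPair.lattice_eq_span_range_basis]; exact γ.2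
  have hz : z + (γ : ℂ) ∈ cell := by
    rw [add_comm]; exact hγ
  have h6 := h4 ⟨γ, hγ'⟩
  have h7 := h3 ⟨γ, hγ'⟩ hz
  simp only [translate, h7, map_zero] at h6
  simpa using (smul_eq_zero.mp h6.symm).resolve_left (exp_ne_zero _)

/-- The norm of `L²_p` is the `L²` norm over a fundamental cell. -/
instance (p : ℂ) : NormedAddCommGroup (L2 p) :=
  NormedAddCommGroup.induced (L2 p) (Lp C2 2 (volume.restrict cell)) (restrictCell p)
    (restrictCell_injective p)

instance (p : ℂ) : NormedSpace ℂ (L2 p) :=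
  NormedSpace.induced ℂ (L2 p) (Lp C2 2 (volume.restrict cell)) (restrictCell p)

/-! ### Multiplication operators -/

theorem translate_act {γ : ℂ} {M : ℂ → Matrix (Fin 2) (Fin 2) ℂ} {f : ℂ → C2}
    (h : ∀ z, twist γ * M (z + γ) = M z * twist γ) (z : ℂ) :
    translate γ (fun z => act (M z) (f z)) z = act (M z) (translate γ f z) := by
  simp only [translate, act]
  rw [← mul_apply_eq_comp, ← mul_apply_eq_comp, ← map_mul, ← map_mul, h z]

theorem QuasiPeriodic.act {p : ℂ} {M : ℂ → Matrix (Fin 2) (Fin 2) ℂ} {f : ℂ → C2}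
    (hM : ∀ γ ∈ lattice, ∀ z, twist γ * M (z + γ) = M z * twist γ) (hf : QuasiPeriodic p f) :
    QuasiPeriodic p (fun z => ChiralTBG.act (M z) (f z)) := by
  intro γ hγ
  filter_upwards [hf γ hγ] with z hz
  rw [translate_act (hM γ hγ), hz, map_smul]

theorem continuous_act {M : ℂ → Matrix (Fin 2) (Fin 2) ℂ} (hM : Continuous M) :
    Continuous fun z => act (M z) := by
  let e : Matrix (Fin 2) (Fin 2) ℂ →ₗ[ℂ] (C2 →L[ℂ] C2) :=
    { toFun := act, map_add' := fun a b => map_add _ a b, map_smul' := fun c a => map_smul _ c a }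
  have h : Continuous e := LinearMap.continuous_of_finiteDimensional _
  exact h.comp hM

theorem exists_bound_act {M : ℂ → Matrix (Fin 2) (Fin 2) ℂ} (hM : Continuous M) {S : Set ℂ}
    (hS : IsCompact S) : ∃ C : ℝ, ∀ z ∈ S, ‖act (M z)‖ ≤ C :=
  hS.exists_bound_of_continuousOn (continuous_act hM).continuousOn

theorem ae_bound_act {M : ℂ → Matrix (Fin 2) (Fin 2) ℂ} {f : ℂ → C2} {S : Set ℂ} {C : ℝ}
    (hS : MeasurableSet S) (h : ∀ z ∈ S, ‖act (M z)‖ ≤ C) :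
    ∀ᵐ z ∂(volume.restrict S), ‖act (M z) (f z)‖ ≤ C * ‖f z‖ := by
  filter_upwards [ae_restrict_mem hS] with z hz
  exact (act (M z)).le_of_opNorm_le (h z hz) _

theorem aestronglyMeasurable_act {M : ℂ → Matrix (Fin 2) (Fin 2) ℂ} (hM : Continuous M)
    {f : ℂ → C2} {μ : Measure ℂ} (hf : AEStronglyMeasurable f μ) :
    AEStronglyMeasurable (fun z => act (M z) (f z)) μ :=
  isBoundedBilinearMap_apply.continuous.comp_aestronglyMeasurable
    ((continuous_act hM).aestronglyMeasurable.prodMk hf)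

theorem LocL2.act {M : ℂ → Matrix (Fin 2) (Fin 2) ℂ} (hM : Continuous M) {f : ℂ → C2}
    (hf : LocL2 f) : LocL2 (fun z => ChiralTBG.act (M z) (f z)) := by
  intro S hS
  obtain ⟨C, hC⟩ := exists_bound_act hM hS
  exact (hf S hS).of_le_mul (aestronglyMeasurable_act hM (hf S hS).1)
    (ae_bound_act hS.measurableSet hC)

theorem norm_def {p : ℂ} (u : L2 p) :
    ‖u‖ = (eLpNorm u.1 2 (volume.restrict cell)).toReal := by
  change ‖u.2.1.memLp_cell.toLp u.1‖ = _
  rw [Lp.norm_toLp]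

/-- Multiplication `u ↦ M u` on `L²_p` by a continuous matrix function `M` commuting with every
`𝓛_γ`, as a linear map. -/
def mulLin (p : ℂ) (M : ℂ → Matrix (Fin 2) (Fin 2) ℂ) (hM : Continuous M)
    (hMγ : ∀ γ ∈ lattice, ∀ z, twist γ * M (z + γ) = M z * twist γ) : L2 p →ₗ[ℂ] L2 p where
  toFun u := L2.mk (fun z => act (M z) (u.1 z)) (u.2.1.act hM) (u.2.2.act hMγ)
  map_add' u v := by
    apply Subtype.ext
    apply AEEqFun.ext
    refine (L2.coeFn_mk _ _ _).trans (Filter.EventuallyEq.trans ?_ (AEEqFun.coeFn_add _ _).symm)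
    filter_upwards [AEEqFun.coeFn_add u.1 v.1,
      L2.coeFn_mk _ (u.2.1.act hM) (u.2.2.act hMγ),
      L2.coeFn_mk _ (v.2.1.act hM) (v.2.2.act hMγ)] with z h1 h2 h3
    rw [Pi.add_apply, h2, h3, Submodule.coe_add, h1, Pi.add_apply, map_add]
  map_smul' c u := by
    apply Subtype.ext
    apply AEEqFun.ext
    refine (L2.coeFn_mk _ _ _).trans (Filter.EventuallyEq.trans ?_ (AEEqFun.coeFn_smul _ _).symm)
    filter_upwards [AEEqFun.coeFn_smul c u.1,
      L2.coeFn_mk _ (u.2.1.act hM) (u.2.2.act hMγ)] with z h1 h2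
    rw [RingHom.id_apply, Pi.smul_apply, h2, Submodule.coe_smul, h1, Pi.smul_apply, map_smul]

theorem mulLin_bound (p : ℂ) (M : ℂ → Matrix (Fin 2) (Fin 2) ℂ) (hM : Continuous M)
    (hMγ : ∀ γ ∈ lattice, ∀ z, twist γ * M (z + γ) = M z * twist γ) :
    ∃ C : ℝ, ∀ u : L2 p, ‖mulLin p M hM hMγ u‖ ≤ C * ‖u‖ := by
  have hb : Bornology.IsBounded cell := ZSpan.fundamentalDomain_isBounded periods.basis
  have hmeas : MeasurableSet cell := ZSpan.fundamentalDomain_measurableSet periods.basis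
  obtain ⟨C, hC⟩ := exists_bound_act hM hb.isCompact_closure
  refine ⟨max C 0, fun u => ?_⟩
  rw [norm_def, norm_def]
  have h := eLpNorm_le_mul_eLpNorm_of_ae_le_mul (ae_bound_act (f := u.1) hmeas
    (fun z hz => (hC z (subset_closure hz)).trans (le_max_left C 0))) 2
  have h2 := ENNReal.toReal_mono
    (ENNReal.mul_ne_top ENNReal.ofReal_ne_top u.2.1.memLp_cell.2.ne) h
  rw [ENNReal.toReal_mul, ENNReal.toReal_ofReal (le_max_right C 0)] at h2
  have h3 : eLpNorm (mulLin p M hM hMγ u).1 2 (volume.restrict cell)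
      = eLpNorm (fun z => act (M z) (u.1 z)) 2 (volume.restrict cell) :=
    eLpNorm_congr_ae (ae_restrict_of_ae (L2.coeFn_mk _ (u.2.1.act hM) (u.2.2.act hMγ)))
  rw [h3]
  exact h2

/-- Multiplication by `M` as a bounded operator on `L²_p`. -/
def mulOp (p : ℂ) (M : ℂ → Matrix (Fin 2) (Fin 2) ℂ) (hM : Continuous M)
    (hMγ : ∀ γ ∈ lattice, ∀ z, twist γ * M (z + γ) = M z * twist γ) : L2 p →L[ℂ] L2 p :=
  (mulLin p M hM hMγ).mkContinuousOfExistsBound (mulLin_bound p M hM hMγ)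

/-- The potentials: `U_±(ωz) = ω U_±(z)` and `U_±(z + γ) = e^{±i⟨γ,K⟩} U_±(z)`, `γ ∈ Λ`. -/
structure Potential where
  Uplus : ℂ → ℂ
  Uminus : ℂ → ℂ
  continuous_plus : Continuous Uplus
  continuous_minus : Continuous Uminus
  rot_plus : ∀ z, Uplus (omega * z) = omega * Uplus z
  rot_minus : ∀ z, Uminus (omega * z) = omega * Uminus z
  translate_plus : ∀ γ ∈ lattice, ∀ z, Uplus (z + γ) = exp (I * pairing γ K) * Uplus z
  translate_minus : ∀ γ ∈ lattice, ∀ z, Uminus (z + γ) = exp (-(I * pairing γ K)) * Uminus z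

namespace Potential

/-- `V = [[0, U_+], [U_-, 0]]`. -/
def mat (V : Potential) (z : ℂ) : Matrix (Fin 2) (Fin 2) ℂ := !![0, V.Uplus z; V.Uminus z, 0]

theorem continuous_mat (V : Potential) : Continuous V.mat := by
  refine continuous_matrix fun i j => ?_
  fin_cases i <;> fin_cases j
  · exact continuous_const
  · exact V.continuous_plus
  · exact V.continuous_minus
  · exact continuous_const

theorem mat_translate (V : Potential) :
    ∀ γ ∈ lattice, ∀ z, twist γ * V.mat (z + γ) = V.mat z * twist γ := by
  intro γ hγ z
  have h3 := exp_three_pairing hγ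
  have h := exp_ne_zero (I * pairing γ K)
  simp only [twist, mat, V.translate_plus γ hγ, V.translate_minus γ hγ, exp_neg]
  ext i j
  fin_cases i <;> fin_cases j <;> simp [Matrix.mul_apply, Fin.sum_univ_two] <;> field_simp
  · linear_combination V.Uplus z * h3
  · linear_combination (-V.Uminus z) * h3

theorem mat_conjTranspose_translate (V : Potential) :
    ∀ γ ∈ lattice, ∀ z,
      twist γ * (V.mat (z + γ)).conjTranspose = (V.mat z).conjTranspose * twist γ := by
  intro γ hγ z
  have h3 := exp_three_pairing hγ
  have h := exp_ne_zero (I * pairing γ K)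
  simp only [twist, mat, V.translate_plus γ hγ, V.translate_minus γ hγ, exp_neg]
  ext i j
  fin_cases i <;> fin_cases j <;>
    simp [Matrix.mul_apply, Fin.sum_univ_two, ← exp_conj, exp_neg] <;> field_simp
  · linear_combination conj (V.Uminus z) * h3
  · linear_combination (-conj (V.Uplus z)) * h3

/-- Multiplication by `V` on `L²_p`. -/
def mul (V : Potential) (p : ℂ) : L2 p →L[ℂ] L2 p :=
  mulOp p V.mat V.continuous_mat V.mat_translate

/-- Multiplication by the adjoint matrix `V(z)*` on `L²_p`. -/
def mulStar (V : Potential) (p : ℂ) : L2 p →L[ℂ] L2 p :=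
  mulOp p (fun z => (V.mat z).conjTranspose) V.continuous_mat.matrix_conjTranspose
    V.mat_conjTranspose_translate

end Potential

/-! ### Weak derivatives and the spaces `H¹_p` -/

/-- `g` is the weak derivative of `f` in the direction `v`. -/
def HasWeakDeriv (v : ℂ) (f g : ℂ → C2) : Prop :=
  ∀ φ : ℂ → ℝ, ContDiff ℝ ∞ φ → HasCompactSupport φ →
    ∫ z, fderiv ℝ φ z v • f z = -∫ z, φ z • g z

theorem integrable_test {φ : ℂ → ℝ} (h1 : Continuous φ) (h2 : HasCompactSupport φ)
    {f : ℂ → C2} (hf : LocL2 f) : Integrable (fun z => φ z • f z) :=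
  hf.locallyIntegrable.integrable_smul_left_of_hasCompactSupport h1 h2

theorem integrable_test_fderiv {φ : ℂ → ℝ} (h1 : ContDiff ℝ ∞ φ) (h2 : HasCompactSupport φ)
    (v : ℂ) {f : ℂ → C2} (hf : LocL2 f) : Integrable (fun z => fderiv ℝ φ z v • f z) :=
  integrable_test ((h1.continuous_fderiv (by simp)).clm_apply continuous_const)
    (h2.fderiv_apply (𝕜 := ℝ) v) hf

theorem HasWeakDeriv.congr {v : ℂ} {f f' g g' : ℂ → C2} (h : HasWeakDeriv v f g)
    (hf : f =ᵐ[volume] f') (hg : g =ᵐ[volume] g') : HasWeakDeriv v f' g' := by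
  intro φ h1 h2
  have e1 : ∫ z, fderiv ℝ φ z v • f' z = ∫ z, fderiv ℝ φ z v • f z :=
    integral_congr_ae (by filter_upwards [hf] with z hz; rw [hz])
  have e2 : ∫ z, φ z • g' z = ∫ z, φ z • g z :=
    integral_congr_ae (by filter_upwards [hg] with z hz; rw [hz])
  rw [e1, e2, h φ h1 h2]

theorem HasWeakDeriv.add {v : ℂ} {f f' g g' : ℂ → C2} (h : HasWeakDeriv v f g)
    (h' : HasWeakDeriv v f' g') (hf : LocL2 f) (hf' : LocL2 f') (hg : LocL2 g) (hg' : LocL2 g') :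
    HasWeakDeriv v (f + f') (g + g') := by
  intro φ h1 h2
  simp only [Pi.add_apply, smul_add]
  rw [integral_add (integrable_test_fderiv h1 h2 v hf) (integrable_test_fderiv h1 h2 v hf'),
    integral_add (integrable_test h1.continuous h2 hg) (integrable_test h1.continuous h2 hg'),
    h φ h1 h2, h' φ h1 h2, neg_add]

theorem HasWeakDeriv.clm {v : ℂ} {f g : ℂ → C2} (h : HasWeakDeriv v f g) (hf : LocL2 f)
    (hg : LocL2 g) (A : C2 →L[ℂ] C2) : HasWeakDeriv v (fun z => A (f z)) (fun z => A (g z)) := by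
  intro φ h1 h2
  have e1 := A.integral_comp_comm (integrable_test_fderiv h1 h2 v hf)
  have e2 := A.integral_comp_comm (integrable_test h1.continuous h2 hg)
  simp only [A.map_smul_of_tower] at e1 e2
  rw [e1, e2, h φ h1 h2, map_neg]

theorem HasWeakDeriv.const_smul {v : ℂ} {f g : ℂ → C2} (h : HasWeakDeriv v f g) (hf : LocL2 f)
    (hg : LocL2 g) (c : ℂ) : HasWeakDeriv v (c • f) (c • g) :=
  h.clm hf hg (c • ContinuousLinearMap.id ℂ C2)

theorem HasWeakDeriv.comp_add {v : ℂ} {f g : ℂ → C2} (h : HasWeakDeriv v f g) (γ : ℂ) :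
    HasWeakDeriv v (fun z => f (z + γ)) (fun z => g (z + γ)) := by
  intro φ h1 h2
  have h3 := h (fun z => φ (z - γ)) (h1.comp (contDiff_id.sub contDiff_const))
    (h2.comp_homeomorph (Homeomorph.subRight γ))
  rw [← integral_add_right_eq_self _ γ, ← integral_add_right_eq_self (fun z => φ (z - γ) • g z) γ]
    at h3
  simpa [fderiv_comp_sub] using h3

theorem HasWeakDeriv.unique {v : ℂ} {f g g' : ℂ → C2} (h : HasWeakDeriv v f g)
    (h' : HasWeakDeriv v f g') (hg : LocL2 g) (hg' : LocL2 g') : g =ᵐ[volume] g' := by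
  have h0 := ae_eq_zero_of_integral_contDiff_smul_eq_zero (μ := volume) (f := g - g')
    (hg.locallyIntegrable.sub hg'.locallyIntegrable) (fun φ h1 h2 => by
      simp only [Pi.sub_apply, smul_sub]
      rw [integral_sub (integrable_test h1.continuous h2 hg)
        (integrable_test h1.continuous h2 hg'), sub_eq_zero, ← neg_inj, ← h φ h1 h2, h' φ h1 h2])
  filter_upwards [h0] with z hz
  exact sub_eq_zero.mp hz

theorem LocL2.comp_add {f : ℂ → C2} (hf : LocL2 f) (γ : ℂ) : LocL2 (fun z => f (z + γ)) := by
  intro S hS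
  have hS' : IsCompact ((fun z => z + γ) '' S) := hS.image (by fun_prop)
  have hmp : MeasurePreserving (fun z : ℂ => z + γ) (volume.restrict S)
      (volume.restrict ((fun z => z + γ) '' S)) :=
    (measurePreserving_add_right volume γ).restrict_image_emb
      (MeasurableEquiv.addRight γ).measurableEmbedding S
  exact (hf _ hS').comp_measurePreserving hmp

theorem LocL2.clm {f : ℂ → C2} (hf : LocL2 f) (A : C2 →L[ℂ] C2) : LocL2 (fun z => A (f z)) :=
  fun S hS => A.comp_memLp' (hf S hS)

theorem QuasiPeriodic.hasWeakDeriv {p v : ℂ} {f g : ℂ → C2} (hq : QuasiPeriodic p f)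
    (h : HasWeakDeriv v f g) (hf : LocL2 f) (hg : LocL2 g) : QuasiPeriodic p g := by
  intro γ hγ
  have h1 : HasWeakDeriv v (translate γ f) (translate γ g) :=
    (h.comp_add γ).clm (hf.comp_add γ) (hg.comp_add γ) _
  have h2 : HasWeakDeriv v (exp (I * pairing p γ) • f) (exp (I * pairing p γ) • g) :=
    h.const_smul hf hg _
  exact (h1.congr (hq γ hγ) Filter.EventuallyEq.rfl).unique h2
    ((hg.comp_add γ).clm _) (hg.const_smul _)

/-- `H¹_p = L²_p ∩ H¹_loc`: the `u ∈ L²_p` whose weak derivatives are in `L²_loc`. -/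
def H1 (p : ℂ) : Submodule ℂ (L2 p) where
  carrier := {u | ∀ v : ℂ, ∃ g : ℂ → C2, LocL2 g ∧ HasWeakDeriv v u.1 g}
  zero_mem' v := by
    refine ⟨0, fun S _ => MemLp.zero, ?_⟩
    refine HasWeakDeriv.congr (f := 0) (g := 0) (fun φ _ _ => by simp) ?_ Filter.EventuallyEq.rfl
    exact (AEEqFun.coeFn_zero (α := ℂ) (β := C2) (μ := volume)).symm
  add_mem' {a b} ha hb v := by
    obtain ⟨g, hg, h⟩ := ha v
    obtain ⟨g', hg', h'⟩ := hb v
    exact ⟨g + g', hg.add hg', (h.add h' a.2.1 b.2.1 hg hg').congr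
      (AEEqFun.coeFn_add a.1 b.1).symm Filter.EventuallyEq.rfl⟩
  smul_mem' c a ha v := by
    obtain ⟨g, hg, h⟩ := ha v
    exact ⟨c • g, hg.const_smul c, (h.const_smul a.2.1 hg c).congr
      (AEEqFun.coeFn_smul c a.1).symm Filter.EventuallyEq.rfl⟩

theorem exists_weakDeriv {p : ℂ} (v : ℂ) (u : H1 p) :
    ∃ g : L2 p, HasWeakDeriv v u.1.1 g.1 := by
  obtain ⟨g, hg, h⟩ := u.2 v
  have hq := u.1.2.2.hasWeakDeriv h u.1.2.1 hg
  exact ⟨L2.mk g hg hq, h.congr Filter.EventuallyEq.rfl (L2.coeFn_mk g hg hq).symm⟩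

theorem weakDeriv_unique {p v : ℂ} {f : ℂ → C2} {g g' : L2 p} (h : HasWeakDeriv v f g.1)
    (h' : HasWeakDeriv v f g'.1) : g = g' :=
  Subtype.ext (AEEqFun.ext (h.unique h' g.2.1 g'.2.1))

/-- The weak derivative in the direction `v`, as a map `H¹_p → L²_p`. -/
def weakDeriv (p v : ℂ) : H1 p →ₗ[ℂ] L2 p where
  toFun u := (exists_weakDeriv v u).choose
  map_add' a b := by
    refine weakDeriv_unique (exists_weakDeriv v (a + b)).choose_spec ?_
    exact ((exists_weakDeriv v a).choose_spec.add (exists_weakDeriv v b).choose_spec a.1.2.1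
      b.1.2.1 (exists_weakDeriv v a).choose.2.1 (exists_weakDeriv v b).choose.2.1).congr
      (AEEqFun.coeFn_add _ _).symm (AEEqFun.coeFn_add _ _).symm
  map_smul' c a := by
    refine weakDeriv_unique (exists_weakDeriv v (c • a)).choose_spec ?_
    exact ((exists_weakDeriv v a).choose_spec.const_smul a.1.2.1
      (exists_weakDeriv v a).choose.2.1 c).congr
      (AEEqFun.coeFn_smul _ _).symm (AEEqFun.coeFn_smul _ _).symm

theorem hasWeakDeriv_weakDeriv {p : ℂ} (v : ℂ) (u : H1 p) :
    HasWeakDeriv v u.1.1 (weakDeriv p v u).1 :=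
  (exists_weakDeriv v u).choose_spec

/-! ### Unbounded operators -/

section Unbounded

variable {E : Type*} [NormedAddCommGroup E] [NormedSpace ℂ E]

/-- `R` is a bounded two-sided inverse of `A - z : Dom A → E`. -/
def IsResolventAt (A : E →ₗ.[ℂ] E) (z : ℂ) (R : E →L[ℂ] E) : Prop :=
  (∀ f : E, ∃ h : R f ∈ A.domain, A ⟨R f, h⟩ - z • R f = f) ∧
    ∀ u : A.domain, R (A u - z • (u : E)) = u

/-- The resolvent set of an unbounded operator. -/
def resolventSetOf (A : E →ₗ.[ℂ] E) : Set ℂ := {z | ∃ R : E →L[ℂ] E, IsResolventAt A z R}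

/-- The spectrum of an unbounded operator. -/
def Spec (A : E →ₗ.[ℂ] E) : Set ℂ := (resolventSetOf A)ᶜ

open Classical in
/-- `(A - z)⁻¹` for `z` in the resolvent set (and `0` otherwise). -/
def resolventOf (A : E →ₗ.[ℂ] E) (z : ℂ) : E →L[ℂ] E :=
  if h : z ∈ resolventSetOf A then h.choose else 0

/-- `ker (A - z)ⁿ`, with its natural domain. -/
def genKer (A : E →ₗ.[ℂ] E) (z : ℂ) : ℕ → Submodule ℂ E
  | 0 => ⊥
  | n + 1 => ((genKer A z n).comap (A.toFun - z • A.domain.subtype)).map A.domain.subtype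

/-- `z` is an eigenvalue of algebraic multiplicity one: the space `⋃ₙ ker (A - z)ⁿ` of
generalized eigenvectors is one-dimensional. -/
def IsSimpleEigenvalue (A : E →ₗ.[ℂ] E) (z : ℂ) : Prop :=
  Module.finrank ℂ (⨆ n, genKer A z n : Submodule ℂ E) = 1

end Unbounded

/-! ### The operators of the chiral model -/

/-- `2D_z̄ = -i(∂_x + i∂_y) : H¹_p → L²_p`. -/
def dbarMap (p : ℂ) : H1 p →ₗ[ℂ] L2 p := (-I) • (weakDeriv p 1 + I • weakDeriv p I)

/-- `2D_z = -i(∂_x - i∂_y) : H¹_p → L²_p`. -/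
def dMap (p : ℂ) : H1 p →ₗ[ℂ] L2 p := (-I) • (weakDeriv p 1 - I • weakDeriv p I)

/-- `2D_z̄` on `L²_p`, with domain `H¹_p`. -/
def twoDbar (p : ℂ) : L2 p →ₗ.[ℂ] L2 p where
  domain := H1 p
  toFun := dbarMap p

/-- `D_V(α) = 2D_z̄ + αV` on `L²_p`, with domain `H¹_p`. -/
def D (V : Potential) (α p : ℂ) : L2 p →ₗ.[ℂ] L2 p where
  domain := H1 p
  toFun := dbarMap p + α • (V.mul p).toLinearMap.comp (H1 p).subtype

/-- `D_V(α)* = 2D_z + ᾱV*` on `L²_p`, with domain `H¹_p`. -/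
def Dstar (V : Potential) (α p : ℂ) : L2 p →ₗ.[ℂ] L2 p where
  domain := H1 p
  toFun := dMap p + conj α • (V.mulStar p).toLinearMap.comp (H1 p).subtype

/-- `H(α) = [[0, D_V(α)*], [D_V(α), 0]]` on `L²_k(ℂ/Λ; ℂ⁴) = L²_k(ℂ/Λ; ℂ²) × L²_k(ℂ/Λ; ℂ²)`, with
domain `H¹_k(ℂ/Λ; ℂ⁴)`: the map `(u, v) ↦ (D_V(α)* v, D_V(α) u)`. -/
def H (V : Potential) (α k : ℂ) : (L2 k × L2 k) →ₗ.[ℂ] (L2 k × L2 k) where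
  domain := (H1 k).prod (H1 k)
  toFun :=
    { toFun := fun w => (Dstar V α k ⟨w.1.2, w.2.2⟩, D V α k ⟨w.1.1, w.2.1⟩)
      map_add' := fun a b => Prod.ext
        ((Dstar V α k).map_add ⟨a.1.2, a.2.2⟩ ⟨b.1.2, b.2.2⟩)
        ((D V α k).map_add ⟨a.1.1, a.2.1⟩ ⟨b.1.1, b.2.1⟩)
      map_smul' := fun c a => Prod.ext
        ((Dstar V α k).map_smul c ⟨a.1.2, a.2.2⟩)
        ((D V α k).map_smul c ⟨a.1.1, a.2.1⟩) }

/-- `E₁(α, k)`: the smallest non-negative eigenvalue of `H(α)` on `L²_k(ℂ/Λ; ℂ⁴)`. -/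
def E1 (V : Potential) (α k : ℂ) : ℝ :=
  sInf {E : ℝ | 0 ≤ E ∧ ∃ w : (H V α k).domain, w ≠ 0 ∧
    H V α k w = (E : ℂ) • (w : L2 k × L2 k)}

/-- The magic set `𝒜(V)`: the first band is identically zero. -/
def magicSet (V : Potential) : Set ℂ := {α | ∀ k, E1 V α k = 0}

/-- `T_k = R(k) V` on `L²_p`, with `R(k) = (2D_z̄ - k)⁻¹`. -/
def T (V : Potential) (p k : ℂ) : L2 p →L[ℂ] L2 p := (resolventOf (twoDbar p) k).comp (V.mul p)

end ChiralTBG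
end

/-!
In the Hilbert basis of plane waves, `L²_p` becomes `ℓ²(𝒦₀)`, the operator `2D_z̄` becomes
multiplication by the frequency `j + p`, and multiplication by `V` becomes one bounded matrix `W`
for all `p`. So `D_V(α) - z` on `L²_p` is `A + αW - k` with `k = z - p`, where `A` is diagonal with
compact inverse `S` because `0 ∉ 𝒦₀`. It is invertible exactly if the pencil `1 + S(αW - k)` is,
and otherwise `k` is an eigenvalue of `A + αW`.

Every point of `𝒦₀` is an eigenvalue of `A + αW` for all `α`: this follows from
`U_±(ωz) = ωU_±(z)`, by which `W` commutes, up to a factor `ω`, with the rotations about the points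
of `𝒦₀`.

The heart of the matter is a dichotomy: if `A + αW - k` is invertible for a single `k`, then its
spectrum is exactly `𝒦₀`, with simple eigenvalues. Both `A` and `W` are skew for the bilinear form
`B(u, v) = ∫ det (u, v)`, so that eigenvectors at `k` and `k'` are `B`-orthogonal unless
`k' = -k`. Call `α` good if the spectrum is contained in `𝒦₀` and `B(x, y) ≠ 0` for all
eigenvectors `x` at `k` and `y` at `-k`; this contains `α = 0`, and it makes the eigenvalues simple.
By compactness and the `Λ*`-periodicity in `k`, the good set is open. For good `α` the resolvent has
simple poles whose residues have rank one, and these residues converge as `α` approaches a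
parameter for which the spectrum is discrete; hence the good set is also closed among those
parameters, which are connected since only countably many are left out.

The operators `T_k` have the eigenvalue `-1/α` exactly if `A + αW` has the eigenvalue `k - p`, and
the sign drops out on conjugating with `diag (1, -1)`. The non-negative eigenvalues of `H(α)` are
the reciprocals of the singular values of `(A + αW + k)⁻¹` if this exists, and contain `0`
otherwise.
-/

noncomputable section

namespace ChiralTBG

/-! ### Compact perturbations of the identity -/

section CompactOperators

open Filter Topology Module.End

variable {E : Type*} [NormedAddCommGroup E] [NormedSpace ℂ E]

theorem exists_seq_norm_eq_one_le_norm_sub {F : ℕ → Submodule ℂ E} (hF : StrictMono F)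
    (hFc : ∀ n, IsClosed (F n : Set E)) {r : ℝ} (hr : r < 1) :
    ∃ y : ℕ → E, ∀ n, y n ∈ F (n + 1) ∧ ‖y n‖ = 1 ∧ ∀ w ∈ F n, r ≤ ‖y n - w‖ := by
  suffices h : ∀ n, ∃ y ∈ F (n + 1), ‖y‖ = 1 ∧ ∀ w ∈ F n, r ≤ ‖y - w‖ from Classical.skolem.mp h
  intro n
  obtain ⟨x, hx, hxn⟩ := SetLike.exists_of_lt (hF n.lt_succ_self)
  obtain ⟨y, -, hy, hyr⟩ := riesz_lemma_of_lt_one (𝕜 := ℂ) (E := F (n + 1))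
    (F := (F n).comap (F (n + 1)).subtype) ((hFc n).preimage continuous_subtype_val)
    ⟨⟨x, hx⟩, hxn⟩ hr
  exact ⟨y, y.2, hy, fun w hw => hyr ⟨w, hF.monotone n.le_succ hw⟩ hw⟩

theorem not_isCompactOperator_of_separated {C : E →L[ℂ] E} {y : ℕ → E} (hy : ∀ n, ‖y n‖ = 1)
    {ε : ℝ} (hε : 0 < ε) (hsep : ∀ m n, m < n → ε ≤ ‖C (y n) - C (y m)‖) :
    ¬ IsCompactOperator C := by
  intro hC
  obtain ⟨Q, hQ, hQ'⟩ := hC.image_closedBall_subset_compact 1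
  obtain ⟨z, -, φ, hφ, hz⟩ := hQ.tendsto_subseq (x := fun n => C (y n))
    (fun n => hQ' ⟨y n, by simp [hy n], rfl⟩)
  obtain ⟨N, hN⟩ := Metric.cauchySeq_iff'.mp hz.cauchySeq ε hε
  have hclose := hN (N + 1) N.le_succ
  rw [dist_eq_norm] at hclose
  exact (hsep _ _ (hφ N.lt_succ_self)).not_gt hclose

theorem not_isCompactOperator_of_hasEigenvector {C : E →L[ℂ] E} {μ : ℕ → ℂ} {v : ℕ → E}
    (hμ : Function.Injective μ) (hv : ∀ n, HasEigenvector (C : Module.End ℂ E) (μ n) (v n))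
    {ε : ℝ} (hε : 0 < ε) (hεμ : ∀ n, ε ≤ ‖μ n‖) : ¬ IsCompactOperator C := by
  have hli : LinearIndependent ℂ v := eigenvectors_linearIndependent' _ μ hμ v hv
  have hCv (n : ℕ) : C (v n) = μ n • v n := (hv n).apply_eq_smul
  let F (n : ℕ) : Submodule ℂ E := Submodule.span ℂ (v '' Set.Iio n)
  have hvF {m n : ℕ} (h : m < n) : v m ∈ F n := Submodule.subset_span ⟨m, h, rfl⟩
  have hF : StrictMono F := strictMono_nat_of_lt_succ fun n =>
    (Submodule.span_mono (Set.image_mono (Set.Iio_subset_Iio n.le_succ))).lt_of_not_ge fun hle =>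
      hli.notMem_span_image (s := Set.Iio n) (by simp) (hle (hvF n.lt_succ_self))
  have hFc (n : ℕ) : IsClosed (F n : Set E) :=
    have : FiniteDimensional ℂ (F n) :=
      FiniteDimensional.span_of_finite ℂ ((Set.finite_Iio n).image v)
    (F n).closed_of_finiteDimensional
  have hCF (n : ℕ) : F n ≤ (F n).comap (C : E →ₗ[ℂ] E) := Submodule.span_le.mpr <| by
    rintro _ ⟨m, hm, rfl⟩
    exact (congrArg (· ∈ F n) (hCv m)).mpr ((F n).smul_mem _ (hvF hm))
  have hsub (n : ℕ) : F (n + 1) ≤ (F n).comap ((C : E →ₗ[ℂ] E) - μ n • 1) :=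
    Submodule.span_le.mpr <| by
      rintro _ ⟨m, hm, rfl⟩
      have heq : C (v m) - μ n • v m = (μ m - μ n) • v m := by rw [hCv, sub_smul]
      change C (v m) - μ n • v m ∈ F n
      rcases (Nat.lt_succ_iff.mp hm).lt_or_eq with hmn | rfl
      · exact heq ▸ (F n).smul_mem _ (hvF hmn)
      · simp [heq]
  obtain ⟨y, hy⟩ := exists_seq_norm_eq_one_le_norm_sub hF hFc one_half_lt_one
  refine not_isCompactOperator_of_separated (fun n => (hy n).2.1) (half_pos hε) fun m n hmn => ?_
  have hμn : μ n ≠ 0 := norm_pos_iff.mp (hε.trans_le (hεμ n))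
  let w := (μ n)⁻¹ • (C (y m) - (C (y n) - μ n • y n))
  have hw : w ∈ F n := (F n).smul_mem _ <| (F n).sub_mem
    (hCF n (hF.monotone hmn (hy m).1)) (hsub n (hy n).1)
  have hCy : C (y n) - C (y m) = μ n • (y n - w) := by
    rw [smul_sub, smul_inv_smul₀ hμn]
    module
  calc ε / 2 = ε * (1 / 2) := by ring
    _ ≤ ‖μ n‖ * ‖y n - w‖ := by gcongr; exacts [hεμ n, (hy n).2.2 w hw]
    _ = ‖C (y n) - C (y m)‖ := by rw [hCy, norm_smul]

theorem finite_eigenvalues_of_le_norm {C : E →L[ℂ] E} (hC : IsCompactOperator C) {ε : ℝ}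
    (hε : 0 < ε) : {μ : ℂ | ε ≤ ‖μ‖ ∧ HasEigenvalue (C : Module.End ℂ E) μ}.Finite := by
  by_contra hinf
  let μ := Set.Infinite.natEmbedding _ hinf
  choose v hv using fun n => (μ n).2.2.exists_hasEigenvector
  exact not_isCompactOperator_of_hasEigenvector (Subtype.val_injective.comp μ.injective) hv hε
    (fun n => (μ n).2.1) hC

variable [CompleteSpace E]

theorem isUnit_one_add_iff {C : E →L[ℂ] E} (hC : IsCompactOperator C) :
    IsUnit (1 + C) ↔ ∀ x, x + C x = 0 → x = 0 := by
  refine ⟨fun hu x hx => (ContinuousLinearMap.isUnit_iff_bijective.mp hu).injective ?_, fun h => ?_⟩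
  · simpa using hx
  · rcases hC.hasEigenvalue_or_mem_resolventSet (μ := -1) (by simp) with hev | hres
    · obtain ⟨v, hv⟩ := hev.exists_hasEigenvector
      have hCv : C v = (-1 : ℂ) • v := hv.apply_eq_smul
      exact absurd (h v (by rw [hCv]; module)) hv.2
    · rw [spectrum.mem_resolventSet_iff, ← IsUnit.neg_iff] at hres
      convert hres using 1
      simp [add_comm]

theorem finite_not_isUnit_one_add_smul {C : E →L[ℂ] E} (hC : IsCompactOperator C) (R : ℝ) :
    {t : ℂ | ‖t‖ ≤ R ∧ ¬ IsUnit (1 + t • C)}.Finite := by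
  have hR : 0 < max R 1 := lt_max_of_lt_right one_pos
  refine ((finite_eigenvalues_of_le_norm hC (inv_pos.mpr hR)).image fun μ => -μ⁻¹).subset ?_
  rintro t ⟨ht, hu⟩
  rw [isUnit_one_add_iff (hC.smul t)] at hu
  push Not at hu
  obtain ⟨x, hx, hx0⟩ := hu
  have ht0 : t ≠ 0 := by
    rintro rfl
    exact hx0 (by simpa using hx)
  refine ⟨-t⁻¹, ⟨?_, hasEigenvalue_of_hasEigenvector ⟨mem_eigenspace_iff.mpr ?_, hx0⟩⟩, by simp⟩
  · rw [norm_neg, norm_inv]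
    exact inv_anti₀ (norm_pos_iff.mpr ht0) (ht.trans (le_max_left _ _))
  · have htx : t • C x = -x := by rwa [eq_neg_iff_add_eq_zero, add_comm]
    change C x = -t⁻¹ • x
    rw [neg_smul, ← smul_neg, ← htx, inv_smul_smul₀ ht0]

theorem countable_not_isUnit_one_add_smul {C : E →L[ℂ] E} (hC : IsCompactOperator C) :
    {t : ℂ | ¬ IsUnit (1 + t • C)}.Countable := by
  refine (Set.countable_iUnion fun n : ℕ =>
    (finite_not_isUnit_one_add_smul hC n).countable).mono fun t ht => ?_
  obtain ⟨n, hn⟩ := exists_nat_ge ‖t‖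
  exact Set.mem_iUnion.mpr ⟨n, hn, ht⟩

end CompactOperators

section Pencil

open Filter Topology

variable {E : Type*} [NormedAddCommGroup E] [NormedSpace ℂ E]

theorem exists_tendsto_subseq_one_add {C : E →L[ℂ] E} (hC : IsCompactOperator C)
    {x : ℕ → E} (hx : ∀ n, ‖x n‖ = 1) (h : Tendsto (fun n => x n + C (x n)) atTop (𝓝 0)) :
    ∃ (y : E) (φ : ℕ → ℕ), StrictMono φ ∧ Tendsto (x ∘ φ) atTop (𝓝 y) ∧ ‖y‖ = 1 ∧
      y + C y = 0 := by
  obtain ⟨Q, hQ, hQ'⟩ := hC.image_closedBall_subset_compact 1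
  obtain ⟨z, -, φ, hφ, hz⟩ := hQ.tendsto_subseq (x := fun n => C (x n))
    (fun n => hQ' ⟨x n, by simp [hx n], rfl⟩)
  have hlim : Tendsto (x ∘ φ) atTop (𝓝 (-z)) := by
    simpa [Function.comp_def] using (h.comp hφ.tendsto_atTop).sub hz
  refine ⟨-z, φ, hφ, hlim, tendsto_nhds_unique hlim.norm (by simp [hx]), ?_⟩
  exact tendsto_nhds_unique (hlim.add ((C.continuous.tendsto _).comp hlim))
    (h.comp hφ.tendsto_atTop)

/-- `1 + S(aV - k)`. For `S = A⁻¹` this is `A⁻¹(A + aV - k)`, so that the kernel of the unbounded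
operator `A + aV - k` is the kernel of a bounded one. -/
def pencil (S V : E →L[ℂ] E) (a k : ℂ) : E →L[ℂ] E := 1 + S * (a • V - k • 1)

/-- The resolvent `(A + aV - k)⁻¹`, where `S = A⁻¹`; it is zero at the points of the spectrum. -/
def pencilResolvent (S V : E →L[ℂ] E) (a k : ℂ) : E →L[ℂ] E :=
  Ring.inverse (pencil S V a k) * S

variable {S V : E →L[ℂ] E}

theorem pencil_apply (a k : ℂ) (x : E) : pencil S V a k x = x + S (a • V x - k • x) := by
  simp [pencil]

theorem continuous_pencil : Continuous fun z : ℂ × ℂ => pencil S V z.1 z.2 := by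
  unfold pencil
  fun_prop

theorem differentiable_pencil (a : ℂ) : Differentiable ℂ (pencil S V a) := by
  unfold pencil
  fun_prop

theorem tendsto_pencil_apply {ι : Type*} {l : Filter ι} {b m : ι → ℂ} {x : ι → E} {a k : ℂ} {y : E}
    (hb : Tendsto b l (𝓝 a)) (hm : Tendsto m l (𝓝 k)) (hx : Tendsto x l (𝓝 y)) :
    Tendsto (fun i => pencil S V (b i) (m i) (x i)) l (𝓝 (pencil S V a k y)) :=
  (isBoundedBilinearMap_apply.continuous.tendsto (pencil S V a k, y)).comp
    (((continuous_pencil.tendsto (a, k)).comp (hb.prodMk_nhds hm)).prodMk_nhds hx)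

theorem pencil_pencilResolvent {a k : ℂ} (h : IsUnit (pencil S V a k)) :
    pencil S V a k * pencilResolvent S V a k = S := by
  rw [pencilResolvent, ← mul_assoc, Ring.mul_inverse_cancel _ h, one_mul]

theorem pencil_pencilResolvent_apply {a k : ℂ} (h : IsUnit (pencil S V a k)) (f : E) :
    pencil S V a k (pencilResolvent S V a k f) = S f :=
  congrArg (· f) (pencil_pencilResolvent h)

theorem pencil_eq_mul {a k : ℂ} (h : IsUnit (pencil S V a k)) (b l : ℂ) :
    pencil S V b l =
      pencil S V a k * (1 + pencilResolvent S V a k * ((b - a) • V - (l - k) • 1)) := by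
  rw [mul_add, mul_one, ← mul_assoc, pencil_pencilResolvent h, pencil, pencil, add_assoc,
    ← mul_add]
  congr 2
  module

theorem pencil_smul_inv_norm {a k : ℂ} {x : E} (hx : x ≠ 0) (h : pencil S V a k x = 0) :
    ‖(‖x‖⁻¹ : ℂ) • x‖ = 1 ∧ pencil S V a k ((‖x‖⁻¹ : ℂ) • x) = 0 :=
  ⟨by simp [norm_smul, hx], by rw [map_smul, h, smul_zero]⟩

theorem exists_tendsto_subseq_pencil (hS : IsCompactOperator S) {a k : ℂ} {b m : ℕ → ℂ}
    (hb : Tendsto b atTop (𝓝 a)) (hm : Tendsto m atTop (𝓝 k)) {x : ℕ → E} (hx : ∀ n, ‖x n‖ = 1)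
    (h : Tendsto (fun n => pencil S V (b n) (m n) (x n)) atTop (𝓝 0)) :
    ∃ (y : E) (φ : ℕ → ℕ), StrictMono φ ∧ Tendsto (x ∘ φ) atTop (𝓝 y) ∧ y ≠ 0 ∧
      pencil S V a k y = 0 := by
  have hdiff : Tendsto (fun n => (pencil S V a k - pencil S V (b n) (m n)) (x n)) atTop (𝓝 0) := by
    have hop : Tendsto (fun n => ‖pencil S V a k - pencil S V (b n) (m n)‖) atTop (𝓝 0) := by
      simpa using ((tendsto_const_nhds (x := pencil S V a k)).sub
        ((continuous_pencil (S := S) (V := V) |>.tendsto (a, k)).comp (hb.prodMk_nhds hm))).norm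
    refine squeeze_zero_norm (fun n => ?_) hop
    simpa [hx n] using (pencil S V a k - pencil S V (b n) (m n)).le_opNorm (x n)
  obtain ⟨y, φ, hφ, hlim, hy, hker⟩ := exists_tendsto_subseq_one_add
    (C := S * (a • V - k • 1)) (hS.comp_clm _) hx (by simpa [pencil_apply] using h.add hdiff)
  exact ⟨y, φ, hφ, hlim, norm_ne_zero_iff.mp (hy ▸ one_ne_zero),
    by simpa [pencil_apply] using hker⟩

variable [CompleteSpace E]

theorem isUnit_pencil_iff (hS : IsCompactOperator S) {a k : ℂ} :
    IsUnit (pencil S V a k) ↔ ∀ x, pencil S V a k x = 0 → x = 0 :=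
  isUnit_one_add_iff (C := S * (a • V - k • 1)) (hS.comp_clm _)

theorem not_isUnit_pencil_iff (hS : IsCompactOperator S) {a k : ℂ} :
    ¬ IsUnit (pencil S V a k) ↔ ∃ x ≠ 0, pencil S V a k x = 0 := by
  simp [isUnit_pencil_iff hS, and_comm]

theorem continuousAt_pencilResolvent {z : ℂ × ℂ} (h : IsUnit (pencil S V z.1 z.2)) :
    ContinuousAt (fun z : ℂ × ℂ => pencilResolvent S V z.1 z.2) z := by
  obtain ⟨u, hu⟩ := h
  have hinv := NormedRing.inverse_continuousAt u
  rw [hu] at hinv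
  exact (ContinuousAt.comp (f := fun z : ℂ × ℂ => pencil S V z.1 z.2) hinv
    continuous_pencil.continuousAt).mul continuousAt_const

theorem differentiableAt_pencilResolvent {a k : ℂ} (h : IsUnit (pencil S V a k)) :
    DifferentiableAt ℂ (pencilResolvent S V a) k :=
  ((differentiableAt_inverse h).comp k (differentiable_pencil a k)).mul_const S

theorem countable_not_isUnit_pencil (hS : IsCompactOperator S) {a k : ℂ}
    (h : IsUnit (pencil S V a k)) : {b | ¬ IsUnit (pencil S V b k)}.Countable := by
  have hC : IsCompactOperator (pencilResolvent S V a k * V) := (hS.clm_comp _).comp_clm V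
  refine ((countable_not_isUnit_one_add_smul hC).image (· + a)).mono ?_
  refine fun b hb => ⟨b - a, fun hu => hb ?_, sub_add_cancel b a⟩
  rw [pencil_eq_mul h b k, sub_self, zero_smul, sub_zero, mul_smul_comm]
  exact h.mul hu

theorem finite_not_isUnit_pencil (hS : IsCompactOperator S) {a k : ℂ}
    (h : IsUnit (pencil S V a k)) (R : ℝ) :
    {l | ‖l - k‖ ≤ R ∧ ¬ IsUnit (pencil S V a l)}.Finite := by
  have hC : IsCompactOperator (pencilResolvent S V a k) := hS.clm_comp _
  refine ((finite_not_isUnit_one_add_smul hC R).image (k - ·)).subset ?_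
  rintro l ⟨hl, hlu⟩
  refine ⟨k - l, ⟨by rwa [norm_sub_rev], fun hu => hlu ?_⟩, sub_sub_cancel k l⟩
  rw [pencil_eq_mul h a l, sub_self, zero_smul, zero_sub, ← neg_smul, neg_sub, mul_smul_comm,
    mul_one]
  exact h.mul hu

theorem eventually_isUnit_pencil (hS : IsCompactOperator S) {a k : ℂ}
    (h : IsUnit (pencil S V a k)) (c : ℂ) : ∀ᶠ l in 𝓝[≠] c, IsUnit (pencil S V a l) := by
  filter_upwards [nhdsNE_le_cofinite c
      (finite_not_isUnit_pencil hS h (‖c - k‖ + 1)).compl_mem_cofinite,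
    nhdsWithin_le_nhds (Metric.closedBall_mem_nhds c one_pos)] with l hl hlc
  refine not_not.mp (not_and.mp hl ?_)
  linarith [norm_sub_le_norm_sub_add_norm_sub l c k, mem_closedBall_iff_norm.mp hlc]

end Pencil

/-! ### Rigidity of the spectrum of a skew pencil -/

section Rigidity

open Filter Topology

theorem norm_le_of_tendsto_punctured {F : Type*} [NormedAddCommGroup F] [NormedSpace ℂ F]
    [CompleteSpace F] {f : ℂ → F} {c : ℂ} {r : ℝ} (hr : 0 < r)
    (hf : ∀ z ∈ Metric.closedBall c r \ {c}, DifferentiableAt ℂ f z) {L : F}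
    (hL : Tendsto f (𝓝[≠] c) (𝓝 L)) {M : ℝ} (hM : ∀ z ∈ Metric.sphere c r, ‖f z‖ ≤ M) :
    ‖L‖ ≤ M := by
  have hcauchy := circleIntegral_sub_center_inv_smul_of_differentiable_on_off_countable_of_tendsto
    hr Set.countable_empty (fun z hz => (hf z hz).continuousAt.continuousWithinAt)
    (fun z hz => hf z ⟨Metric.ball_subset_closedBall hz.1.1, hz.1.2⟩) hL
  have hbound := circleIntegral.norm_two_pi_i_inv_smul_integral_le_of_norm_le_const
    (f := fun z => (z - c)⁻¹ • f z) (C := r⁻¹ * M) hr.le fun z hz => by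
      rw [norm_smul, norm_inv, mem_sphere_iff_norm.mp hz]
      gcongr
      exact hM z hz
  rwa [hcauchy, inv_smul_smul₀ two_pi_I_ne_zero, mul_inv_cancel_left₀ hr.ne'] at hbound

theorem exists_seq_norm_apply_eq_one {ι E F : Type*} [NormedAddCommGroup E] [NormedSpace ℂ E]
    [NormedAddCommGroup F] [NormedSpace ℂ F] {l : Filter ι} [l.IsCountablyGenerated]
    {N : ι → E →L[ℂ] F} (h : ¬ ∃ M, ∀ᶠ i in l, ‖N i‖ ≤ M) :
    ∃ (i : ℕ → ι) (g : ℕ → E), Tendsto i atTop l ∧ Tendsto g atTop (𝓝 0) ∧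
      ∀ n, ‖N (i n) (g n)‖ = 1 := by
  push Not at h
  obtain ⟨s, hs⟩ := l.exists_antitone_basis
  have hlarge (n : ℕ) : ∃ i ∈ s n, ∃ f, ((n : ℝ) + 1) * ‖f‖ < ‖N i f‖ := by
    obtain ⟨i, hi, his⟩ := ((h (n + 1)).and_eventually (hs.mem n)).exists
    by_contra! hle
    exact hi.not_ge ((N i).opNorm_le_bound (by positivity) (hle i his))
  choose i his f hf using hlarge
  have hpos (n : ℕ) : 0 < ‖N (i n) (f n)‖ := lt_of_le_of_lt (by positivity) (hf n)
  refine ⟨i, fun n => (‖N (i n) (f n)‖⁻¹ : ℂ) • f n, hs.tendsto his,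
    squeeze_zero_norm (fun n => ?_) tendsto_one_div_add_atTop_nhds_zero_nat,
    fun n => by simp [norm_smul, (hpos n).ne']⟩
  rw [norm_smul, norm_inv, norm_real, norm_norm, inv_mul_eq_div,
    div_le_div_iff₀ (hpos n) (by positivity), one_mul, mul_comm]
  exact (hf n).le

variable {E : Type*} [NormedAddCommGroup E] [NormedSpace ℂ E]

/-- `k` is an eigenvalue of the pencil outside of `D`, or some eigenvector at `k` is orthogonal,
for the bilinear form `B`, to an eigenvector at `-k`. -/
def Degenerate (S V : E →L[ℂ] E) (D : Set ℂ) (B : E →L[ℂ] E →L[ℂ] ℂ) (a k : ℂ) : Prop :=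
  ∃ x ≠ 0, pencil S V a k x = 0 ∧ (k ∉ D ∨ ∃ y ≠ 0, pencil S V a (-k) y = 0 ∧ B x y = 0)

/-- The pencil of `A + aV - k`, `A = S⁻¹`, where `A` and `V` are skew with respect to a
nondegenerate bilinear form, the points of `D` are always eigenvalues, and the spectra are
periodic. -/
structure SkewPencil (S V : E →L[ℂ] E) (D : Set ℂ) (B : E →L[ℂ] E →L[ℂ] ℂ) : Prop where
  compact : IsCompactOperator S
  skew : ∀ a k k' w f y, pencil S V a k w = S f → pencil S V a k' y = 0 →
    B f y = -((k + k') * B w y)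
  nondeg : ∀ y ≠ 0, ∃ f, B f y ≠ 0
  eigenvalue : ∀ k ∈ D, ∀ a, ∃ x ≠ 0, pencil S V a k x = 0
  neg_mem : ∀ k ∈ D, -k ∈ D
  periodic : ∃ R : ℝ, ∀ k, ∃ k', ‖k'‖ ≤ R ∧ ∀ a, Degenerate S V D B a k → Degenerate S V D B a k'
  zero : ∀ k, ¬ Degenerate S V D B 0 k

/-- The residue at `c` of `k ↦ (A + aV - k)⁻¹`, which is minus the spectral projection if `c` is a
semisimple eigenvalue. -/
def residue (S V : E →L[ℂ] E) (a c : ℂ) : E →L[ℂ] E :=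
  limUnder (𝓝[≠] c) fun k => (k - c) • pencilResolvent S V a k

variable {S V : E →L[ℂ] E} {D : Set ℂ} {B : E →L[ℂ] E →L[ℂ] ℂ}

theorem tendsto_sub_nhdsNE_zero (c : ℂ) : Tendsto (fun k => k - c) (𝓝[≠] c) (𝓝 0) :=
  (continuous_sub_right c).tendsto' c 0 (sub_self c) |>.mono_left nhdsWithin_le_nhds

theorem eventually_nhdsNE_of_closedBall {p : ℂ → Prop} {c : ℂ} {r : ℝ} (hr : 0 < r)
    (h : ∀ k ∈ Metric.closedBall c r \ {c}, p k) : ∀ᶠ k in 𝓝[≠] c, p k :=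
  (nhdsWithin_hasBasis Metric.nhds_basis_closedBall _).eventually_iff.mpr ⟨r, hr, @h⟩

namespace SkewPencil

theorem mul_pairing_eq (h : SkewPencil S V D B) {a k c : ℂ} (hu : IsUnit (pencil S V a k))
    (f : E) {y : E} (hy : pencil S V a (-c) y = 0) :
    B ((k - c) • pencilResolvent S V a k f) y = -B f y := by
  have hskew := h.skew a k (-c) _ f y (pencil_pencilResolvent_apply hu f) hy
  rw [map_smul, smul_apply, smul_eq_mul, hskew, neg_neg, ← sub_eq_add_neg]

theorem pairing_eq_zero (h : SkewPencil S V D B) {a k k' : ℂ} {x y : E}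
    (hx : pencil S V a k x = 0) (hy : pencil S V a k' y = 0) (hk : k + k' ≠ 0) : B x y = 0 := by
  have hskew := h.skew a k k' x 0 y (by rw [hx, map_zero]) hy
  rw [map_zero, zero_apply, eq_comm, neg_eq_zero] at hskew
  exact (mul_eq_zero.mp hskew).resolve_left hk

theorem exists_pairing_eq_zero (h : SkewPencil S V D B) {a k k' : ℂ} (hk : k ∈ D)
    (hd : Degenerate S V D B a k') :
    ∃ x y, ‖x‖ = 1 ∧ ‖y‖ = 1 ∧ pencil S V a k' x = 0 ∧ pencil S V a (-k) y = 0 ∧ B x y = 0 := by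
  obtain ⟨x, hx0, hx, hor⟩ := hd
  obtain ⟨y, hy0, hy, hxy⟩ : ∃ y ≠ 0, pencil S V a (-k) y = 0 ∧ B x y = 0 := by
    by_cases hkk : k' = k
    · subst hkk
      exact hor.resolve_left (not_not_intro hk)
    · obtain ⟨y, hy0, hy⟩ := h.eigenvalue (-k) (h.neg_mem k hk) a
      exact ⟨y, hy0, hy, h.pairing_eq_zero hx hy (by rwa [← sub_eq_add_neg, sub_ne_zero])⟩
  exact ⟨_, _, (pencil_smul_inv_norm hx0 hx).1, (pencil_smul_inv_norm hy0 hy).1,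
    (pencil_smul_inv_norm hx0 hx).2, (pencil_smul_inv_norm hy0 hy).2, by simp [hxy]⟩

theorem degenerate_of_tendsto (h : SkewPencil S V D B) {a k : ℂ} {b m : ℕ → ℂ}
    (hb : Tendsto b atTop (𝓝 a)) (hm : Tendsto m atTop (𝓝 k))
    (hd : ∀ n, Degenerate S V D B (b n) (m n)) : Degenerate S V D B a k := by
  by_cases hkD : k ∈ D
  · choose x y hx1 hy1 hx hy hxy using fun n => h.exists_pairing_eq_zero hkD (hd n)
    obtain ⟨x', φ, hφ, hx', hx'0, hx'k⟩ :=
      exists_tendsto_subseq_pencil h.compact (V := V) hb hm hx1 (by simp [hx])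
    obtain ⟨y', ψ, hψ, hy', hy'0, hy'k⟩ := exists_tendsto_subseq_pencil h.compact
      (V := V) (hb.comp hφ.tendsto_atTop) (tendsto_const_nhds (x := -k)) (x := y ∘ φ)
      (fun n => hy1 _) (by simp [hy])
    have hlim : Tendsto (fun n => B (x (φ (ψ n))) (y (φ (ψ n)))) atTop (𝓝 (B x' y')) :=
      (B.isBoundedBilinearMap.continuous.tendsto (x', y')).comp
        ((hx'.comp hψ.tendsto_atTop).prodMk_nhds hy')
    exact ⟨x', hx'0, hx'k, Or.inr ⟨y', hy'0, hy'k, tendsto_nhds_unique hlim (by simp [hxy])⟩⟩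
  · choose x hx0 hx _ using hd
    obtain ⟨x', -, -, -, hx'0, hx'k⟩ := exists_tendsto_subseq_pencil h.compact (V := V) hb hm
      (fun n => (pencil_smul_inv_norm (hx0 n) (hx n)).1)
      (by simp [fun n => (pencil_smul_inv_norm (hx0 n) (hx n)).2])
    exact ⟨x', hx'0, hx'k, Or.inl hkD⟩

theorem isClosed_degenerate (h : SkewPencil S V D B) :
    IsClosed {a | ∃ k, Degenerate S V D B a k} := by
  obtain ⟨R, hR⟩ := h.periodic
  refine IsSeqClosed.isClosed fun b a hb ha => ?_
  choose k hk using hb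
  choose m hmR hm using hR
  obtain ⟨k', -, φ, hφ, hk'⟩ := (isCompact_closedBall (0 : ℂ) R).tendsto_subseq
    (x := fun n => m (k n)) (fun n => by simpa using hmR (k n))
  exact ⟨k', h.degenerate_of_tendsto (ha.comp hφ.tendsto_atTop) hk' fun n => hm _ _ (hk _)⟩

theorem eventually_norm_le (h : SkewPencil S V D B) {a c : ℂ} (hd : ¬ Degenerate S V D B a c)
    (hu : ∀ᶠ k in 𝓝[≠] c, IsUnit (pencil S V a k)) :
    ∃ M : ℝ, ∀ᶠ k in 𝓝[≠] c, ‖(k - c) • pencilResolvent S V a k‖ ≤ M := by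
  by_contra hunb
  obtain ⟨k, g, hk, hg, hx1⟩ := exists_seq_norm_apply_eq_one hunb
  let x (n : ℕ) : E := (k n - c) • pencilResolvent S V a (k n) (g n)
  have hpen : Tendsto (fun n => pencil S V a (k n) (x n)) atTop (𝓝 0) := by
    have hlim : Tendsto (fun n => (k n - c) • S (g n)) atTop (𝓝 0) := by
      simpa using ((tendsto_sub_nhdsNE_zero c).comp hk).smul ((S.continuous.tendsto 0).comp hg)
    refine hlim.congr' ?_
    filter_upwards [hk.eventually hu] with n hn
    rw [map_smul, pencil_pencilResolvent_apply hn]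
  obtain ⟨x', φ, hφ, hx', hx'0, hx'k⟩ := exists_tendsto_subseq_pencil h.compact (V := V)
    (tendsto_const_nhds (x := a)) (tendsto_nhds_of_tendsto_nhdsWithin hk) hx1 hpen
  by_cases hcD : c ∈ D
  · obtain ⟨y, hy0, hy⟩ := h.eigenvalue (-c) (h.neg_mem c hcD) a
    refine hd ⟨x', hx'0, hx'k, Or.inr ⟨y, hy0, hy, ?_⟩⟩
    have hlim : Tendsto (fun n => -B (g (φ n)) y) atTop (𝓝 0) := by
      simpa [Function.comp_def] using
        (((B.flip y).continuous.tendsto 0).comp (hg.comp hφ.tendsto_atTop)).neg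
    refine tendsto_nhds_unique (((B.flip y).continuous.tendsto x').comp hx') (hlim.congr' ?_)
    filter_upwards [(hk.comp hφ.tendsto_atTop).eventually hu] with n hn
    exact (h.mul_pairing_eq hn (g (φ n)) hy).symm
  · exact hd ⟨x', hx'0, hx'k, Or.inl hcD⟩

variable [CompleteSpace E]

theorem isUnit_of_not_degenerate (h : SkewPencil S V D B) {a k : ℂ} (hk : k ∉ D)
    (hd : ¬ Degenerate S V D B a k) : IsUnit (pencil S V a k) := by
  by_contra hu
  obtain ⟨x, hx0, hx⟩ := (not_isUnit_pencil_iff h.compact).mp hu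
  exact hd ⟨x, hx0, hx, Or.inl hk⟩

theorem notMem_of_isUnit (h : SkewPencil S V D B) {a k : ℂ} (hu : IsUnit (pencil S V a k)) :
    k ∉ D := fun hk => (not_isUnit_pencil_iff h.compact).mpr (h.eigenvalue k hk a) hu

theorem tendsto_residue (h : SkewPencil S V D B) {a c : ℂ} (hd : ¬ Degenerate S V D B a c)
    (hu : ∀ᶠ k in 𝓝[≠] c, IsUnit (pencil S V a k)) :
    Tendsto (fun k => (k - c) • pencilResolvent S V a k) (𝓝[≠] c) (𝓝 (residue S V a c)) := by
  obtain ⟨M, hM⟩ := h.eventually_norm_le hd hu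
  refine tendsto_limUnder_of_differentiable_on_punctured_nhds_of_bounded_under
    (hu.mono fun k hk => (differentiableAt_id.sub_const c).smul
      (differentiableAt_pencilResolvent hk)) ⟨M, ?_⟩
  simpa using hM

theorem tendsto_residue_apply (h : SkewPencil S V D B) {a c : ℂ} (hd : ¬ Degenerate S V D B a c)
    (hu : ∀ᶠ k in 𝓝[≠] c, IsUnit (pencil S V a k)) (f : E) :
    Tendsto (fun k => (k - c) • pencilResolvent S V a k f) (𝓝[≠] c)
      (𝓝 (residue S V a c f)) :=
  ((ContinuousLinearMap.apply ℂ E f).continuous.tendsto _).comp (h.tendsto_residue hd hu)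

theorem pencil_residue_apply (h : SkewPencil S V D B) {a c : ℂ} (hd : ¬ Degenerate S V D B a c)
    (hu : ∀ᶠ k in 𝓝[≠] c, IsUnit (pencil S V a k)) (f : E) :
    pencil S V a c (residue S V a c f) = 0 := by
  have hlim : Tendsto (fun k : ℂ => (k - c) • S f) (𝓝[≠] c) (𝓝 0) := by
    simpa using (tendsto_sub_nhdsNE_zero c).smul_const (S f)
  refine tendsto_nhds_unique (tendsto_pencil_apply tendsto_const_nhds
    (tendsto_id.mono_left nhdsWithin_le_nhds) (h.tendsto_residue_apply hd hu f)) (hlim.congr' ?_)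
  filter_upwards [hu] with k hk
  rw [map_smul, id, pencil_pencilResolvent_apply hk]

theorem pairing_residue (h : SkewPencil S V D B) {a c : ℂ} (hd : ¬ Degenerate S V D B a c)
    (hu : ∀ᶠ k in 𝓝[≠] c, IsUnit (pencil S V a k)) (f : E) {y : E}
    (hy : pencil S V a (-c) y = 0) : B (residue S V a c f) y = -B f y := by
  refine tendsto_nhds_unique (((B.flip y).continuous.tendsto _).comp
    (h.tendsto_residue_apply hd hu f)) (tendsto_const_nhds.congr' ?_)
  filter_upwards [hu] with k hk
  exact (h.mul_pairing_eq hk f hy).symm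

/-- The residue has rank one: it is `f ↦ -(B f y / B x y) x`. -/
theorem smul_eq_neg_smul_residue (h : SkewPencil S V D B) {a c : ℂ}
    (hd : ¬ Degenerate S V D B a c) (hu : ∀ᶠ k in 𝓝[≠] c, IsUnit (pencil S V a k)) (f : E)
    {x y : E} (hx : pencil S V a c x = 0) (hy0 : y ≠ 0) (hy : pencil S V a (-c) y = 0) :
    B f y • x = -(B x y • residue S V a c f) := by
  rw [eq_neg_iff_add_eq_zero]
  by_contra hne
  refine hd ⟨_, hne, ?_, Or.inr ⟨y, hy0, hy, ?_⟩⟩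
  · rw [map_add, map_smul, map_smul, hx, h.pencil_residue_apply hd hu, smul_zero, smul_zero,
      add_zero]
  · simp only [map_add, map_smul, add_apply, smul_apply, smul_eq_mul, h.pairing_residue hd hu f hy]
    ring

theorem norm_residue_le (h : SkewPencil S V D B) {a c : ℂ} (hd : ¬ Degenerate S V D B a c)
    {r M : ℝ} (hr : 0 < r) (hu : ∀ k ∈ Metric.closedBall c r \ {c}, IsUnit (pencil S V a k))
    (hM : ∀ k ∈ Metric.sphere c r, ‖pencilResolvent S V a k‖ ≤ M) :
    ‖residue S V a c‖ ≤ r * M := by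
  refine norm_le_of_tendsto_punctured (f := fun k => (k - c) • pencilResolvent S V a k) hr
    (fun k hk => (differentiableAt_id.sub_const c).smul
      (differentiableAt_pencilResolvent (hu k hk)))
    (h.tendsto_residue hd (eventually_nhdsNE_of_closedBall hr hu)) fun k hk => ?_
  rw [norm_smul, mem_sphere_iff_norm.mp hk]
  gcongr
  exact hM k hk

end SkewPencil

theorem sub_smul_pencilResolvent_add {a b c k : ℂ} {x : E} (hx : pencil S V a c x = 0)
    (hu : IsUnit (pencil S V b k)) :
    (k - c) • pencilResolvent S V b k x + x = (b - a) • pencilResolvent S V b k (V x) := by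
  have hpen : pencil S V b k x = (b - a) • S (V x) - (k - c) • S x := by
    rw [← sub_zero (pencil S V b k x), ← hx, pencil_apply, pencil_apply]
    simp only [map_sub, map_smul]
    module
  have hinv : Ring.inverse (pencil S V b k) (pencil S V b k x) = x := by
    rw [← mul_apply_eq_comp, Ring.inverse_mul_cancel _ hu, one_apply_eq_self]
  rw [hpen, map_sub, map_smul, map_smul, sub_eq_iff_eq_add'] at hinv
  exact hinv.symm

namespace SkewPencil

variable [CompleteSpace E]

theorem norm_residue_add_le (h : SkewPencil S V D B) {a b c : ℂ} (hd : ¬ Degenerate S V D B b c)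
    {r M : ℝ} (hr : 0 < r) (hu : ∀ k ∈ Metric.closedBall c r \ {c}, IsUnit (pencil S V b k))
    (hM : ∀ k ∈ Metric.sphere c r, ‖pencilResolvent S V b k‖ ≤ M) {x : E}
    (hx : pencil S V a c x = 0) : ‖residue S V b c x + x‖ ≤ ‖b - a‖ * (M * ‖V x‖) := by
  refine norm_le_of_tendsto_punctured
    (f := fun k => (k - c) • pencilResolvent S V b k x + x) hr
    (fun k hk => ((differentiableAt_id.sub_const c).smul ((differentiableAt_pencilResolvent
      (hu k hk)).clm_apply (differentiableAt_const x))).add_const x)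
    ((h.tendsto_residue_apply hd (eventually_nhdsNE_of_closedBall hr hu) x).add_const x)
    fun k hk => ?_
  have hku := hu k ⟨Metric.sphere_subset_closedBall hk, Metric.ne_of_mem_sphere hk hr.ne'⟩
  rw [sub_smul_pencilResolvent_add hx hku, norm_smul]
  gcongr
  exact (pencilResolvent S V b k).le_of_opNorm_le (hM k hk) _

theorem eventually_sphere_norm_pencilResolvent_le {a c : ℂ} {r : ℝ}
    (hu : ∀ k ∈ Metric.sphere c r, IsUnit (pencil S V a k)) :
    ∃ M, ∀ᶠ b in 𝓝 a, ∀ k ∈ Metric.sphere c r, ‖pencilResolvent S V b k‖ ≤ M := by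
  obtain ⟨M, hM⟩ := (isCompact_sphere c r).exists_bound_of_continuousOn fun k hk =>
    (differentiableAt_pencilResolvent (hu k hk)).continuousAt.continuousWithinAt
  refine ⟨M + 1, (isCompact_sphere c r).eventually_forall_of_forall_eventually fun k hk => ?_⟩
  filter_upwards [(continuousAt_pencilResolvent (z := (a, k)) (hu k hk)).norm.eventually_lt_const
    ((hM k hk).trans_lt (lt_add_one M))] with z hz using hz.le

theorem tendsto_residue_of_not_degenerate (h : SkewPencil S V D B) {a k₀ : ℂ}
    (hu : IsUnit (pencil S V a k₀)) (c : ℂ) :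
    (∃ M, ∀ᶠ b in 𝓝[{b | ∀ k, ¬ Degenerate S V D B b k}] a, ‖residue S V b c‖ ≤ M) ∧
      ∀ x, pencil S V a c x = 0 → Tendsto (fun b => residue S V b c x)
        (𝓝[{b | ∀ k, ¬ Degenerate S V D B b k}] a) (𝓝 (-x)) := by
  obtain ⟨r, hr, hiso⟩ := (nhdsWithin_hasBasis Metric.nhds_basis_closedBall _).eventually_iff.mp
    (eventually_isUnit_pencil h.compact hu c)
  obtain ⟨M, hM⟩ := eventually_sphere_norm_pencilResolvent_le (r := r) fun k hk =>
    hiso ⟨Metric.sphere_subset_closedBall hk, Metric.ne_of_mem_sphere hk hr.ne'⟩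
  have hunit {b : ℂ} (hb : ∀ k, ¬ Degenerate S V D B b k) (k : ℂ)
      (hk : k ∈ Metric.closedBall c r \ {c}) : IsUnit (pencil S V b k) :=
    h.isUnit_of_not_degenerate (h.notMem_of_isUnit (hiso hk)) (hb k)
  refine ⟨⟨r * M, ?_⟩, fun x hx => ?_⟩
  · filter_upwards [self_mem_nhdsWithin, nhdsWithin_le_nhds hM] with b hb hbM
    exact h.norm_residue_le (hb c) hr (hunit hb) hbM
  · have hlim : Tendsto (fun b => ‖b - a‖ * (M * ‖V x‖)) (𝓝 a) (𝓝 0) :=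
      (by fun_prop : Continuous fun b => ‖b - a‖ * (M * ‖V x‖)).tendsto' _ _ (by simp)
    rw [tendsto_iff_norm_sub_tendsto_zero]
    refine squeeze_zero' (Eventually.of_forall fun _ => norm_nonneg _) ?_
      (hlim.mono_left nhdsWithin_le_nhds)
    filter_upwards [self_mem_nhdsWithin, nhdsWithin_le_nhds hM] with b hb hbM
    rw [sub_neg_eq_add]
    exact h.norm_residue_add_le (hb c) hr (hunit hb) hbM hx

theorem eventually_isUnit (h : SkewPencil S V D B) {a b k₀ : ℂ} (hu : IsUnit (pencil S V a k₀))
    (hb : ∀ k, ¬ Degenerate S V D B b k) (c : ℂ) : ∀ᶠ k in 𝓝[≠] c, IsUnit (pencil S V b k) :=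
  eventually_isUnit_pencil h.compact
    (h.isUnit_of_not_degenerate (h.notMem_of_isUnit hu) (hb k₀)) c

theorem mem_of_mem_closure (h : SkewPencil S V D B) {a k₀ : ℂ} (hu : IsUnit (pencil S V a k₀))
    (ha : a ∈ closure {b | ∀ k, ¬ Degenerate S V D B b k}) {c : ℂ} {x : E} (hx0 : x ≠ 0)
    (hx : pencil S V a c x = 0) : c ∈ D := by
  by_contra hcD
  have := mem_closure_iff_nhdsWithin_neBot.mp ha
  have hzero : (fun b => residue S V b c x) =ᶠ[𝓝[{b | ∀ k, ¬ Degenerate S V D B b k}] a] 0 := by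
    filter_upwards [self_mem_nhdsWithin] with b hb
    by_contra hne
    exact hb c ⟨_, hne, h.pencil_residue_apply (hb c) (h.eventually_isUnit hu hb c) x, Or.inl hcD⟩
  exact hx0 (neg_eq_zero.mp (tendsto_nhds_unique
    ((h.tendsto_residue_of_not_degenerate hu c).2 x hx) (tendsto_const_nhds.congr' hzero.symm)))

theorem pairing_ne_zero_of_mem_closure (h : SkewPencil S V D B) {a k₀ : ℂ}
    (hu : IsUnit (pencil S V a k₀)) (ha : a ∈ closure {b | ∀ k, ¬ Degenerate S V D B b k})
    {c : ℂ} {x y : E} (hx0 : x ≠ 0) (hx : pencil S V a c x = 0) (hy0 : y ≠ 0)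
    (hy : pencil S V a (-c) y = 0) : B x y ≠ 0 := by
  intro hxy
  let G := {b | ∀ k, ¬ Degenerate S V D B b k}
  have : (𝓝[G] a).NeBot := mem_closure_iff_nhdsWithin_neBot.mp ha
  obtain ⟨⟨M, hM⟩, hlim⟩ := h.tendsto_residue_of_not_degenerate hu c
  have hPx : Tendsto (fun b => residue S V b c x) (𝓝[G] a) (𝓝 (-x)) := hlim x hx
  have hQy : Tendsto (fun b => residue S V b (-c) y) (𝓝[G] a) (𝓝 (-y)) :=
    (h.tendsto_residue_of_not_degenerate hu (-c)).2 y hy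
  obtain ⟨f, hf⟩ := h.nondeg y hy0
  have hrank : ∀ᶠ b in 𝓝[G] a, B f (residue S V b (-c) y) • residue S V b c x =
      -(B (residue S V b c x) (residue S V b (-c) y) • residue S V b c f) := by
    filter_upwards [self_mem_nhdsWithin, hQy.eventually_ne (neg_ne_zero.mpr hy0)] with b hb hne
    have hub := h.eventually_isUnit hu hb
    exact h.smul_eq_neg_smul_residue (hb c) (hub c) f (h.pencil_residue_apply (hb c) (hub c) x)
      hne (h.pencil_residue_apply (hb (-c)) (hub (-c)) y)
  have hpair : Tendsto (fun b => B (residue S V b c x) (residue S V b (-c) y)) (𝓝[G] a) (𝓝 0) := by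
    simpa [Function.comp_def, hxy] using
      (B.isBoundedBilinearMap.continuous.tendsto (-x, -y)).comp (hPx.prodMk_nhds hQy)
  have hbdd : IsBoundedUnder (· ≤ ·) (𝓝[G] a) (norm ∘ fun b => residue S V b c f) :=
    ⟨M * ‖f‖, eventually_map.mpr (hM.mono fun b hb => (residue S V b c).le_of_opNorm_le hb f)⟩
  have hzero : B f (-y) • -x = -0 := tendsto_nhds_unique
    ((((B f).continuous.tendsto _).comp hQy).smul hPx |>.congr' hrank)
    (hpair.zero_smul_isBoundedUnder_le hbdd).neg
  rw [map_neg, smul_neg, neg_smul, neg_neg, neg_zero] at hzero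
  exact (smul_eq_zero.mp hzero).elim hf hx0

theorem not_degenerate_of_mem_closure (h : SkewPencil S V D B) {a k₀ : ℂ}
    (hu : IsUnit (pencil S V a k₀)) (ha : a ∈ closure {b | ∀ k, ¬ Degenerate S V D B b k})
    (c : ℂ) : ¬ Degenerate S V D B a c := by
  rintro ⟨x, hx0, hx, hcD | ⟨y, hy0, hy, hxy⟩⟩
  · exact hcD (h.mem_of_mem_closure hu ha hx0 hx)
  · exact h.pairing_ne_zero_of_mem_closure hu ha hx0 hx hy0 hy hxy

theorem not_degenerate (h : SkewPencil S V D B) {a k₀ : ℂ} (hu : IsUnit (pencil S V a k₀))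
    (k : ℂ) : ¬ Degenerate S V D B a k := by
  have hk₀ : k₀ ∉ D := h.notMem_of_isUnit hu
  have h0 : IsUnit (pencil S V 0 k₀) := h.isUnit_of_not_degenerate hk₀ (h.zero k₀)
  have hU : IsPreconnected {b | ¬ IsUnit (pencil S V b k₀)}ᶜ :=
    ((countable_not_isUnit_pencil h.compact h0).isConnected_compl_of_one_lt_rank
      (by simp)).isPreconnected
  have hG : IsOpen {b | ∀ k, ¬ Degenerate S V D B b k} := by
    simpa only [Set.compl_ofPred, not_exists] using h.isClosed_degenerate.isOpen_compl
  refine hU.subset_of_closure_inter_subset hG ⟨0, not_not_intro h0, h.zero⟩ ?_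
    (not_not_intro hu) k
  rintro b ⟨hb, hbU⟩
  exact h.not_degenerate_of_mem_closure (not_not.mp hbU) hb

end SkewPencil

end Rigidity

/-! ### Diagonal operators and permutations on `ℓ²` -/

section SequenceSpace

open Filter Topology
open scoped lp

variable {ι 𝕜 : Type*} [RCLike 𝕜]

theorem memlp_two_iff {f : ι → 𝕜} : Memℓp f 2 ↔ Summable fun i => ‖f i‖ ^ 2 := by
  rw [memℓp_gen_iff (by norm_num)]
  simp

theorem norm_sq_eq_tsum (x : ℓ²(ι, 𝕜)) : ‖x‖ ^ 2 = ∑' i, ‖x i‖ ^ 2 := by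
  simpa using lp.norm_rpow_eq_tsum (p := 2) (by norm_num) x

theorem summable_norm_sq (x : ℓ²(ι, 𝕜)) : Summable fun i => ‖x i‖ ^ 2 :=
  memlp_two_iff.mp (lp.memℓp x)

theorem memlp_mul {c : ι → 𝕜} {C : ℝ} (hc : ∀ i, ‖c i‖ ≤ C) (x : ℓ²(ι, 𝕜)) :
    Memℓp (fun i => c i * x i) 2 := by
  refine memlp_two_iff.mpr (((summable_norm_sq x).mul_left (C ^ 2)).of_nonneg_of_le
    (fun _ => by positivity) fun i => ?_)
  rw [norm_mul, mul_pow]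
  gcongr
  exact hc i

theorem norm_le_mul_norm {x y : ℓ²(ι, 𝕜)} {C : ℝ} (hC : 0 ≤ C) (h : ∀ i, ‖x i‖ ≤ C * ‖y i‖) :
    ‖x‖ ≤ C * ‖y‖ := by
  refine (sq_le_sq₀ (norm_nonneg _) (by positivity)).mp ?_
  rw [mul_pow, norm_sq_eq_tsum, norm_sq_eq_tsum, ← tsum_mul_left]
  refine (summable_norm_sq x).tsum_le_tsum (fun i => ?_) ((summable_norm_sq y).mul_left _)
  rw [← mul_pow]
  exact pow_le_pow_left₀ (norm_nonneg _) (h i) 2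

/-- The diagonal operator on `ℓ²` with the bounded entries `c`. -/
def diag (c : ι → 𝕜) (hc : ∃ C : ℝ, ∀ i, ‖c i‖ ≤ C) : ℓ²(ι, 𝕜) →L[𝕜] ℓ²(ι, 𝕜) :=
  LinearMap.mkContinuousOfExistsBound
    { toFun := fun x => ⟨fun i => c i * x i, memlp_mul hc.choose_spec x⟩
      map_add' := fun x y => by ext i; exact mul_add _ _ _
      map_smul' := fun a x => by ext i; exact mul_left_comm _ _ _ }
    ⟨max hc.choose 0, fun x => norm_le_mul_norm (le_max_right _ _) fun i => by
      change ‖c i * x i‖ ≤ _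
      rw [norm_mul]
      exact mul_le_mul_of_nonneg_right ((hc.choose_spec i).trans (le_max_left _ _))
        (norm_nonneg _)⟩

@[simp]
theorem diag_apply (c : ι → 𝕜) (hc : ∃ C : ℝ, ∀ i, ‖c i‖ ≤ C) (x : ℓ²(ι, 𝕜)) (i : ι) :
    diag c hc x i = c i * x i := rfl

theorem norm_diag_sub_diag_le {c d : ι → 𝕜} (hc : ∃ C : ℝ, ∀ i, ‖c i‖ ≤ C)
    (hd : ∃ C : ℝ, ∀ i, ‖d i‖ ≤ C) {ε : ℝ} (hε : 0 ≤ ε) (h : ∀ i, ‖c i - d i‖ ≤ ε) :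
    ‖diag c hc - diag d hd‖ ≤ ε := by
  refine ContinuousLinearMap.opNorm_le_bound _ hε fun x => norm_le_mul_norm hε fun i => ?_
  rw [sub_apply, lp.coeFn_sub, Pi.sub_apply, diag_apply, diag_apply, ← sub_mul, norm_mul]
  exact mul_le_mul_of_nonneg_right (h i) (norm_nonneg _)

theorem single_one_apply [DecidableEq ι] (i j : ι) :
    (lp.single 2 i (1 : 𝕜) : ℓ²(ι, 𝕜)) j = if i = j then 1 else 0 := by
  simp only [lp.single_apply, Pi.single_apply, eq_comm]

theorem isCompactOperator_diag_of_finite_support {c : ι → 𝕜} (hc : ∃ C : ℝ, ∀ i, ‖c i‖ ≤ C)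
    (h : (Function.support c).Finite) : IsCompactOperator (diag c hc) := by
  classical
  let P (i : ι) : ℓ²(ι, 𝕜) →L[𝕜] ℓ²(ι, 𝕜) :=
    (lp.evalCLM 𝕜 (fun _ : ι => 𝕜) 2 i).smulRight (lp.single 2 i 1)
  have hP (i : ι) (x : ℓ²(ι, 𝕜)) (j : ι) : P i x j = if i = j then x i else 0 := by
    change x i * (lp.single 2 i (1 : 𝕜) : ℓ²(ι, 𝕜)) j = _
    rw [single_one_apply, mul_ite, mul_one, mul_zero]
  have hsum : diag c hc = ∑ i ∈ h.toFinset, c i • P i := by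
    ext x j
    simp only [diag_apply, sum_apply, smul_apply, lp.coeFn_sum, Finset.sum_apply, lp.coeFn_smul,
      Pi.smul_apply, hP, smul_eq_mul, mul_ite, mul_zero, Finset.sum_ite_eq',
      Set.Finite.mem_toFinset, Function.mem_support]
    split_ifs with hj
    · rfl
    · rw [not_not.mp hj, zero_mul]
  rw [hsum]
  refine Submodule.sum_mem (compactOperator (RingHom.id 𝕜) _ _) fun i _ => ?_
  have hcompact : IsCompactOperator (lp.evalCLM 𝕜 (fun _ : ι => 𝕜) 2 i) :=
    isCompactOperator_of_locallyCompactSpace_dom _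
  exact (hcompact.clm_comp (ContinuousLinearMap.toSpanSingleton 𝕜 (lp.single 2 i 1))).smul (c i)

theorem isCompactOperator_diag {c : ι → 𝕜} (hc : ∃ C : ℝ, ∀ i, ‖c i‖ ≤ C)
    (h : ∀ ε : ℝ, 0 < ε → {i | ε ≤ ‖c i‖}.Finite) : IsCompactOperator (diag c hc) := by
  classical
  let cut (n : ℕ) (i : ι) : 𝕜 := if 1 / ((n : ℝ) + 1) ≤ ‖c i‖ then c i else 0
  have hcut (n : ℕ) : ∃ C : ℝ, ∀ i, ‖cut n i‖ ≤ C := by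
    refine hc.imp fun C hC i => ?_
    simp only [cut]
    split_ifs
    · exact hC i
    · rw [norm_zero]; exact (norm_nonneg _).trans (hC i)
  refine isCompactOperator_of_tendsto (F := fun n => diag (cut n) (hcut n)) (l := atTop) ?_
    (Eventually.of_forall fun n => isCompactOperator_diag_of_finite_support _
      ((h _ Nat.one_div_pos_of_nat).subset fun i hi => (ite_ne_right_iff.mp hi).1))
  refine tendsto_iff_norm_sub_tendsto_zero.mpr (squeeze_zero (fun _ => norm_nonneg _)
    (fun n => ?_) (tendsto_one_div_add_atTop_nhds_zero_nat (𝕜 := ℝ)))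
  refine norm_diag_sub_diag_le _ _ (by positivity) fun i => ?_
  simp only [cut]
  split_ifs with hi
  · rw [sub_self, norm_zero]; positivity
  · rw [zero_sub, norm_neg]; exact (not_le.mp hi).le

/-- The operator `x ↦ (x (σ i))ᵢ` on `ℓ²` permuting the coordinates. -/
def permOp (σ : Equiv.Perm ι) : ℓ²(ι, 𝕜) →L[𝕜] ℓ²(ι, 𝕜) :=
  LinearMap.mkContinuous
    { toFun := fun x => ⟨fun i => x (σ i), memlp_two_iff.mpr
        ((σ.summable_iff (f := fun i => ‖x i‖ ^ 2)).mpr (summable_norm_sq x))⟩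
      map_add' := fun _ _ => rfl
      map_smul' := fun _ _ => rfl } 1 fun x => by
    refine (sq_le_sq₀ (norm_nonneg _) (by positivity)).mp (le_of_eq ?_)
    rw [one_mul, norm_sq_eq_tsum, norm_sq_eq_tsum]
    exact σ.tsum_eq (fun i => ‖x i‖ ^ 2)

@[simp]
theorem permOp_apply (σ : Equiv.Perm ι) (x : ℓ²(ι, 𝕜)) (i : ι) : permOp σ x i = x (σ i) := rfl

/-- The bilinear (not sesquilinear) pairing `∑ xᵢ yᵢ` on `ℓ²`. -/
def dot : ℓ²(ι, 𝕜) →L[𝕜] ℓ²(ι, 𝕜) →L[𝕜] 𝕜 :=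
  LinearMap.mkContinuous₂
    (LinearMap.mk₂ 𝕜 (fun x y => inner 𝕜 (star x) y)
      (fun x x' y => by rw [star_add, inner_add_left])
      (fun c x y => by rw [star_smul, inner_smul_left]; simp)
      (fun x y y' => inner_add_right _ _ _) (fun c x y => inner_smul_right _ _ _)) 1
    fun x y => by
      rw [one_mul]
      exact (norm_inner_le_norm (𝕜 := 𝕜) (star x) y).trans_eq (by rw [norm_star x])

theorem hasSum_dot (x y : ℓ²(ι, 𝕜)) : HasSum (fun i => x i * y i) (dot x y) := by
  refine (lp.hasSum_inner (star x) y).congr_fun fun i => ?_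
  simp [mul_comm]

/-- The matrix entries of an operator on `ℓ²`. -/
def entry [DecidableEq ι] (W : ℓ²(ι, 𝕜) →L[𝕜] ℓ²(ι, 𝕜)) (i j : ι) : 𝕜 := W (lp.single 2 j 1) i

theorem ext_single [DecidableEq ι] {F : Type*} [AddCommMonoid F] [Module 𝕜 F]
    [TopologicalSpace F] [T2Space F] {f g : ℓ²(ι, 𝕜) →L[𝕜] F}
    (h : ∀ i, f (lp.single 2 i 1) = g (lp.single 2 i 1)) : f = g := by
  refine lp.ext_continuousLinearMap (by simp) fun i => ?_
  ext
  exact h i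

theorem ext_entry [DecidableEq ι] {f g : ℓ²(ι, 𝕜) →L[𝕜] ℓ²(ι, 𝕜)}
    (h : ∀ i j, entry f i j = entry g i j) : f = g :=
  ext_single fun j => lp.ext (funext fun i => h i j)

theorem permOp_single [DecidableEq ι] (σ : Equiv.Perm ι) (i : ι) :
    permOp σ (lp.single 2 i (1 : 𝕜)) = lp.single 2 (σ.symm i) 1 := by
  ext j
  simp only [permOp_apply, single_one_apply, Equiv.symm_apply_eq]

theorem permOp_apply_of_entry [DecidableEq ι] {σ : Equiv.Perm ι}
    {W : ℓ²(ι, 𝕜) →L[𝕜] ℓ²(ι, 𝕜)} {c : 𝕜}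
    (h : ∀ i j, entry W (σ i) (σ j) = c * entry W i j) (x : ℓ²(ι, 𝕜)) :
    permOp σ (W x) = c • W (permOp σ x) := by
  have hcomp : (permOp σ).comp W = c • W.comp (permOp σ) := by
    refine ext_single fun j => lp.ext (funext fun i => ?_)
    have hij := h i (σ.symm j)
    rw [Equiv.apply_symm_apply] at hij
    simpa [permOp_single, entry] using hij
  exact DFunLike.congr_fun hcomp x

theorem entry_adjoint [DecidableEq ι] (W : ℓ²(ι, 𝕜) →L[𝕜] ℓ²(ι, 𝕜))
    (i j : ι) : entry (ContinuousLinearMap.adjoint W) i j = conj (entry W j i) := by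
  have hinner : inner 𝕜 (lp.single 2 i (1 : 𝕜)) (ContinuousLinearMap.adjoint W (lp.single 2 j 1)) =
      inner 𝕜 (W (lp.single 2 i 1)) (lp.single 2 j (1 : 𝕜)) :=
    ContinuousLinearMap.adjoint_inner_right _ _ _
  rw [lp.inner_single_left, lp.inner_single_right] at hinner
  simpa [entry] using hinner

theorem adjoint_diag {c : ι → 𝕜} (hc : ∃ C : ℝ, ∀ i, ‖c i‖ ≤ C) :
    ContinuousLinearMap.adjoint (diag c hc) =
      diag (fun i => conj (c i)) (by simpa only [RCLike.norm_conj] using hc) := by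
  classical
  refine ext_entry fun i j => ?_
  rw [entry_adjoint]
  change conj (c j * _) = conj (c i) * _
  rw [single_one_apply, single_one_apply]
  by_cases h : i = j
  · simp [h]
  · simp [h, Ne.symm h]

end SequenceSpace

/-! ### Arithmetic of the Dirac points -/

theorem ofReal_sqrt_three_mul_I : ((√3 : ℝ) : ℂ) * I = 2 * omega + 1 := by
  apply Complex.ext
  · simp [omega_re]
  · simp only [mul_im, ofReal_re, I_im, mul_one, ofReal_im, I_re, mul_zero, add_zero, add_im,
      re_ofNat, im_ofNat, zero_mul, one_im, omega_im]
    ring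

theorem ofReal_sqrt_three_mul_self : ((√3 : ℝ) : ℂ) * ((√3 : ℝ) : ℂ) = 3 := by
  rw [← ofReal_mul, Real.mul_self_sqrt (by norm_num)]
  norm_num

theorem omega_mul_self : omega * omega = -omega - 1 := by
  have h : (2 * omega + 1) * (2 * omega + 1) = -3 := by
    rw [← ofReal_sqrt_three_mul_I]
    linear_combination (I * I) * ofReal_sqrt_three_mul_self + 3 * I_mul_I
  linear_combination h / 4

theorem omega_mul_omega_mul_self : omega * (omega * omega) = 1 := by
  rw [omega_mul_self]
  linear_combination -omega_mul_self

theorem omega_ne_zero : omega ≠ 0 := exp_ne_zero _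

theorem omega_sub_one_ne_zero : omega - 1 ≠ 0 := by
  intro h
  have hre := congrArg Complex.re h
  rw [sub_re, omega_re] at hre
  norm_num at hre

/-- The factor `4πi/√3` between `Λ` and `Λ*`. -/
def dualScale : ℂ := 4 * π * I / (√3 : ℝ)

theorem dualScale_ne_zero : dualScale ≠ 0 := by
  have : ((√3 : ℝ) : ℂ) ≠ 0 := by norm_num
  simp [dualScale, Real.pi_ne_zero]

theorem mem_lattice_iff {z : ℂ} : z ∈ lattice ↔ ∃ m n : ℤ, z = m * omega + n := by
  rw [PeriodPair.mem_lattice]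
  simp [periods, eq_comm]

theorem mem_dualLattice_iff {q : ℂ} :
    q ∈ dualLattice ↔ ∃ m n : ℤ, q = dualScale * (m * omega + n) := by
  constructor
  · rintro ⟨γ, hγ, rfl⟩
    obtain ⟨m, n, rfl⟩ := mem_lattice_iff.mp hγ
    exact ⟨m, n, rfl⟩
  · rintro ⟨m, n, rfl⟩
    exact ⟨_, mem_lattice_iff.mpr ⟨m, n, rfl⟩, rfl⟩

theorem K_eq_dualScale_mul : K = dualScale * (-(2 * omega + 1) / 3) := by
  have h : ((√3 : ℝ) : ℂ) ≠ 0 := by norm_num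
  rw [← ofReal_sqrt_three_mul_I, dualScale, K]
  field_simp
  rw [I_sq]
  ring

theorem add_mem_dualLattice {p q : ℂ} (hp : p ∈ dualLattice) (hq : q ∈ dualLattice) :
    p + q ∈ dualLattice := by
  obtain ⟨γ, hγ, rfl⟩ := hp
  obtain ⟨δ, hδ, rfl⟩ := hq
  exact ⟨_, add_mem hγ hδ, by ring⟩

theorem neg_mem_dualLattice {p : ℂ} (hp : p ∈ dualLattice) : -p ∈ dualLattice := by
  obtain ⟨γ, hγ, rfl⟩ := hp
  exact ⟨_, neg_mem hγ, by ring⟩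

theorem sub_mem_dualLattice {p q : ℂ} (hp : p ∈ dualLattice) (hq : q ∈ dualLattice) :
    p - q ∈ dualLattice := by
  rw [sub_eq_add_neg]
  exact add_mem_dualLattice hp (neg_mem_dualLattice hq)

theorem add_mem_dualLattice_iff {p q : ℂ} (hq : q ∈ dualLattice) :
    p + q ∈ dualLattice ↔ p ∈ dualLattice :=
  ⟨fun h => by simpa using sub_mem_dualLattice h hq, fun h => add_mem_dualLattice h hq⟩

theorem neg_mem_dualLattice_iff {p : ℂ} : -p ∈ dualLattice ↔ p ∈ dualLattice :=
  ⟨fun h => neg_neg p ▸ neg_mem_dualLattice h, neg_mem_dualLattice⟩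

theorem omega_sub_one_mul_mem_dualLattice {p : ℂ} (hp : p ∈ dualLattice) :
    (omega - 1) * p ∈ dualLattice := by
  obtain ⟨m, n, rfl⟩ := mem_dualLattice_iff.mp hp
  refine mem_dualLattice_iff.mpr ⟨n - 2 * m, -m - n, ?_⟩
  push_cast
  linear_combination (dualScale * m) * omega_mul_self

theorem omega_sub_one_mul_K_mem : (omega - 1) * K ∈ dualLattice := by
  refine mem_dualLattice_iff.mpr ⟨1, 1, ?_⟩
  rw [K_eq_dualScale_mul]
  push_cast
  linear_combination (-(2 / 3) * dualScale) * omega_mul_self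

theorem K_add_K_notMem_dualLattice : K + K ∉ dualLattice := by
  intro h
  obtain ⟨m, n, hmn⟩ := mem_dualLattice_iff.mp h
  rw [K_eq_dualScale_mul, ← mul_add] at hmn
  have him := congrArg Complex.im (mul_left_cancel₀ dualScale_ne_zero hmn)
  have hcoeff : (-4 / 3 : ℝ) * (√3 / 2) = m * (√3 / 2) := by
    calc _ = (-(2 * omega + 1) / 3 + -(2 * omega + 1) / 3).im := by
          simp [omega_im]; ring
      _ = _ := by rw [him]; simp [omega_im]
  have hreal : (-4 : ℝ) = 3 * m := by
    linarith [mul_right_cancel₀ (by norm_num) hcoeff]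
  have hint : (-4 : ℤ) = 3 * m := by exact_mod_cast hreal
  lia

theorem K_notMem_dualLattice : K ∉ dualLattice := fun h =>
  K_add_K_notMem_dualLattice (add_mem_dualLattice h h)

theorem finite_inter_dualLattice {s : Set ℂ} (hs : Bornology.IsBounded s) :
    (s ∩ dualLattice).Finite := by
  have hfin := ZSpan.setFinite_inter periods.basis (hs.smul₀ dualScale⁻¹)
  refine (hfin.image fun γ => dualScale * γ).subset ?_
  rintro _ ⟨hq, γ, hγ, rfl⟩
  refine ⟨γ, ⟨⟨_, hq, ?_⟩, ?_⟩, rfl⟩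
  · exact inv_mul_cancel_left₀ dualScale_ne_zero γ
  · rwa [lattice, PeriodPair.lattice_eq_span_range_basis] at hγ

theorem exists_mem_dualLattice_norm_sub_le : ∃ R : ℝ, ∀ k : ℂ, ∃ q ∈ dualLattice, ‖k - q‖ ≤ R := by
  refine ⟨‖dualScale‖ * ∑ i, ‖periods.basis i‖, fun k => ?_⟩
  let γ := ZSpan.floor periods.basis (dualScale⁻¹ * k)
  have hsub : k - dualScale * γ.1 = dualScale * ZSpan.fract periods.basis (dualScale⁻¹ * k) := by
    rw [ZSpan.fract_apply, mul_sub, mul_inv_cancel_left₀ dualScale_ne_zero]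
  refine ⟨dualScale * γ.1, ⟨γ.1, ?_, rfl⟩, ?_⟩
  · rw [lattice, PeriodPair.lattice_eq_span_range_basis]
    exact γ.2
  · rw [hsub, norm_mul]
    exact mul_le_mul_of_nonneg_left (ZSpan.norm_fract_le _ _) (norm_nonneg _)

/-- The Dirac points as a type. They index the plane waves of `L²_0`, since `𝒦₀` is the spectrum
of `2D_{z̄}` there. -/
abbrev Dirac : Type := diracPoints

namespace Dirac

open Classical in
/-- The component of `ℂ²` in which the plane wave of frequency `j` lives. -/
def comp (j : Dirac) : Fin 2 := if j.1 + K ∈ dualLattice then 0 else 1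

theorem comp_eq_zero_iff {j : Dirac} : comp j = 0 ↔ j.1 + K ∈ dualLattice := by
  unfold comp
  split_ifs with h <;> simp [h]

theorem comp_eq_one_iff {j : Dirac} : comp j = 1 ↔ j.1 - K ∈ dualLattice := by
  have hone : comp j = 1 ↔ j.1 + K ∉ dualLattice := by
    unfold comp
    split_ifs with h <;> simp [h]
  rw [hone]
  refine ⟨fun h => j.2.resolve_right h, fun hsub hadd => K_add_K_notMem_dualLattice ?_⟩
  simpa using sub_mem_dualLattice hadd hsub

theorem ne_zero (j : Dirac) : j.1 ≠ 0 := by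
  rintro h
  rcases j.2 with hj | hj
  · rw [h, zero_sub, neg_mem_dualLattice_iff] at hj
    exact K_notMem_dualLattice hj
  · rw [h, zero_add] at hj
    exact K_notMem_dualLattice hj

theorem add_mem (j : Dirac) {q : ℂ} (hq : q ∈ dualLattice) : j.1 + q ∈ diracPoints :=
  j.2.imp (fun h => by rw [add_sub_right_comm]; exact add_mem_dualLattice h hq)
    fun h => by rw [add_right_comm]; exact add_mem_dualLattice h hq

theorem comp_eq_of_add {j j' : Dirac} {q : ℂ} (hq : q ∈ dualLattice) (h : j'.1 = j.1 + q) :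
    comp j' = comp j := by
  have hiff : comp j' = 0 ↔ comp j = 0 := by
    rw [comp_eq_zero_iff, comp_eq_zero_iff, h, add_right_comm, add_mem_dualLattice_iff hq]
  lia

theorem neg_mem (j : Dirac) : -j.1 ∈ diracPoints :=
  j.2.symm.imp (fun h => by rw [sub_eq_add_neg, ← neg_add]; exact neg_mem_dualLattice h)
    fun h => by rw [neg_add_eq_sub, ← neg_sub]; exact neg_mem_dualLattice h

/-- The involution `j ↦ -j` of the Dirac points. -/
def negPerm : Equiv.Perm Dirac where
  toFun j := ⟨-j.1, neg_mem j⟩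
  invFun j := ⟨-j.1, neg_mem j⟩
  left_inv _ := Subtype.ext (neg_neg _)
  right_inv _ := Subtype.ext (neg_neg _)

@[simp]
theorem coe_negPerm (j : Dirac) : (negPerm j).1 = -j.1 := rfl

@[simp]
theorem negPerm_negPerm (j : Dirac) : negPerm (negPerm j) = j := Subtype.ext (neg_neg _)

theorem comp_negPerm (j : Dirac) : comp (negPerm j) = 1 - comp j := by
  by_cases h : comp j = 0
  · rw [h, sub_zero, comp_eq_one_iff, coe_negPerm, ← neg_add', neg_mem_dualLattice_iff]
    exact comp_eq_zero_iff.mp h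
  · have hone := Fin.eq_one_of_ne_zero _ h
    rw [hone, sub_self, comp_eq_zero_iff, coe_negPerm, neg_add_eq_sub, ← neg_sub,
      neg_mem_dualLattice_iff]
    exact comp_eq_one_iff.mp hone

/-- The translation `j ↦ j + q` of the Dirac points by `q ∈ Λ*`. -/
def shiftPerm (q : ℂ) (hq : q ∈ dualLattice) : Equiv.Perm Dirac where
  toFun j := ⟨j.1 + q, add_mem j hq⟩
  invFun j := ⟨j.1 + -q, add_mem j (neg_mem_dualLattice hq)⟩
  left_inv j := Subtype.ext (by simp)
  right_inv j := Subtype.ext (by simp)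

@[simp]
theorem coe_shiftPerm (q : ℂ) (hq : q ∈ dualLattice) (j : Dirac) :
    (shiftPerm q hq j).1 = j.1 + q := rfl

theorem omega_sub_one_mul_mem (j : Dirac) : (omega - 1) * j.1 ∈ dualLattice := by
  rcases j.2 with h | h
  · rw [← sub_add_cancel j.1 K, mul_add]
    exact add_mem_dualLattice (omega_sub_one_mul_mem_dualLattice h) omega_sub_one_mul_K_mem
  · rw [← add_sub_cancel_right j.1 K, mul_sub]
    exact sub_mem_dualLattice (omega_sub_one_mul_mem_dualLattice h) omega_sub_one_mul_K_mem

theorem omega_sub_one_mul_sub_mem (j₀ j : Dirac) : (omega - 1) * (j.1 - j₀.1) ∈ dualLattice := by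
  rw [mul_sub]
  exact sub_mem_dualLattice (omega_sub_one_mul_mem j) (omega_sub_one_mul_mem j₀)

/-- The rotation `j ↦ j₀ + ω (j - j₀)` of the Dirac points about `j₀`. -/
def rotPerm (j₀ : Dirac) : Equiv.Perm Dirac :=
  let f : Dirac → Dirac := fun j => ⟨j.1 + (omega - 1) * (j.1 - j₀.1),
    add_mem j (omega_sub_one_mul_sub_mem j₀ j)⟩
  have hf : ∀ j, f (f (f j)) = j := fun j => Subtype.ext (by
    simp only [f]
    linear_combination (j.1 - j₀.1) * omega_mul_omega_mul_self)
  { toFun := f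
    invFun := fun j => f (f j)
    left_inv := hf
    right_inv := hf }

theorem coe_rotPerm (j₀ j : Dirac) :
    (rotPerm j₀ j).1 = j.1 + (omega - 1) * (j.1 - j₀.1) := rfl

theorem coe_rotPerm_sub (j₀ j : Dirac) : (rotPerm j₀ j).1 - j₀.1 = omega * (j.1 - j₀.1) := by
  rw [coe_rotPerm]; ring

@[simp]
theorem rotPerm_self (j₀ : Dirac) : rotPerm j₀ j₀ = j₀ := Subtype.ext (by simp [coe_rotPerm])

theorem finite_norm_le (R : ℝ) : {j : Dirac | ‖j.1‖ ≤ R}.Finite := by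
  have hfin := finite_inter_dualLattice (Metric.isBounded_closedBall (x := 0) (r := R + ‖K‖))
  refine (((hfin.image (· + K)).union (hfin.image (· - K))).preimage
    Subtype.val_injective.injOn).subset fun j (hj : ‖j.1‖ ≤ R) => ?_
  refine j.2.imp (fun h => ⟨j.1 - K, ⟨?_, h⟩, sub_add_cancel _ _⟩)
    fun h => ⟨j.1 + K, ⟨?_, h⟩, add_sub_cancel_right _ _⟩
  · rw [mem_closedBall_zero_iff]; linarith [norm_sub_le j.1 K]
  · rw [mem_closedBall_zero_iff]; linarith [norm_add_le j.1 K]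

theorem finite_le_norm_inv {ε : ℝ} (hε : 0 < ε) (k : ℂ) :
    {j : Dirac | ε ≤ ‖(j.1 - k)⁻¹‖}.Finite := by
  refine (finite_norm_le (ε⁻¹ + ‖k‖)).subset fun j (hj : ε ≤ ‖(j.1 - k)⁻¹‖) => ?_
  rw [norm_inv] at hj
  have hsub : ‖j.1 - k‖ ≤ ε⁻¹ := by
    simpa using inv_anti₀ hε hj
  change ‖j.1‖ ≤ _
  linarith [norm_sub_norm_le j.1 k]

theorem exists_norm_inv_le (k : ℂ) : ∃ C : ℝ, ∀ j : Dirac, ‖(j.1 - k)⁻¹‖ ≤ C := by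
  obtain ⟨C, hC⟩ := ((finite_le_norm_inv one_pos k).image fun j => ‖(j.1 - k)⁻¹‖).bddAbove
  refine ⟨max C 1, fun j => ?_⟩
  by_cases h : 1 ≤ ‖(j.1 - k)⁻¹‖
  · exact (hC ⟨j, h, rfl⟩).trans (le_max_left _ _)
  · exact (not_le.mp h).le.trans (le_max_right _ _)

end Dirac

/-! ### The model operator on `ℓ²(𝒦₀)` -/

section Model

open Filter Topology
open scoped lp

theorem pencil_diag_eq_iff {ι : Type*} {c : ι → ℂ} {hc : ∃ C : ℝ, ∀ i, ‖c i‖ ≤ C}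
    (hc0 : ∀ i, c i ≠ 0) {W : ℓ²(ι, ℂ) →L[ℂ] ℓ²(ι, ℂ)} {a k : ℂ} {x f : ℓ²(ι, ℂ)} :
    pencil (diag c hc) W a k x = diag c hc f ↔
      ∀ i, (c i)⁻¹ * x i + a * W x i - k * x i = f i := by
  have happly (i : ι) : pencil (diag c hc) W a k x i =
      c i * ((c i)⁻¹ * x i + a * W x i - k * x i) := by
    rw [pencil_apply, lp.coeFn_add, Pi.add_apply, diag_apply, lp.coeFn_sub, Pi.sub_apply,
      lp.coeFn_smul, lp.coeFn_smul, Pi.smul_apply, Pi.smul_apply, smul_eq_mul, smul_eq_mul]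
    linear_combination -(x i) * mul_inv_cancel₀ (hc0 i)
  refine Subtype.ext_iff.trans (funext_iff.trans (forall_congr' fun i => ?_))
  rw [happly, diag_apply, mul_right_inj' (hc0 i)]

/-- `ℓ²(𝒦₀)`, the space of Fourier coefficients of `L²_0`. -/
abbrev DiracSeq : Type := ℓ²(Dirac, ℂ)

namespace Dirac

/-- The diagonal entries of the matrix `diag (1, -1)` of `ℂ²` in the Fourier basis. -/
def sign (j : Dirac) : ℂ := if j.comp = 0 then 1 else -1

theorem norm_sign_le (j : Dirac) : ‖j.sign‖ ≤ 1 := by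
  unfold sign
  split_ifs <;> simp

theorem sign_ne_zero (j : Dirac) : j.sign ≠ 0 := by
  unfold sign
  split_ifs <;> simp

theorem sign_eq_neg {i j : Dirac} (h : i.comp ≠ j.comp) : i.sign = -j.sign := by
  unfold sign
  split_ifs with hi hj hj
  · exact absurd (hi.trans hj.symm) h
  · rw [neg_neg]
  · rfl
  · exact absurd ((Fin.eq_one_of_ne_zero _ hi).trans (Fin.eq_one_of_ne_zero _ hj).symm) h

theorem sign_negPerm (j : Dirac) : (negPerm j).sign = -j.sign :=
  sign_eq_neg (by rw [comp_negPerm]; generalize j.comp = i; decide +revert)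

theorem sign_shiftPerm {q : ℂ} (hq : q ∈ dualLattice) (j : Dirac) :
    (shiftPerm q hq j).sign = j.sign := by
  rw [sign, sign, comp_eq_of_add hq (coe_shiftPerm q hq j)]

end Dirac

/-- Multiplication by `diag (1, -1)` in the Fourier basis. -/
def signOp : DiracSeq →L[ℂ] DiracSeq := diag Dirac.sign ⟨1, Dirac.norm_sign_le⟩

theorem signOp_apply (x : DiracSeq) (j : Dirac) : signOp x j = j.sign * x j := rfl

theorem signOp_ne_zero {x : DiracSeq} (hx : x ≠ 0) : signOp x ≠ 0 := fun h => hx <|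
  lp.ext (funext fun j => (mul_eq_zero.mp (congrFun (congrArg Subtype.val h) j)).resolve_left
    j.sign_ne_zero)

theorem signOp_single (j : Dirac) : signOp (lp.single 2 j 1) = j.sign • lp.single 2 j (1 : ℂ) := by
  ext i
  rw [signOp_apply, lp.coeFn_smul, Pi.smul_apply, smul_eq_mul, single_one_apply]
  split_ifs with h
  · rw [h]
  · simp only [mul_zero]

/-- `(A - k)⁻¹` for the diagonal operator `A` of multiplication by the frequency `j`, with the
value `0` on the kernel of `A - k`. -/
def diagInv (k : ℂ) : DiracSeq →L[ℂ] DiracSeq :=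
  diag (fun j => (j.1 - k)⁻¹) (Dirac.exists_norm_inv_le k)

theorem diagInv_apply (k : ℂ) (x : DiracSeq) (j : Dirac) :
    diagInv k x j = (j.1 - k)⁻¹ * x j := rfl

theorem isCompactOperator_diagInv (k : ℂ) : IsCompactOperator (diagInv k) :=
  isCompactOperator_diag _ fun _ε hε => Dirac.finite_le_norm_inv hε k

/-- The bilinear form `∫ det (u, v)` in the Fourier basis. -/
def skewForm : DiracSeq →L[ℂ] DiracSeq →L[ℂ] ℂ :=
  (dot.comp signOp).flip.comp (permOp Dirac.negPerm) |>.flip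

theorem hasSum_skewForm (x y : DiracSeq) :
    HasSum (fun j => j.sign * x j * y (Dirac.negPerm j)) (skewForm x y) :=
  hasSum_dot (signOp x) (permOp Dirac.negPerm y)

theorem skewForm_single_left (i : Dirac) (y : DiracSeq) :
    skewForm (lp.single 2 i 1) y = i.sign * y (Dirac.negPerm i) := by
  refine (hasSum_skewForm _ y).unique ?_
  convert hasSum_ite_eq i (i.sign * y (Dirac.negPerm i)) using 2 with j
  rw [single_one_apply]
  by_cases h : j = i
  · subst h; simp
  · simp [h, Ne.symm h]

theorem skewForm_single_right (x : DiracSeq) (i : Dirac) :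
    skewForm x (lp.single 2 i 1) = -(i.sign * x (Dirac.negPerm i)) := by
  refine (hasSum_skewForm x _).unique ?_
  convert hasSum_ite_eq (Dirac.negPerm i) (-(i.sign * x (Dirac.negPerm i))) using 2 with j
  rw [single_one_apply]
  by_cases h : j = Dirac.negPerm i
  · subst h; simp [Dirac.sign_negPerm]
  · have hi : i ≠ Dirac.negPerm j := by
      rintro rfl
      simp at h
    simp [h, hi]

theorem exists_skewForm_ne_zero {y : DiracSeq} (hy : y ≠ 0) : ∃ x, skewForm x y ≠ 0 := by
  contrapose! hy
  ext j
  have hj := hy (lp.single 2 (Dirac.negPerm j) 1)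
  rw [skewForm_single_left, Dirac.negPerm_negPerm] at hj
  exact (mul_eq_zero.mp hj).resolve_left (Dirac.sign_ne_zero _)

theorem skewForm_permOp_shiftPerm {q : ℂ} (hq : q ∈ dualLattice) (x y : DiracSeq) :
    skewForm (permOp (Dirac.shiftPerm q hq) x)
      (permOp (Dirac.shiftPerm (-q) (neg_mem_dualLattice hq)) y) = skewForm x y := by
  refine (hasSum_skewForm _ _).unique (((Dirac.shiftPerm q hq).hasSum_iff.mpr
    (hasSum_skewForm x y)).congr_fun fun j => ?_)
  have hneg : Dirac.negPerm (Dirac.shiftPerm q hq j) =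
      Dirac.shiftPerm (-q) (neg_mem_dualLattice hq) (Dirac.negPerm j) :=
    Subtype.ext (by simp [add_comm])
  simp only [Function.comp_apply, permOp_apply, Dirac.sign_shiftPerm, hneg]

theorem permOp_ne_zero {σ : Equiv.Perm Dirac} {x : DiracSeq} (hx : x ≠ 0) : permOp σ x ≠ 0 := by
  refine fun h => hx (lp.ext (funext fun j => ?_))
  have hj : x (σ (σ.symm j)) = 0 := congrFun (congrArg Subtype.val h) (σ.symm j)
  rwa [Equiv.apply_symm_apply] at hj

variable {W : DiracSeq →L[ℂ] DiracSeq} {a k : ℂ} {x : DiracSeq}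

theorem pencil_diagInv_eq_iff {f : DiracSeq} :
    pencil (diagInv 0) W a k x = diagInv 0 f ↔
      ∀ j, j.1 * x j + a * W x j - k * x j = f j := by
  refine (pencil_diag_eq_iff fun j => inv_ne_zero (sub_ne_zero.mpr j.ne_zero)).trans ?_
  simp only [sub_zero, inv_inv]

theorem pencil_diagInv_eq_zero_iff :
    pencil (diagInv 0) W a k x = 0 ↔ ∀ j, j.1 * x j + a * W x j = k * x j := by
  rw [← map_zero (diagInv 0), pencil_diagInv_eq_iff]
  exact forall_congr' fun j => sub_eq_zero

theorem exists_support_of_pencil_zero_eq_zero (hx0 : x ≠ 0)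
    (hx : pencil (diagInv 0) W 0 k x = 0) :
    ∃ j : Dirac, j.1 = k ∧ x j ≠ 0 ∧ ∀ i ≠ j, x i = 0 := by
  have hmul (i : Dirac) : (i.1 - k) * x i = 0 := by
    linear_combination pencil_diagInv_eq_zero_iff.mp hx i
  obtain ⟨j, hj⟩ : ∃ j, x j ≠ 0 := by
    contrapose! hx0
    exact lp.ext (funext hx0)
  have hjk : j.1 = k := sub_eq_zero.mp ((mul_eq_zero.mp (hmul j)).resolve_right hj)
  refine ⟨j, hjk, hj, fun i hi => (mul_eq_zero.mp (hmul i)).resolve_left fun hik => hi ?_⟩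
  exact Subtype.ext ((sub_eq_zero.mp hik).trans hjk.symm)

theorem not_degenerate_zero : ¬ Degenerate (diagInv 0) W diracPoints skewForm 0 k := by
  rintro ⟨x, hx0, hx, hk | ⟨y, hy0, hy, hxy⟩⟩ <;>
    obtain ⟨j, hjk, hj, hsupp⟩ := exists_support_of_pencil_zero_eq_zero hx0 hx
  · exact hk (hjk ▸ j.2)
  · obtain ⟨l, hlk, hl, -⟩ := exists_support_of_pencil_zero_eq_zero hy0 hy
    have hlj : l = Dirac.negPerm j := Subtype.ext (by rw [hlk, Dirac.coe_negPerm, hjk])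
    have hform : skewForm x y = j.sign * x j * y (Dirac.negPerm j) :=
      (hasSum_skewForm x y).unique <| hasSum_single j fun i hi => by
        rw [hsupp i hi, mul_zero, zero_mul]
    rw [hform, ← hlj] at hxy
    exact mul_ne_zero (mul_ne_zero j.sign_ne_zero hj) hl hxy

/-- The symmetries of the matrix of multiplication by a potential in the Fourier basis: `shift`
comes from the periodicity of `U_±`, `rot` from `U_±(ωz) = ωU_±(z)`, and `neg` and `off_diag` from
`V` being an off-diagonal matrix function. -/
structure IsPotentialMatrix (W : DiracSeq →L[ℂ] DiracSeq) : Prop where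
  shift : ∀ q hq i j, entry W (Dirac.shiftPerm q hq i) (Dirac.shiftPerm q hq j) = entry W i j
  rot : ∀ j₀ i j, entry W (Dirac.rotPerm j₀ i) (Dirac.rotPerm j₀ j) = omega * entry W i j
  neg : ∀ i j, entry W (Dirac.negPerm i) (Dirac.negPerm j) = entry W j i
  off_diag : ∀ i j, i.comp = j.comp → entry W i j = 0

/-- The sequences `x` with `x (j₀ + ω (j - j₀)) = ω x j`. -/
def rotCovariant (j₀ : Dirac) : Submodule ℂ DiracSeq :=
  (permOp (Dirac.rotPerm j₀) - omega • 1 : DiracSeq →L[ℂ] DiracSeq).ker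

section RotCovariant

variable {j₀ : Dirac}

theorem mem_rotCovariant_iff : x ∈ rotCovariant j₀ ↔ permOp (Dirac.rotPerm j₀) x = omega • x := by
  change permOp (Dirac.rotPerm j₀) x - omega • x = 0 ↔ _
  rw [sub_eq_zero]

theorem isClosed_rotCovariant : IsClosed (rotCovariant j₀ : Set DiracSeq) :=
  ContinuousLinearMap.isClosed_ker _

theorem apply_rotPerm_of_mem (hx : x ∈ rotCovariant j₀) (j : Dirac) :
    x (Dirac.rotPerm j₀ j) = omega * x j :=
  congrFun (congrArg Subtype.val (mem_rotCovariant_iff.mp hx)) j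

theorem apply_self_eq_zero_of_mem (hx : x ∈ rotCovariant j₀) : x j₀ = 0 := by
  have hrot := apply_rotPerm_of_mem hx j₀
  rw [Dirac.rotPerm_self] at hrot
  refine (mul_eq_zero.mp (?_ : (omega - 1) * x j₀ = 0)).resolve_left omega_sub_one_ne_zero
  linear_combination -hrot

theorem sub_mul_diagInv_apply_of_mem (hx : x ∈ rotCovariant j₀) (j : Dirac) :
    (j.1 - j₀.1) * diagInv j₀.1 x j = x j := by
  rw [diagInv_apply]
  by_cases h : j.1 - j₀.1 = 0
  · rw [h, zero_mul, Subtype.ext (sub_eq_zero.mp h), apply_self_eq_zero_of_mem hx]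
  · rw [mul_inv_cancel_left₀ h]

theorem permOp_diagInv_of_mem (hx : x ∈ rotCovariant j₀) :
    permOp (Dirac.rotPerm j₀) (diagInv j₀.1 x) = diagInv j₀.1 x := by
  ext j
  rw [permOp_apply, diagInv_apply, diagInv_apply, apply_rotPerm_of_mem hx, Dirac.coe_rotPerm_sub,
    mul_inv, mul_assoc, mul_left_comm, inv_mul_cancel_left₀ omega_ne_zero]

end RotCovariant

theorem exists_kernel_or_surjOn_of_invariant {E : Type*} [NormedAddCommGroup E] [NormedSpace ℂ E]
    [CompleteSpace E] {C : E →L[ℂ] E} (hC : IsCompactOperator C) {F : Submodule ℂ E}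
    (hF : IsClosed (F : Set E)) (hCF : ∀ x ∈ F, C x ∈ F) :
    (∃ f ∈ F, f ≠ 0 ∧ f + C f = 0) ∨ ∀ g ∈ F, ∃ f ∈ F, f + C f = g := by
  have : CompleteSpace F := hF.completeSpace_coe
  let C' : F →L[ℂ] F := C.restrict hCF
  have hC' : IsCompactOperator C' := hC.restrict' hCF
  by_cases hu : IsUnit (1 + C')
  · refine Or.inr fun g hg => ?_
    obtain ⟨f, hf⟩ := (ContinuousLinearMap.isUnit_iff_bijective.mp hu).2 ⟨g, hg⟩
    exact ⟨f, f.2, congrArg Subtype.val hf⟩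
  · rw [isUnit_one_add_iff hC'] at hu
    push Not at hu
    obtain ⟨f, hf, hf0⟩ := hu
    exact Or.inl ⟨f, f.2, Subtype.coe_ne_coe.mpr hf0, congrArg Subtype.val hf⟩

theorem pencil_single_sub_diagInv_eq_zero {j₀ : Dirac} {f : DiracSeq} (hf : f ∈ rotCovariant j₀)
    (c : ℂ) (h : f + a • W (diagInv j₀.1 f) = a • W (lp.single 2 j₀ c)) :
    pencil (diagInv 0) W a j₀.1 (lp.single 2 j₀ c - diagInv j₀.1 f) = 0 := by
  rw [pencil_diagInv_eq_zero_iff]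
  intro j
  have hj : f j + a * W (diagInv j₀.1 f) j = a * W (lp.single 2 j₀ c) j :=
    congrFun (congrArg Subtype.val h) j
  have hsingle : (j.1 - j₀.1) * (lp.single 2 j₀ c : DiracSeq) j = 0 := by
    rw [lp.single_apply, Pi.single_apply]
    split_ifs with h
    · rw [h, sub_self, zero_mul]
    · rw [mul_zero]
  rw [map_sub, lp.coeFn_sub, lp.coeFn_sub, Pi.sub_apply, Pi.sub_apply]
  linear_combination hsingle - sub_mul_diagInv_apply_of_mem hf j - hj

namespace IsPotentialMatrix

theorem skewForm_map_left (hW : IsPotentialMatrix W) (x y : DiracSeq) :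
    skewForm (W x) y = -skewForm x (W y) := by
  have hcomp : skewForm.comp W = -(skewForm.flip.comp W).flip := by
    refine ext_single fun i => ext_single fun j => ?_
    change skewForm (W (lp.single 2 i 1)) (lp.single 2 j 1) =
      -skewForm (lp.single 2 i 1) (W (lp.single 2 j 1))
    rw [skewForm_single_left, skewForm_single_right]
    change -(j.sign * entry W (Dirac.negPerm j) i) = -(i.sign * entry W (Dirac.negPerm i) j)
    have htranspose : entry W (Dirac.negPerm j) i = entry W (Dirac.negPerm i) j := by
      simpa using hW.neg j (Dirac.negPerm i)
    rw [htranspose]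
    by_cases hcomp : (Dirac.negPerm i).comp = j.comp
    · rw [hW.off_diag _ _ hcomp, mul_zero, mul_zero]
    · have hsign := Dirac.sign_eq_neg hcomp
      rw [Dirac.sign_negPerm, neg_inj] at hsign
      rw [hsign]
  exact DFunLike.congr_fun (DFunLike.congr_fun hcomp x) y

theorem map_signOp (hW : IsPotentialMatrix W) (x : DiracSeq) :
    W (signOp x) = -signOp (W x) := by
  have hcomp : W.comp signOp = -signOp.comp W := by
    refine ext_single fun j => lp.ext (funext fun i => ?_)
    change W (signOp (lp.single 2 j 1)) i = -(i.sign * entry W i j)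
    rw [signOp_single, map_smul]
    change j.sign * entry W i j = _
    by_cases hij : i.comp = j.comp
    · rw [hW.off_diag _ _ hij, mul_zero, mul_zero, neg_zero]
    · rw [Dirac.sign_eq_neg hij, neg_mul, neg_neg]
  exact DFunLike.congr_fun hcomp x

theorem pencil_neg_signOp (hW : IsPotentialMatrix W) (hx : pencil (diagInv 0) W a k x = 0) :
    pencil (diagInv 0) W (-a) k (signOp x) = 0 := by
  rw [pencil_diagInv_eq_zero_iff] at hx ⊢
  intro j
  rw [hW.map_signOp, lp.coeFn_neg, Pi.neg_apply, signOp_apply, signOp_apply]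
  linear_combination j.sign * hx j

theorem isUnit_pencil_neg_iff (hW : IsPotentialMatrix W) :
    IsUnit (pencil (diagInv 0) W (-a) k) ↔ IsUnit (pencil (diagInv 0) W a k) := by
  rw [← not_iff_not, not_isUnit_pencil_iff (isCompactOperator_diagInv 0),
    not_isUnit_pencil_iff (isCompactOperator_diagInv 0)]
  refine ⟨?_, ?_⟩ <;> rintro ⟨x, hx0, hx⟩ <;> refine ⟨signOp x, signOp_ne_zero hx0, ?_⟩
  · simpa using hW.pencil_neg_signOp hx
  · exact hW.pencil_neg_signOp hx

theorem skewForm_of_pencil_eq (hW : IsPotentialMatrix W) (a k k' : ℂ) (w f y : DiracSeq)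
    (hw : pencil (diagInv 0) W a k w = diagInv 0 f) (hy : pencil (diagInv 0) W a k' y = 0) :
    skewForm f y = -((k + k') * skewForm w y) := by
  rw [pencil_diagInv_eq_iff] at hw
  rw [pencil_diagInv_eq_zero_iff] at hy
  have hsum := (((hasSum_skewForm (W w) y).add (hasSum_skewForm w (W y))).mul_left a).sub
    ((hasSum_skewForm w y).mul_left (k + k'))
  rw [hW.skewForm_map_left, neg_add_cancel, mul_zero, zero_sub] at hsum
  refine (hasSum_skewForm f y).unique (hsum.congr_fun fun j => ?_)
  have hyj := hy (Dirac.negPerm j)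
  rw [Dirac.coe_negPerm] at hyj
  rw [← hw j]
  linear_combination -(j.sign * w j) * hyj

theorem map_mem_rotCovariant (hW : IsPotentialMatrix W) {j₀ : Dirac}
    (hx : permOp (Dirac.rotPerm j₀) x = x) : W x ∈ rotCovariant j₀ := by
  rw [mem_rotCovariant_iff, permOp_apply_of_entry (hW.rot j₀), hx]

/-- The protected states. Both `W` and the equation `(A - j₀) x = f` respect the rotation about
`j₀`, and the latter is solvable for rotation covariant `f` since those vanish at `j₀`. Hence one
can look for a kernel vector of the form `c e_{j₀} - (A - j₀)⁻¹ f`. -/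
theorem exists_pencil_eq_zero (hW : IsPotentialMatrix W) (j₀ : Dirac) (a : ℂ) :
    ∃ x ≠ 0, pencil (diagInv 0) W a j₀.1 x = 0 := by
  have hfix : permOp (Dirac.rotPerm j₀) (lp.single 2 j₀ (1 : ℂ)) = lp.single 2 j₀ 1 := by
    rw [permOp_single, (Equiv.symm_apply_eq _).mpr (Dirac.rotPerm_self j₀).symm]
  rcases exists_kernel_or_surjOn_of_invariant (C := a • W * diagInv j₀.1)
    ((isCompactOperator_diagInv j₀.1).clm_comp (a • W)) (F := rotCovariant j₀)
    isClosed_rotCovariant (fun x hx => Submodule.smul_mem _ a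
      (hW.map_mem_rotCovariant (permOp_diagInv_of_mem hx))) with ⟨f, hf, hf0, hker⟩ | hsurj
  · change f + a • W (diagInv j₀.1 f) = 0 at hker
    refine ⟨_, ?_, pencil_single_sub_diagInv_eq_zero hf 0 (by simpa using hker)⟩
    rw [lp.single_zero, zero_sub, neg_ne_zero]
    intro h0
    rw [h0, map_zero, smul_zero, add_zero] at hker
    exact hf0 hker
  · obtain ⟨f, hf, hfeq⟩ := hsurj (a • W (lp.single 2 j₀ 1))
      (Submodule.smul_mem _ a (hW.map_mem_rotCovariant hfix))
    refine ⟨_, fun h0 => ?_, pencil_single_sub_diagInv_eq_zero hf 1 hfeq⟩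
    have hj₀ : (lp.single 2 j₀ (1 : ℂ) : DiracSeq) j₀ - diagInv j₀.1 f j₀ = 0 :=
      congrFun (congrArg Subtype.val h0) j₀
    rw [diagInv_apply, apply_self_eq_zero_of_mem hf, mul_zero, sub_zero, single_one_apply,
      if_pos rfl] at hj₀
    exact one_ne_zero hj₀

theorem pencil_permOp_shiftPerm (hW : IsPotentialMatrix W) {q : ℂ} (hq : q ∈ dualLattice)
    (hx : pencil (diagInv 0) W a k x = 0) :
    pencil (diagInv 0) W a (k - q) (permOp (Dirac.shiftPerm q hq) x) = 0 := by
  have hcomm := permOp_apply_of_entry (c := 1)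
    (fun i j => (hW.shift q hq i j).trans (one_mul _).symm) x
  rw [one_smul] at hcomm
  rw [pencil_diagInv_eq_zero_iff] at hx ⊢
  intro j
  have hxj := hx (Dirac.shiftPerm q hq j)
  rw [Dirac.coe_shiftPerm] at hxj
  rw [← hcomm, permOp_apply, permOp_apply]
  linear_combination hxj

theorem degenerate_sub (hW : IsPotentialMatrix W) {q : ℂ} (hq : q ∈ dualLattice)
    (h : Degenerate (diagInv 0) W diracPoints skewForm a k) :
    Degenerate (diagInv 0) W diracPoints skewForm a (k - q) := by
  obtain ⟨x, hx0, hx, hor⟩ := h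
  refine ⟨_, permOp_ne_zero hx0, hW.pencil_permOp_shiftPerm hq hx, hor.imp ?_ ?_⟩
  · intro hk hkq
    have hadd := Dirac.add_mem ⟨k - q, hkq⟩ hq
    rw [sub_add_cancel] at hadd
    exact hk hadd
  · rintro ⟨y, hy0, hy, hxy⟩
    refine ⟨_, permOp_ne_zero hy0, ?_, (skewForm_permOp_shiftPerm hq x y).trans hxy⟩
    rw [show -(k - q) = -k - -q by ring]
    exact hW.pencil_permOp_shiftPerm _ hy

theorem skewPencil (hW : IsPotentialMatrix W) :
    SkewPencil (diagInv 0) W diracPoints skewForm where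
  compact := isCompactOperator_diagInv 0
  skew := hW.skewForm_of_pencil_eq
  nondeg _ hy := exists_skewForm_ne_zero hy
  eigenvalue k hk a := hW.exists_pencil_eq_zero ⟨k, hk⟩ a
  neg_mem k hk := Dirac.neg_mem ⟨k, hk⟩
  periodic := by
    obtain ⟨R, hR⟩ := exists_mem_dualLattice_norm_sub_le
    refine ⟨R, fun k => ?_⟩
    obtain ⟨q, hq, hk⟩ := hR k
    exact ⟨k - q, hk, fun a => hW.degenerate_sub hq⟩
  zero _ := not_degenerate_zero

end IsPotentialMatrix

end Model

/-! ### Periodic functions on the plane -/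

theorem mem_lattice_iff_mem_span {γ : ℂ} :
    γ ∈ lattice ↔ γ ∈ Submodule.span ℤ (Set.range periods.basis) := by
  rw [lattice, PeriodPair.lattice_eq_span_range_basis]

theorem measurableSet_cell : MeasurableSet cell :=
  ZSpan.fundamentalDomain_measurableSet periods.basis

theorem isBounded_cell : Bornology.IsBounded cell :=
  ZSpan.fundamentalDomain_isBounded periods.basis

instance : IsFiniteMeasure (volume.restrict cell) :=
  ⟨by rw [Measure.restrict_apply_univ]; exact isBounded_cell.measure_lt_top⟩

theorem isAddFundamentalDomain_cell : IsAddFundamentalDomain lattice cell := by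
  rw [lattice, PeriodPair.lattice_eq_span_range_basis]
  exact ZSpan.isAddFundamentalDomain periods.basis volume

/-- The area of the fundamental cell. -/
def cellArea : ℝ := volume.real cell

theorem cellArea_pos : 0 < cellArea :=
  ENNReal.toReal_pos (ZSpan.measure_fundamentalDomain_ne_zero periods.basis)
    isBounded_cell.measure_lt_top.ne

section PeriodicIntegral

variable {E : Type*} [NormedAddCommGroup E] [NormedSpace ℝ E] {F : ℂ → E}

theorem setIntegral_cell_comp {σ : ℂ ≃ᵐ ℂ} (hσ : MeasurePreserving σ) (e : Equiv.Perm lattice)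
    (he : ∀ γ z, σ ((e γ : ℂ) + z) = γ + σ z) (hF : ∀ γ ∈ lattice, ∀ z, F (z + γ) = F z) :
    ∫ z in cell, F (σ z) = ∫ z in cell, F z := by
  have hdom : IsAddFundamentalDomain lattice (σ ⁻¹' cell) :=
    isAddFundamentalDomain_cell.preimage_of_equiv hσ.quasiMeasurePreserving e.bijective he
  have : VAddInvariantMeasure lattice ℂ volume :=
    ⟨fun c s _ => measure_preimage_add volume (c : ℂ) s⟩
  rw [isAddFundamentalDomain_cell.setIntegral_eq hdom,
    hσ.setIntegral_preimage_emb σ.measurableEmbedding]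
  intro γ z
  have hz := he (e.symm γ) z
  rw [e.apply_symm_apply] at hz
  change F (σ (γ + z)) = F (σ z)
  rw [hz, add_comm, hF _ (e.symm γ).2]

theorem setIntegral_cell_add_right (w : ℂ) (hF : ∀ γ ∈ lattice, ∀ z, F (z + γ) = F z) :
    ∫ z in cell, F (z + w) = ∫ z in cell, F z :=
  setIntegral_cell_comp (σ := MeasurableEquiv.addRight w) (measurePreserving_add_right volume w)
    (Equiv.refl _) (fun _ _ => add_assoc _ _ _) hF

theorem norm_omega : ‖omega‖ = 1 := by
  rw [omega, show (2 * π * I / 3 : ℂ) = ((2 * π / 3 : ℝ) : ℂ) * I by push_cast; ring,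
    norm_exp_ofReal_mul_I]

theorem omega_mul_mem_lattice {γ : ℂ} (hγ : γ ∈ lattice) : omega * γ ∈ lattice := by
  obtain ⟨m, n, rfl⟩ := mem_lattice_iff.mp hγ
  refine mem_lattice_iff.mpr ⟨n - m, -m, ?_⟩
  push_cast
  linear_combination m * omega_mul_self

/-- Division by `ω` as a permutation of the lattice. -/
def invRotLattice : Equiv.Perm lattice where
  toFun γ := ⟨omega * (omega * γ), omega_mul_mem_lattice (omega_mul_mem_lattice γ.2)⟩
  invFun γ := ⟨omega * γ, omega_mul_mem_lattice γ.2⟩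
  left_inv γ := Subtype.ext (by linear_combination (γ : ℂ) * omega_mul_omega_mul_self)
  right_inv γ := Subtype.ext (by linear_combination (γ : ℂ) * omega_mul_omega_mul_self)

/-- Multiplication by `ω` as an isometry of the plane. -/
def rotPlane : ℂ ≃ₗᵢ[ℝ] ℂ := rotation ⟨omega, by simp [Submonoid.unitSphere, norm_omega]⟩

theorem setIntegral_cell_omega_mul (hF : ∀ γ ∈ lattice, ∀ z, F (z + γ) = F z) :
    ∫ z in cell, F (omega * z) = ∫ z in cell, F z := by
  refine setIntegral_cell_comp (σ := rotPlane.toMeasurableEquiv) rotPlane.measurePreserving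
    invRotLattice (fun γ z => ?_) hF
  change omega * (omega * (omega * (γ : ℂ)) + z) = γ + omega * z
  linear_combination (γ : ℂ) * omega_mul_omega_mul_self

theorem exists_finite_cover_of_isBounded {S : Set ℂ} (hS : Bornology.IsBounded S) :
    ∃ F : Set ℂ, F.Finite ∧ F ⊆ lattice ∧ S ⊆ ⋃ γ ∈ F, (fun z => z - γ) ⁻¹' cell := by
  refine ⟨_, ZSpan.setFinite_inter periods.basis (hS.sub isBounded_cell),
    fun γ hγ => mem_lattice_iff_mem_span.mpr hγ.2, fun z hz => ?_⟩
  obtain ⟨γ, hγ, -⟩ := ZSpan.exist_unique_vadd_mem_fundamentalDomain periods.basis z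
  have hγz : (γ : ℂ) + z ∈ cell := hγ
  refine Set.mem_biUnion (x := -(γ : ℂ)) ⟨⟨z, hz, _, hγz, ?_⟩, neg_mem γ.2⟩ ?_
  · exact sub_add_cancel_right _ _
  · rwa [Set.mem_preimage, sub_neg_eq_add, add_comm]

theorem exists_lintegral_le_mul_lintegral_cell {S : Set ℂ} (hS : Bornology.IsBounded S) :
    ∃ N : ℕ, ∀ h : ℂ → ENNReal, (∀ γ ∈ lattice, ∀ᵐ z, h (z + γ) = h z) →
      ∫⁻ z in S, h z ≤ N * ∫⁻ z in cell, h z := by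
  obtain ⟨F, hfin, hF, hSF⟩ := exists_finite_cover_of_isBounded hS
  have := hfin.fintype
  refine ⟨Fintype.card F, fun h hper => ?_⟩
  have htranslate (γ : F) :
      ∫⁻ z in (fun z => z - (γ : ℂ)) ⁻¹' cell, h z = ∫⁻ z in cell, h z := by
    have hcomp := (measurePreserving_sub_right volume (γ : ℂ)).setLIntegral_comp_preimage_emb
      (MeasurableEquiv.subRight (γ : ℂ)).measurableEmbedding (fun w => h (w + γ)) cell
    simp only [sub_add_cancel] at hcomp
    rw [hcomp]
    exact lintegral_congr_ae (ae_restrict_of_ae (hper γ (hF γ.2)))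
  calc ∫⁻ z in S, h z ≤ ∫⁻ z in ⋃ γ ∈ F, (fun z => z - γ) ⁻¹' cell, h z := lintegral_mono_set hSF
    _ ≤ ∑ γ : F, ∫⁻ z in (fun z => z - (γ : ℂ)) ⁻¹' cell, h z := by
        rw [← tsum_fintype (L := .unconditional _), ← lintegral_sum_measure]
        exact lintegral_mono' (Measure.restrict_biUnion_le hfin.countable) le_rfl
    _ = Fintype.card F * ∫⁻ z in cell, h z := by
        rw [Finset.sum_congr rfl fun γ _ => htranslate γ, Finset.sum_const, nsmul_eq_mul,
          Finset.card_univ]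

end PeriodicIntegral

/-! ### Completeness of the characters of the torus -/

section Torus

/-- The circle carries its normalized Haar measure. -/
local instance : MeasureSpace UnitAddCircle := ⟨AddCircle.haarAddCircle⟩

variable {d : Type*}

/-- The half open unit box, with upper bound `0 + 1` as in the coordinates
`UnitAddTorus.measurableEquivPiIoc` of the torus. -/
def unitBox (d : Type*) : Set (d → ℝ) := {x | ∀ i, x i ∈ Set.Ioc (0 : ℝ) (0 + 1)}

/-- The coordinates in the unit box of a point of the torus. -/
def torusCoord (t : UnitAddTorus d) : d → ℝ :=
  (UnitAddTorus.measurableEquivPiIoc (fun _ => 0) t).1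

theorem coe_torusCoord (t : UnitAddTorus d) (i : d) : (torusCoord t i : UnitAddCircle) = t i :=
  congrFun ((UnitAddTorus.measurableEquivPiIoc fun _ => 0).symm_apply_apply t) i

theorem measurableSet_unitBox [Countable d] : MeasurableSet (unitBox d) :=
  MeasurableSet.univ_pi' fun _ => measurableSet_Ioc

theorem measurableEmbedding_torusCoord [Countable d] : MeasurableEmbedding (torusCoord (d := d)) :=
  (MeasurableEmbedding.subtype_coe measurableSet_unitBox).comp
    (UnitAddTorus.measurableEquivPiIoc fun _ => 0).measurableEmbedding

variable [Fintype d]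

theorem measurePreserving_torusCoord :
    MeasurePreserving (torusCoord (d := d)) volume (volume.restrict (unitBox d)) :=
  (measurePreserving_subtype_coe measurableSet_unitBox).comp
    (UnitAddTorus.measurePreserving_equivPiIoc fun _ => 0)

theorem mFourierCoeff_comp_torusCoord (g : (d → ℝ) → ℂ) (n : d → ℤ) :
    UnitAddTorus.mFourierCoeff (g ∘ torusCoord) (-n) =
      ∫ x in unitBox d, (∏ i, exp (2 * π * I * n i * x i)) * g x := by
  rw [UnitAddTorus.mFourierCoeff,
    ← measurePreserving_torusCoord.integral_comp measurableEmbedding_torusCoord]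
  refine integral_congr_ae (.of_forall fun t => ?_)
  change UnitAddTorus.mFourier (- -n) t * g (torusCoord t) = _
  rw [neg_neg]
  congr 1
  refine Finset.prod_congr rfl fun i _ => ?_
  rw [← coe_torusCoord t i, fourier_coe_apply, ofReal_one, div_one]

theorem ae_eq_zero_of_mFourierCoeff_eq_zero {G : UnitAddTorus d → ℂ} (hG : MemLp G 2)
    (h : ∀ n, UnitAddTorus.mFourierCoeff G n = 0) : G =ᵐ[volume] 0 := by
  have hzero : hG.toLp G = 0 := by
    rw [← UnitAddTorus.mFourierBasis.repr.map_eq_zero_iff]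
    ext n
    rw [UnitAddTorus.mFourierBasis_repr, lp.coeFn_zero, Pi.zero_apply, ← h n]
    refine integral_congr_ae (hG.coeFn_toLp.mono fun t ht => ?_)
    simp only [ht]
  exact (hG.toLp_eq_toLp_iff MemLp.zero).mp (hzero.trans (MemLp.toLp_zero _).symm)

theorem ae_eq_zero_of_integral_unitBox_eq_zero {g : (d → ℝ) → ℂ}
    (hg : MemLp g 2 (volume.restrict (unitBox d)))
    (h : ∀ n : d → ℤ, ∫ x in unitBox d, (∏ i, exp (2 * π * I * n i * x i)) * g x = 0) :
    g =ᵐ[volume.restrict (unitBox d)] 0 := by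
  rw [Filter.EventuallyEq, ← measurePreserving_torusCoord.map_eq,
    measurableEmbedding_torusCoord.ae_map_iff]
  refine ae_eq_zero_of_mFourierCoeff_eq_zero
    (hg.comp_measurePreserving measurePreserving_torusCoord) fun n => ?_
  have hcoeff := mFourierCoeff_comp_torusCoord g (-n)
  rwa [neg_neg, h] at hcoeff

end Torus

/-- The coordinates of the plane in the basis of periods. -/
def cellCoord : (Fin 2 → ℝ) ≃L[ℝ] ℂ := periods.basis.equivFun.symm.toContinuousLinearEquiv

theorem cellCoord_apply (s : Fin 2 → ℝ) : cellCoord s = s 0 * omega + s 1 := by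
  change periods.basis.equivFun.symm s = _
  rw [Module.Basis.equivFun_symm_apply, Fin.sum_univ_two]
  simp [periods]

theorem preimage_cellCoord_cell :
    cellCoord ⁻¹' cell = Set.univ.pi fun _ => Set.Ico (0 : ℝ) 1 := by
  ext s
  have hrepr (i : Fin 2) : periods.basis.repr (cellCoord s) i = s i :=
    congrFun (periods.basis.equivFun.apply_symm_apply s) i
  change (∀ i, periods.basis.repr (cellCoord s) i ∈ _) ↔ _
  simp only [hrepr, Set.mem_pi, Set.mem_univ, true_imp_iff]

theorem unitBox_ae_eq : unitBox (Fin 2) =ᵐ[volume] (cellCoord ⁻¹' cell : Set (Fin 2 → ℝ)) := by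
  have hbox : unitBox (Fin 2) = Set.univ.pi fun _ => Set.Ioc (0 : ℝ) 1 := by ext; simp [unitBox]
  rw [preimage_cellCoord_cell, hbox]
  exact Measure.univ_pi_Ioc_ae_eq_Icc.trans Measure.univ_pi_Ico_ae_eq_Icc.symm

theorem exists_map_cellCoord_eq_smul : ∃ c : NNReal, c ≠ 0 ∧
    Measure.map cellCoord (volume.restrict (unitBox (Fin 2))) = c • volume.restrict cell := by
  have := cellCoord.isAddHaarMeasure_map (volume : Measure (Fin 2 → ℝ))
  refine ⟨_, (Measure.addHaarScalarFactor_pos_of_isAddHaarMeasure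
    (Measure.map cellCoord (volume : Measure (Fin 2 → ℝ))) (volume : Measure ℂ)).ne', ?_⟩
  rw [Measure.restrict_congr_set unitBox_ae_eq, ← Measure.restrict_smul,
    ← Measure.isAddLeftInvariant_eq_smul,
    Measure.restrict_map cellCoord.continuous.measurable measurableSet_cell]

theorem pairing_dualScale_mul (m n : ℤ) (s : Fin 2 → ℝ) :
    pairing (dualScale * (m * omega + n)) (cellCoord s) = 2 * π * (n * s 0 - m * s 1) := by
  have hscale : dualScale = ((4 * π / √3 : ℝ) : ℂ) * I := by
    rw [dualScale]
    push_cast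
    ring
  rw [cellCoord_apply, pairing, hscale]
  simp [omega_re, omega_im]
  field_simp
  ring

/-! ### Characters and the twisted translations -/

/-- The character `z ↦ e^{i⟨q,z⟩}` of the plane. -/
def character (q z : ℂ) : ℂ := exp (I * pairing q z)

theorem character_comm (q z : ℂ) : character q z = character z q := by
  simp [character, pairing, mul_comm]

@[simp]
theorem character_zero_right (q : ℂ) : character q 0 = 1 := by simp [character, pairing]

@[simp]
theorem character_zero_left (z : ℂ) : character 0 z = 1 := by simp [character, pairing]

theorem character_add_left (p q z : ℂ) :
    character (p + q) z = character p z * character q z := by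
  simp only [character, pairing, add_mul, add_re, ofReal_add, mul_add, exp_add]

theorem character_add_right (q z w : ℂ) :
    character q (z + w) = character q z * character q w := by
  simp only [character_comm q, character_add_left]

theorem character_neg_left (q z : ℂ) : character (-q) z = (character q z)⁻¹ :=
  eq_inv_of_mul_eq_one_left (by rw [← character_add_left, neg_add_cancel, character_zero_left])

theorem character_ne_zero (q z : ℂ) : character q z ≠ 0 := exp_ne_zero _

@[simp]
theorem norm_character (q z : ℂ) : ‖character q z‖ = 1 := norm_exp_I_mul_ofReal _

theorem conj_character (q z : ℂ) : conj (character q z) = character (-q) z := by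
  rw [character_neg_left, inv_eq_conj (norm_character q z)]

theorem contDiff_character (q : ℂ) : ContDiff ℝ ∞ (character q) := by
  have hpairing : ContDiff ℝ ∞ (pairing q) :=
    reCLM.contDiff.comp (contDiff_const.mul conjCLE.contDiff)
  exact (contDiff_const.mul (ofRealCLM.contDiff.comp hpairing)).cexp

theorem continuous_character (q : ℂ) : Continuous (character q) :=
  (contDiff_character q).continuous

theorem character_eq_one {q γ : ℂ} (hq : q ∈ dualLattice) (hγ : γ ∈ lattice) :
    character q γ = 1 := by
  obtain ⟨m, n, rfl⟩ := mem_dualLattice_iff.mp hq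
  obtain ⟨k, l, rfl⟩ := mem_lattice_iff.mp hγ
  have hpairing := pairing_dualScale_mul m n ![k, l]
  rw [cellCoord_apply] at hpairing
  simp only [Matrix.cons_val_zero, Matrix.cons_val_one, ofReal_intCast] at hpairing
  rw [character, hpairing, exp_eq_one_iff]
  exact ⟨n * k - m * l, by push_cast; ring⟩

theorem character_add_lattice {q γ : ℂ} (hq : q ∈ dualLattice) (hγ : γ ∈ lattice) (z : ℂ) :
    character q (z + γ) = character q z := by
  rw [character_add_right, character_eq_one hq hγ, mul_one]

theorem exists_character_ne_one {q : ℂ} (hq : q ≠ 0) : ∃ w, character q w ≠ 1 := by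
  have hnorm : normSq q ≠ 0 := normSq_eq_zero.not.mpr hq
  refine ⟨((π / normSq q : ℝ) : ℂ) * q, ?_⟩
  have hpairing : pairing q (((π / normSq q : ℝ) : ℂ) * q) = π := by
    rw [pairing, map_mul, conj_ofReal, mul_left_comm, mul_conj, ← ofReal_mul, ofReal_re,
      div_mul_cancel₀ _ hnorm]
  rw [character, hpairing, mul_comm, exp_pi_mul_I]
  norm_num

theorem setIntegral_cell_character {q : ℂ} (hq : q ∈ dualLattice) :
    ∫ z in cell, character q z = if q = 0 then (cellArea : ℂ) else 0 := by
  split_ifs with h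
  · simp [h, cellArea]
  · obtain ⟨w, hw⟩ := exists_character_ne_one h
    have hshift := setIntegral_cell_add_right w fun γ hγ z => character_add_lattice hq hγ z
    simp only [character_add_right] at hshift
    rw [integral_mul_const] at hshift
    by_contra hne
    exact hw ((mul_eq_left₀ hne).mp hshift)

theorem ae_eq_zero_of_setIntegral_cell_character_mul_eq_zero {f : ℂ → ℂ}
    (hf : MemLp f 2 (volume.restrict cell))
    (h : ∀ q ∈ dualLattice, ∫ z in cell, character q z * f z = 0) :
    f =ᵐ[volume.restrict cell] 0 := by
  obtain ⟨c, hc, hmap⟩ := exists_map_cellCoord_eq_smul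
  have hemb : MeasurableEmbedding cellCoord := cellCoord.toHomeomorph.measurableEmbedding
  have hbox : f ∘ cellCoord =ᵐ[volume.restrict (unitBox (Fin 2))] 0 := by
    refine ae_eq_zero_of_integral_unitBox_eq_zero ?_ fun n => ?_
    · rw [← hemb.memLp_map_measure_iff, hmap]
      exact hf.smul_measure ENNReal.coe_ne_top
    · have hcell : ∫ z, character (dualScale * ((-n 1 : ℤ) * omega + (n 0 : ℤ))) z * f z
          ∂(c • volume.restrict cell) = 0 := by
        rw [integral_smul_nnreal_measure, h _ (mem_dualLattice_iff.mpr ⟨_, _, rfl⟩), smul_zero]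
      rw [← hmap, hemb.integral_map] at hcell
      rw [← hcell]
      refine integral_congr_ae (.of_forall fun s => ?_)
      simp only [Function.comp_apply]
      rw [character, pairing_dualScale_mul, Fin.prod_univ_two, ← exp_add]
      congr 2
      push_cast
      ring
  have hsmul : ∀ᵐ z ∂(c • volume.restrict cell), f z = 0 := by
    rwa [← hmap, hemb.ae_map_iff]
  exact (Measure.ae_ennreal_smul_measure_iff (ENNReal.coe_ne_zero.mpr hc)).mp hsmul

/-! ### Restriction to the cell -/

theorem twist_eq_diagonal (γ : ℂ) :
    twist γ = Matrix.diagonal ![character γ K, (character γ K)⁻¹] := by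
  rw [twist, exp_neg]
  ext i j
  fin_cases i <;> fin_cases j <;> rfl

theorem twist_add (γ δ : ℂ) : twist (γ + δ) = twist γ * twist δ := by
  simp only [twist_eq_diagonal, Matrix.diagonal_mul_diagonal, character_add_left, mul_inv]
  congr 1
  ext i
  fin_cases i <;> rfl

theorem twist_zero : twist 0 = 1 := by
  rw [twist_eq_diagonal, character_zero_left, inv_one, ← Matrix.diagonal_one]
  congr 1
  ext i
  fin_cases i <;> rfl

theorem act_twist_apply (γ : ℂ) (x : C2) (i : Fin 2) :
    act (twist γ) x i = ![character γ K, (character γ K)⁻¹] i * x i := by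
  simp [twist_eq_diagonal, Matrix.mulVec_diagonal]

theorem norm_act_twist (γ : ℂ) (x : C2) : ‖act (twist γ) x‖ = ‖x‖ := by
  simp [EuclideanSpace.norm_eq, Fin.sum_univ_two, act_twist_apply]

theorem continuous_twist : Continuous twist := by
  have hcharacter : Continuous fun γ => character γ K :=
    (continuous_character K).congr (character_comm K)
  simp only [funext twist_eq_diagonal]
  refine Continuous.matrix_diagonal (continuous_pi fun i => ?_)
  fin_cases i
  · exact hcharacter
  · exact hcharacter.inv₀ fun γ => character_ne_zero γ K

theorem LocL2.of_continuous {f : ℂ → C2} (hf : Continuous f) : LocL2 f := by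
  intro S hS
  have : IsFiniteMeasure (volume.restrict S) :=
    ⟨by rw [Measure.restrict_apply_univ]; exact hS.measure_lt_top⟩
  obtain ⟨C, hC⟩ := hS.exists_bound_of_continuousOn hf.continuousOn
  exact .of_bound hf.aestronglyMeasurable C ((ae_restrict_mem hS.measurableSet).mono hC)

theorem QuasiPeriodic.enorm_add_ae_eq {p : ℂ} {f : ℂ → C2} (hf : QuasiPeriodic p f) {γ : ℂ}
    (hγ : γ ∈ lattice) : ∀ᵐ z, ‖f (z + γ)‖ₑ = ‖f z‖ₑ := by
  filter_upwards [hf γ hγ] with z hz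
  have hnorm : ‖ChiralTBG.act (twist γ) (f (z + γ))‖ = ‖character p γ • f z‖ := congrArg norm hz
  rw [norm_act_twist, norm_smul, norm_character, one_mul] at hnorm
  rw [← ofReal_norm, hnorm, ofReal_norm]

theorem QuasiPeriodic.locL2 {p : ℂ} {f : ℂ → C2} (hf : QuasiPeriodic p f)
    (hmeas : AEStronglyMeasurable f) (hcell : MemLp f 2 (volume.restrict cell)) : LocL2 f := by
  intro S hS
  obtain ⟨N, hN⟩ := exists_lintegral_le_mul_lintegral_cell hS.isBounded
  have hfinite := hcell.2
  refine ⟨hmeas.restrict, ?_⟩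
  rw [eLpNorm_lt_top_iff_lintegral_rpow_enorm_lt_top (by norm_num) (by norm_num)] at hfinite ⊢
  refine (hN _ fun γ hγ => ?_).trans_lt (ENNReal.mul_lt_top (ENNReal.natCast_lt_top N) hfinite)
  filter_upwards [hf.enorm_add_ae_eq hγ] with z hz
  rw [hz]

/-- The lattice point `γ` with `z - γ` in the fundamental cell. -/
def cellFloor (z : ℂ) : ℂ := ZSpan.floor periods.basis z

theorem sub_cellFloor (z : ℂ) : z - cellFloor z = ZSpan.fract periods.basis z := rfl

theorem cellFloor_add {γ : ℂ} (hγ : γ ∈ lattice) (z : ℂ) :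
    cellFloor (z + γ) = cellFloor z + γ := by
  have hfract := ZSpan.fract_add_ZSpan periods.basis z (mem_lattice_iff_mem_span.mp hγ)
  rw [← sub_cellFloor, ← sub_cellFloor] at hfract
  linear_combination -hfract

theorem cellFloor_of_mem {z : ℂ} (hz : z ∈ cell) : cellFloor z = 0 := by
  rw [← sub_eq_self (a := z), sub_cellFloor]
  exact ZSpan.fract_eq_self.mpr hz

theorem measurable_cellFloor : Measurable cellFloor := by
  have hsum : cellFloor =
      fun z => ∑ i, ((⌊periods.basis.repr z i⌋ : ℤ) : ℂ) * periods.basis i := by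
    ext z
    simp [cellFloor, ZSpan.floor]
  rw [hsum]
  refine Finset.measurable_sum _ fun i _ => ?_
  have hcoord : Measurable fun z => periods.basis.repr z i :=
    (LinearMap.continuous_of_finiteDimensional (periods.basis.coord i)).measurable
  have hcast : Measurable fun n : ℤ => (n : ℂ) := measurable_from_top
  exact (hcast.comp hcoord.floor).mul_const _

/-- The quasi-periodic extension to the plane of a function on the fundamental cell. -/
def extend (p : ℂ) (f : ℂ → C2) (z : ℂ) : C2 :=
  character p (cellFloor z) • act (twist (-cellFloor z)) (f (z - cellFloor z))

theorem extend_of_mem (p : ℂ) (f : ℂ → C2) {z : ℂ} (hz : z ∈ cell) : extend p f z = f z := by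
  rw [extend, cellFloor_of_mem hz, character_zero_right, neg_zero, twist_zero, act, map_one,
    sub_zero, one_smul, one_apply_eq_self]

theorem quasiPeriodic_extend (p : ℂ) (f : ℂ → C2) : QuasiPeriodic p (extend p f) := by
  refine fun γ hγ => .of_forall fun z => ?_
  change act (twist γ) (extend p f (z + γ)) = character p γ • extend p f z
  have htwist : twist γ * twist (-(cellFloor z + γ)) = twist (-cellFloor z) := by
    rw [← twist_add, neg_add_rev, add_neg_cancel_left]
  rw [extend, extend, cellFloor_add hγ, map_smul, ← mul_apply_eq_comp, act, act, ← map_mul, htwist,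
    add_sub_add_right_eq_sub, character_add_right, mul_comm, mul_smul]

theorem stronglyMeasurable_extend (p : ℂ) {f : ℂ → C2} (hf : StronglyMeasurable f) :
    StronglyMeasurable (extend p f) := by
  have hfract : StronglyMeasurable fun z => f (z - cellFloor z) :=
    hf.comp_measurable (measurable_id.sub measurable_cellFloor)
  have htwist : StronglyMeasurable fun z => act (twist (-cellFloor z)) :=
    (continuous_act (continuous_twist.comp continuous_neg)).stronglyMeasurable.comp_measurable
      measurable_cellFloor
  exact ((continuous_character p).stronglyMeasurable.comp_measurable measurable_cellFloor).smul
    (isBoundedBilinearMap_apply.continuous.comp_stronglyMeasurable (htwist.prodMk hfract))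

theorem restrictCell_surjective (p : ℂ) : Function.Surjective (restrictCell p) := by
  intro f
  have hcell : extend p f =ᵐ[volume.restrict cell] f :=
    (ae_restrict_mem measurableSet_cell).mono fun z hz => extend_of_mem p f hz
  have hquasi := quasiPeriodic_extend p f
  have hloc : LocL2 (extend p f) := hquasi.locL2
    (stronglyMeasurable_extend p (Lp.stronglyMeasurable f)).aestronglyMeasurable
    ((memLp_congr_ae hcell).mpr (Lp.memLp f))
  refine ⟨L2.mk _ hloc hquasi, Lp.ext ?_⟩
  have hmk : (L2.mk _ hloc hquasi).1 =ᵐ[volume.restrict cell] extend p f :=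
    ae_restrict_of_ae (L2.coeFn_mk _ hloc hquasi)
  exact (L2.mk _ hloc hquasi).2.1.memLp_cell.coeFn_toLp.trans (hmk.trans hcell)

/-- Restriction to the fundamental cell as an isometric isomorphism. -/
def restrictCellEquiv (p : ℂ) : L2 p ≃ₗᵢ[ℂ] Lp C2 2 (volume.restrict cell) where
  toLinearEquiv := LinearEquiv.ofBijective (restrictCell p)
    ⟨restrictCell_injective p, restrictCell_surjective p⟩
  norm_map' _ := rfl

theorem coeFn_restrictCellEquiv {p : ℂ} (u : L2 p) :
    restrictCellEquiv p u =ᵐ[volume.restrict cell] u.1 :=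
  u.2.1.memLp_cell.coeFn_toLp

instance (p : ℂ) : CompleteSpace (L2 p) :=
  (restrictCellEquiv p).toIsometryEquiv.completeSpace

/-! ### Plane waves -/

/-- The plane wave of frequency `j + p`, of norm one on the fundamental cell. It takes its values
in the component of `ℂ²` for which it is quasi-periodic. -/
def wave (p : ℂ) (j : Dirac) (z : ℂ) : C2 :=
  (((√cellArea)⁻¹ : ℝ) * character (j.1 + p) z) • EuclideanSpace.single j.comp 1

theorem contDiff_wave (p : ℂ) (j : Dirac) : ContDiff ℝ ∞ (wave p j) :=
  (contDiff_const.mul (contDiff_character _)).smul contDiff_const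

theorem wave_add (p : ℂ) (j : Dirac) (z w : ℂ) :
    wave p j (z + w) = character (j.1 + p) w • wave p j z := by
  rw [wave, wave, character_add_right, smul_smul]
  congr 1
  ring

theorem act_twist_single (j : Dirac) {γ : ℂ} (hγ : γ ∈ lattice) :
    act (twist γ) (EuclideanSpace.single j.comp 1) =
      (character j.1 γ)⁻¹ • EuclideanSpace.single j.comp (1 : ℂ) := by
  have hentry : ![character γ K, (character γ K)⁻¹] j.comp = (character j.1 γ)⁻¹ := by
    rw [character_comm γ]
    rcases Fin.exists_fin_two.mp ⟨j.comp, rfl⟩ with hj | hj <;> rw [hj]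
    · have hone := character_eq_one (Dirac.comp_eq_zero_iff.mp hj) hγ
      rw [character_add_left] at hone
      exact eq_inv_of_mul_eq_one_right hone
    · have hone := character_eq_one (Dirac.comp_eq_one_iff.mp hj) hγ
      rw [sub_eq_add_neg, character_add_left, character_neg_left] at hone
      exact eq_inv_of_mul_eq_one_right hone
  ext i
  rw [act_twist_apply, PiLp.smul_apply, PiLp.single_apply]
  split_ifs with h
  · rw [h, hentry, smul_eq_mul]
  · simp

theorem quasiPeriodic_wave (p : ℂ) (j : Dirac) : QuasiPeriodic p (wave p j) := by
  refine fun γ hγ => .of_forall fun z => ?_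
  change act (twist γ) (wave p j (z + γ)) = character p γ • wave p j z
  rw [wave_add, map_smul, wave, map_smul, act_twist_single j hγ, smul_smul, smul_smul, smul_smul]
  congr 1
  rw [character_add_left j.1 p γ]
  field_simp [character_ne_zero j.1 γ]

/-- The normalized plane waves as elements of `L²_p`. -/
def waveL2 (p : ℂ) (j : Dirac) : L2 p :=
  L2.mk (wave p j) (.of_continuous (contDiff_wave p j).continuous) (quasiPeriodic_wave p j)

theorem coeFn_waveL2 (p : ℂ) (j : Dirac) : (waveL2 p j).1 =ᵐ[volume] wave p j :=
  L2.coeFn_mk _ _ _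

/-- The normalized plane waves as square integrable functions on the fundamental cell. -/
def waveCell (p : ℂ) (j : Dirac) : Lp C2 2 (volume.restrict cell) :=
  restrictCellEquiv p (waveL2 p j)

theorem coeFn_waveCell (p : ℂ) (j : Dirac) : waveCell p j =ᵐ[volume.restrict cell] wave p j :=
  (coeFn_restrictCellEquiv _).trans (ae_restrict_of_ae (coeFn_waveL2 p j))

theorem inner_wave (p : ℂ) (j : Dirac) (z : ℂ) (x : C2) : inner ℂ (wave p j z) x =
    ((√cellArea)⁻¹ : ℝ) * (character (-(j.1 + p)) z * x j.comp) := by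
  rw [wave, inner_smul_left, EuclideanSpace.inner_single_left, map_mul, conj_ofReal,
    conj_character, map_one, one_mul, mul_assoc]

theorem inner_waveCell (p : ℂ) (j : Dirac) (f : Lp C2 2 (volume.restrict cell)) :
    inner ℂ (waveCell p j) f =
      ((√cellArea)⁻¹ : ℝ) * ∫ z in cell, character (-(j.1 + p)) z * f z j.comp := by
  rw [L2.inner_def, ← integral_const_mul]
  refine integral_congr_ae ?_
  filter_upwards [coeFn_waveCell p j] with z hz
  rw [hz, inner_wave]

theorem Dirac.sub_mem_of_comp_eq {i j : Dirac} (h : i.comp = j.comp) :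
    i.1 - j.1 ∈ dualLattice := by
  rcases Fin.exists_fin_two.mp ⟨j.comp, rfl⟩ with hj | hj
  · simpa using sub_mem_dualLattice (comp_eq_zero_iff.mp (h.trans hj))
      (comp_eq_zero_iff.mp hj)
  · simpa using sub_mem_dualLattice (comp_eq_one_iff.mp (h.trans hj))
      (comp_eq_one_iff.mp hj)

theorem inner_wave_wave_of_comp_eq {i j : Dirac} (h : i.comp = j.comp) (p z : ℂ) :
    inner ℂ (wave p i z) (wave p j z) = (cellArea : ℂ)⁻¹ * character (j.1 - i.1) z := by
  have hscale : (((√cellArea)⁻¹ : ℝ) : ℂ) * ((√cellArea)⁻¹ : ℝ) = (cellArea : ℂ)⁻¹ := by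
    rw [← ofReal_mul, ← mul_inv, Real.mul_self_sqrt cellArea_pos.le, ofReal_inv]
  have hfreq : j.1 - i.1 = -(i.1 + p) + (j.1 + p) := by ring
  rw [inner_wave, wave, hfreq, character_add_left (-(i.1 + p)), ← hscale, h]
  simp only [PiLp.smul_apply, PiLp.single_apply, if_true, smul_eq_mul]
  ring

theorem inner_wave_wave_of_comp_ne {i j : Dirac} (h : i.comp ≠ j.comp) (p z : ℂ) :
    inner ℂ (wave p i z) (wave p j z) = 0 := by
  rw [inner_wave, wave]
  simp [h]

theorem orthonormal_waveCell (p : ℂ) : Orthonormal ℂ (waveCell p) := by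
  classical
  rw [orthonormal_iff_ite]
  intro i j
  have hinner : inner ℂ (waveCell p i) (waveCell p j) =
      ∫ z in cell, inner ℂ (wave p i z) (wave p j z) := by
    rw [L2.inner_def]
    refine integral_congr_ae ?_
    filter_upwards [coeFn_waveCell p i, coeFn_waveCell p j] with z hi hj
    rw [hi, hj]
  rw [hinner]
  by_cases h : i.comp = j.comp
  · simp only [inner_wave_wave_of_comp_eq h, integral_const_mul]
    rw [setIntegral_cell_character (Dirac.sub_mem_of_comp_eq h.symm), mul_ite, mul_zero,
      inv_mul_cancel₀ (ofReal_ne_zero.mpr cellArea_pos.ne')]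
    simp only [sub_eq_zero, Subtype.coe_inj, eq_comm (a := j)]
  · simp only [inner_wave_wave_of_comp_ne h, integral_zero]
    rw [if_neg fun hij => h (congrArg Dirac.comp hij)]

theorem Dirac.exists_comp_eq (i : Fin 2) : ∃ j : Dirac, j.comp = i := by
  have hzero : (0 : ℂ) ∈ dualLattice := ⟨0, zero_mem _, by simp⟩
  rcases Fin.exists_fin_two.mp ⟨i, rfl⟩ with rfl | rfl
  · exact ⟨⟨-K, Or.inr (by simpa using hzero)⟩, comp_eq_zero_iff.mpr (by simpa using hzero)⟩
  · exact ⟨⟨K, Or.inl (by simpa using hzero)⟩, comp_eq_one_iff.mpr (by simpa using hzero)⟩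

theorem ae_eq_zero_of_inner_waveCell_eq_zero {p : ℂ} {f : Lp C2 2 (volume.restrict cell)}
    (hf : ∀ j, inner ℂ (waveCell p j) f = 0) (i : Fin 2) :
    (fun z => f z i) =ᵐ[volume.restrict cell] 0 := by
  obtain ⟨j₀, hj₀⟩ := Dirac.exists_comp_eq i
  have hcomp : MemLp (fun z => f z i) 2 (volume.restrict cell) :=
    (EuclideanSpace.proj (𝕜 := ℂ) i).comp_memLp' (Lp.memLp f)
  have hmodulated : MemLp (fun z => character (-(j₀.1 + p)) z * f z i) 2
      (volume.restrict cell) :=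
    hcomp.of_le ((continuous_character _).aestronglyMeasurable.mul hcomp.1)
      (.of_forall fun z => by rw [norm_mul, norm_character, one_mul])
  have hzero := ae_eq_zero_of_setIntegral_cell_character_mul_eq_zero hmodulated fun q hq => by
    have hq' := neg_mem_dualLattice_iff.mpr hq
    have hj : (Dirac.shiftPerm (-q) hq' j₀).comp = i :=
      (Dirac.comp_eq_of_add hq' (Dirac.coe_shiftPerm _ hq' j₀)).trans hj₀
    have hinner := hf (Dirac.shiftPerm (-q) hq' j₀)
    rw [inner_waveCell, hj, Dirac.coe_shiftPerm, mul_eq_zero_iff_left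
      (ofReal_ne_zero.mpr (inv_ne_zero (Real.sqrt_ne_zero'.mpr cellArea_pos)))] at hinner
    rw [← hinner]
    congr 1 with z
    rw [← mul_assoc, ← character_add_left]
    congr 2
    ring
  filter_upwards [hzero] with z hz
  exact (mul_eq_zero.mp hz).resolve_left (character_ne_zero _ _)

theorem orthogonal_span_waveCell (p : ℂ) :
    (Submodule.span ℂ (Set.range (waveCell p)))ᗮ = ⊥ := by
  refine (Submodule.eq_bot_iff _).mpr fun f hf => ?_
  have hzero := ae_eq_zero_of_inner_waveCell_eq_zero fun j =>
    (Submodule.mem_orthogonal _ _).mp hf _ (Submodule.subset_span ⟨j, rfl⟩)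
  refine Lp.ext ?_
  filter_upwards [ae_all_iff.mpr hzero, Lp.coeFn_zero C2 2 (volume.restrict cell)] with z hz hz₀
  rw [hz₀]
  ext i
  exact hz i

/-- The Hilbert basis of normalized plane waves. -/
def waveBasis (p : ℂ) : HilbertBasis Dirac ℂ (Lp C2 2 (volume.restrict cell)) :=
  .mkOfOrthogonalEqBot (orthonormal_waveCell p) (orthogonal_span_waveCell p)

theorem waveBasis_apply (p : ℂ) (j : Dirac) : waveBasis p j = waveCell p j :=
  congrFun (HilbertBasis.coe_mkOfOrthogonalEqBot _ _) j

/-- The Fourier transform `L²_p ≃ ℓ²(𝒦₀)`. -/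
def fourierL2 (p : ℂ) : L2 p ≃ₗᵢ[ℂ] DiracSeq := (restrictCellEquiv p).trans (waveBasis p).repr

theorem fourierL2_apply {p : ℂ} (u : L2 p) (j : Dirac) : fourierL2 p u j =
    ((√cellArea)⁻¹ : ℝ) * ∫ z in cell, character (-(j.1 + p)) z * u.1 z j.comp := by
  change (waveBasis p).repr (restrictCellEquiv p u) j = _
  rw [HilbertBasis.repr_apply_apply, waveBasis_apply, inner_waveCell]
  congr 1
  refine integral_congr_ae ?_
  filter_upwards [coeFn_restrictCellEquiv u] with z hz
  rw [hz]

theorem fourierL2_symm_single [DecidableEq Dirac] (p : ℂ) (j : Dirac) :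
    (fourierL2 p).symm (lp.single 2 j 1) = waveL2 p j := by
  change (restrictCellEquiv p).symm ((waveBasis p).repr.symm (lp.single 2 j 1)) = _
  rw [HilbertBasis.repr_symm_single, waveBasis_apply]
  exact (restrictCellEquiv p).symm_apply_apply _

/-! ### Weak derivatives in Fourier variables -/

theorem enorm_eq_eLpNorm {p : ℂ} (u : L2 p) : ‖u‖ₑ = eLpNorm u.1 2 (volume.restrict cell) := by
  rw [← ofReal_norm, norm_def, ENNReal.ofReal_toReal u.2.1.memLp_cell.2.ne]

theorem exists_lintegral_enorm_le {S : Set ℂ} (hS : Bornology.IsBounded S) :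
    ∃ C : NNReal, ∀ (p : ℂ) (u : L2 p), ∫⁻ z in S, ‖u.1 z‖ₑ ≤ C * ‖u‖ₑ := by
  obtain ⟨N, hN⟩ := exists_lintegral_le_mul_lintegral_cell hS
  have hfinite : volume.restrict cell Set.univ ^
      (1 / (1 : ENNReal).toReal - 1 / (2 : ENNReal).toReal) ≠ ⊤ :=
    ENNReal.rpow_ne_top_of_nonneg (by norm_num) (measure_ne_top _ _)
  lift (volume.restrict cell Set.univ ^
    (1 / (1 : ENNReal).toReal - 1 / (2 : ENNReal).toReal)) to NNReal using hfinite with M hM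
  refine ⟨M * N, fun p u => ?_⟩
  calc ∫⁻ z in S, ‖u.1 z‖ₑ ≤ N * ∫⁻ z in cell, ‖u.1 z‖ₑ :=
        hN _ fun γ hγ => u.2.2.enorm_add_ae_eq hγ
    _ ≤ N * (‖u‖ₑ * M) := by
        rw [← eLpNorm_one_eq_lintegral_enorm, enorm_eq_eLpNorm, hM]
        gcongr
        exact eLpNorm_le_eLpNorm_mul_rpow_measure_univ (by norm_num) u.2.1.memLp_cell.1
    _ = (M * N : NNReal) * ‖u‖ₑ := by
        push_cast
        ring

section TestFunction

variable {φ : ℂ → ℝ}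

theorem exists_norm_integral_smul_le (hφ : Continuous φ) (hsupp : HasCompactSupport φ) :
    ∃ C : ℝ, ∀ (p : ℂ) (u : L2 p), ‖∫ z, φ z • u.1 z‖ ≤ C * ‖u‖ := by
  obtain ⟨M, hM⟩ := hφ.bounded_above_of_compact_support hsupp
  have hM' (z : ℂ) : ‖φ z‖ₑ ≤ M.toNNReal := by
    rw [← ofReal_norm]
    exact ENNReal.ofReal_le_ofReal (hM z)
  obtain ⟨C, hC⟩ := exists_lintegral_enorm_le hsupp.isCompact.isBounded
  refine ⟨(M.toNNReal * C : NNReal), fun p u => ?_⟩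
  have henorm : ‖∫ z, φ z • u.1 z‖ₑ ≤ (M.toNNReal * C : NNReal) * ‖u‖ₑ := by
    have hsubset : ∫ z, φ z • u.1 z = ∫ z in tsupport φ, φ z • u.1 z :=
      (setIntegral_eq_integral_of_forall_compl_eq_zero fun z hz => by
        rw [image_eq_zero_of_notMem_tsupport hz, zero_smul]).symm
    rw [hsubset, ENNReal.coe_mul, mul_assoc]
    calc ‖∫ z in tsupport φ, φ z • u.1 z‖ₑ ≤ ∫⁻ z in tsupport φ, ‖φ z • u.1 z‖ₑ :=
          enorm_integral_le_lintegral_enorm _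
      _ ≤ ∫⁻ z in tsupport φ, M.toNNReal * ‖u.1 z‖ₑ :=
          lintegral_mono fun z => (enorm_smul _ _).trans_le (by gcongr; exact hM' z)
      _ = M.toNNReal * ∫⁻ z in tsupport φ, ‖u.1 z‖ₑ :=
          lintegral_const_mul' _ _ ENNReal.coe_ne_top
      _ ≤ M.toNNReal * (C * ‖u‖ₑ) := by
          gcongr
          exact hC p u
  rw [enorm_eq_nnnorm, enorm_eq_nnnorm] at henorm
  exact_mod_cast henorm

/-- The pairing `u ↦ ∫ φ u` with a test function. -/
def testOp (p : ℂ) (hφ : Continuous φ) (hsupp : HasCompactSupport φ) : L2 p →L[ℂ] C2 :=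
  LinearMap.mkContinuousOfExistsBound
    { toFun := fun u => ∫ z, φ z • u.1 z
      map_add' := fun u v => by
        rw [← integral_add (integrable_test hφ hsupp u.2.1) (integrable_test hφ hsupp v.2.1)]
        refine integral_congr_ae ?_
        filter_upwards [AEEqFun.coeFn_add u.1 v.1] with z hz
        rw [Submodule.coe_add, hz, Pi.add_apply, smul_add]
      map_smul' := fun c u => by
        rw [RingHom.id_apply, ← integral_smul]
        refine integral_congr_ae ?_
        filter_upwards [AEEqFun.coeFn_smul c u.1] with z hz
        rw [Submodule.coe_smul, hz, Pi.smul_apply, smul_comm] }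
    ((exists_norm_integral_smul_le hφ hsupp).imp fun _ hC => hC p)

theorem testOp_apply {p : ℂ} (hφ : Continuous φ) (hsupp : HasCompactSupport φ) (u : L2 p) :
    testOp p hφ hsupp u = ∫ z, φ z • u.1 z := rfl

/-- The pairing of a test function with a normalized plane wave. -/
def testCoeff (p : ℂ) (φ : ℂ → ℝ) (j : Dirac) : ℂ :=
  ((√cellArea)⁻¹ : ℝ) * ∫ z, φ z • character (j.1 + p) z

theorem integral_smul_wave (p : ℂ) (φ : ℂ → ℝ) (j : Dirac) :
    ∫ z, φ z • wave p j z = testCoeff p φ j • EuclideanSpace.single j.comp 1 := by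
  rw [testCoeff, ← integral_const_mul, ← integral_smul_const]
  congr 1 with z
  rw [wave, ← smul_assoc, mul_smul_comm]

theorem testOp_waveL2 (p : ℂ) (hφ : Continuous φ) (hsupp : HasCompactSupport φ) (j : Dirac) :
    testOp p hφ hsupp (waveL2 p j) = testCoeff p φ j • EuclideanSpace.single j.comp 1 := by
  rw [testOp_apply, ← integral_smul_wave]
  refine integral_congr_ae ?_
  filter_upwards [coeFn_waveL2 p j] with z hz
  rw [hz]

theorem hasSum_integral_smul {p : ℂ} (hφ : Continuous φ) (hsupp : HasCompactSupport φ)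
    (u : L2 p) :
    HasSum (fun j : Dirac => (fourierL2 p u j * testCoeff p φ j) •
      (EuclideanSpace.single j.comp 1 : C2)) (∫ z, φ z • u.1 z) := by
  classical
  have hsum : HasSum (fun j => fourierL2 p u j • waveL2 p j) u := by
    have hsingle := (lp.hasSum_single (by simp) (fourierL2 p u)).mapL
      (fourierL2 p).symm.toContinuousLinearEquiv.toContinuousLinearMap
    have hinv : (fourierL2 p).symm (fourierL2 p u) = u := (fourierL2 p).symm_apply_apply u
    rw [← hinv]
    refine hsingle.congr_fun fun j => ?_
    change _ = (fourierL2 p).symm (lp.single 2 j (fourierL2 p u j))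
    rw [← fourierL2_symm_single, ← map_smul, ← lp.single_smul, hinv, smul_eq_mul, mul_one]
  refine (hsum.mapL (testOp p hφ hsupp)).congr_fun fun j => ?_
  rw [map_smul, testOp_waveL2, smul_smul]

theorem fderiv_wave (p : ℂ) (j : Dirac) (z v : ℂ) :
    fderiv ℝ (wave p j) z v = (I * pairing (j.1 + p) v) • wave p j z := by
  have hline : HasLineDerivAt ℝ (wave p j) (fderiv ℝ (wave p j) z v) z v :=
    ((contDiff_wave p j).differentiable (by simp) z).hasFDerivAt.hasLineDerivAt v
  have hphase : HasDerivAt (fun t : ℝ => exp (I * pairing (j.1 + p) v * t))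
      (I * pairing (j.1 + p) v) 0 := by
    simpa using ((hasDerivAt_id (0 : ℝ)).ofReal_comp.const_mul
      (I * (pairing (j.1 + p) v : ℂ))).cexp
  refine hline.unique ((hphase.smul_const (wave p j z)).congr_of_eventuallyEq
    (.of_forall fun t => ?_))
  have hpairing : pairing (j.1 + p) (t • v) = pairing (j.1 + p) v * t := by
    simp [pairing]
    ring
  change wave p j (z + t • v) = _
  rw [wave_add, character, hpairing, ofReal_mul, ← mul_assoc]

theorem testCoeff_fderiv (p : ℂ) (hφ : ContDiff ℝ ∞ φ) (hsupp : HasCompactSupport φ)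
    (v : ℂ) (j : Dirac) : testCoeff p (fun z => fderiv ℝ φ z v) j =
      -(I * pairing (j.1 + p) v) * testCoeff p φ j := by
  have hloc : LocL2 (wave p j) := .of_continuous (contDiff_wave p j).continuous
  have hparts := integral_smul_fderiv_eq_neg_fderiv_smul_of_integrable (μ := volume) (f := φ)
    (g := wave p j) (v := v) (integrable_test_fderiv hφ hsupp v hloc) (by
      simp only [fderiv_wave]
      exact integrable_test hφ.continuous hsupp (hloc.const_smul _))
    (integrable_test hφ.continuous hsupp hloc) (fun z _ => hφ.differentiable (by simp) z)
    (fun z _ => (contDiff_wave p j).differentiable (by simp) z)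
  simp only [fderiv_wave, smul_comm (φ _) (I * (pairing (j.1 + p) v : ℂ))] at hparts
  rw [integral_smul, integral_smul_wave, integral_smul_wave, smul_smul, ← neg_smul] at hparts
  have hcoeff := congrArg (fun x : C2 => x j.comp) hparts
  simp only [PiLp.smul_apply, PiLp.single_apply, if_true, smul_eq_mul, mul_one] at hcoeff
  linear_combination hcoeff

theorem testCoeff_comp_sub_right (p : ℂ) (φ : ℂ → ℝ) (w : ℂ) (j : Dirac) :
    testCoeff p (fun z => φ (z - w)) j = character (j.1 + p) w * testCoeff p φ j := by
  rw [testCoeff, testCoeff, mul_left_comm, ← integral_const_mul (character (j.1 + p) w),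
    ← integral_add_right_eq_self (fun z => φ (z - w) • character (j.1 + p) z) w]
  congr 2 with z
  rw [add_sub_cancel_right, character_add_right, mul_smul_comm, mul_comm (character _ z)]

end TestFunction

theorem wave_ne_zero (p : ℂ) (j : Dirac) (z : ℂ) : wave p j z ≠ 0 := by
  simp [wave, Real.sqrt_ne_zero'.mpr cellArea_pos, character_ne_zero]

theorem exists_testCoeff_ne_zero (p : ℂ) (j : Dirac) :
    ∃ φ : ℂ → ℝ, ContDiff ℝ ∞ φ ∧ HasCompactSupport φ ∧ testCoeff p φ j ≠ 0 := by
  by_contra! h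
  have hzero := ae_eq_zero_of_integral_contDiff_smul_eq_zero (μ := volume) (f := wave p j)
    (LocL2.of_continuous (contDiff_wave p j).continuous).locallyIntegrable fun φ hφ hsupp => by
      rw [integral_smul_wave, h φ hφ hsupp, zero_smul]
  obtain ⟨z, hz⟩ := hzero.exists
  exact wave_ne_zero p j z hz

theorem eq_zero_of_hasSum_character_mul {ι : Type*} [Countable ι] {q : ι → ℂ}
    (hinj : Function.Injective q) (hq : ∀ i, q i ∈ dualLattice) {c : ι → ℂ}
    (h : ∀ w, HasSum (fun i => character (q i) w * c i) 0) (i₀ : ι) : c i₀ = 0 := by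
  classical
  let F (i : ι) (w : ℂ) : ℂ := character (q i - q i₀) w * c i
  have hFsum (w : ℂ) : HasSum (fun i => F i w) 0 := by
    have hmul := (h w).mul_left (character (-q i₀) w)
    rw [mul_zero] at hmul
    refine hmul.congr_fun fun i => ?_
    rw [← mul_assoc, ← character_add_left, neg_add_eq_sub]
  have hFnorm (i : ι) (w : ℂ) : ‖F i w‖ = ‖c i‖ := by rw [norm_mul, norm_character, one_mul]
  have hFint (i : ι) : ∫ w in cell, F i w = if i = i₀ then cellArea * c i₀ else 0 := by
    rw [integral_mul_const, setIntegral_cell_character (sub_mem_dualLattice (hq i) (hq i₀))]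
    by_cases hi : i = i₀
    · rw [if_pos (sub_eq_zero.mpr (congrArg q hi)), if_pos hi, hi]
    · rw [if_neg fun hq₀ => hi (hinj (sub_eq_zero.mp hq₀)), if_neg hi, zero_mul]
  have hint := hasSum_integral_of_summable_integral_norm (μ := volume.restrict cell) (F := F)
    (fun i => .of_bound (((continuous_character _).mul continuous_const).aestronglyMeasurable)
      ‖c i‖ (.of_forall fun w => (hFnorm i w).le)) (by
      simp only [hFnorm, integral_const]
      exact ((hFsum 0).summable.norm.congr fun i => hFnorm i 0).mul_left _)
  simp only [(hFsum _).tsum_eq, integral_zero, hFint] at hint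
  exact (mul_eq_zero.mp ((hasSum_ite_eq i₀ _).unique hint)).resolve_left
    (ofReal_ne_zero.mpr cellArea_pos.ne')

instance : Countable Dirac := by
  refine Set.countable_univ_iff.mp ((Set.countable_iUnion fun n : ℕ =>
    (Dirac.finite_norm_le n).countable).mono fun j _ => ?_)
  exact Set.mem_iUnion.mpr (exists_nat_ge ‖j.1‖)

theorem eq_zero_of_hasSum_character_mul_smul_single {c : Dirac → ℂ}
    (h : ∀ w, HasSum (fun j : Dirac => (character j.1 w * c j) •
      (EuclideanSpace.single j.comp 1 : C2)) 0) (j₀ : Dirac) : c j₀ = 0 := by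
  refine eq_zero_of_hasSum_character_mul (ι := {j : Dirac // j.comp = j₀.comp})
    (q := fun j => j.1.1 - j₀.1) (c := fun j => c j)
    (fun i j hij => Subtype.ext (Subtype.ext (sub_left_injective hij)))
    (fun j => Dirac.sub_mem_of_comp_eq j.2) (fun w => ?_) ⟨j₀, rfl⟩
  have hcomp := ((h w).mapL (EuclideanSpace.proj (𝕜 := ℂ) j₀.comp)).mul_left (character (-j₀.1) w)
  rw [map_zero, mul_zero, ← hasSum_subtype_iff_of_support_subset
    (s := {j : Dirac | j.comp = j₀.comp})] at hcomp
  · refine hcomp.congr_fun fun j => ?_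
    have hj : j.1.comp = j₀.comp := j.2
    simp [sub_eq_neg_add, character_add_left, mul_assoc, hj]
  · refine Function.support_subset_iff'.mpr fun j hj => ?_
    simp [Ne.symm hj]

section WeakDerivative

variable {p v : ℂ} {u g : L2 p}

theorem hasSum_integral_fderiv_smul_add {φ : ℂ → ℝ} (hφ : ContDiff ℝ ∞ φ)
    (hsupp : HasCompactSupport φ) (v : ℂ) (u g : L2 p) :
    HasSum (fun j : Dirac => ((fourierL2 p g j - I * pairing (j.1 + p) v * fourierL2 p u j) *
      testCoeff p φ j) • (EuclideanSpace.single j.comp 1 : C2))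
      ((∫ z, fderiv ℝ φ z v • u.1 z) + ∫ z, φ z • g.1 z) := by
  have hderiv := hasSum_integral_smul
    ((hφ.continuous_fderiv (by simp)).clm_apply continuous_const) (hsupp.fderiv_apply (𝕜 := ℝ) v) u
  refine (hderiv.add (hasSum_integral_smul hφ.continuous hsupp g)).congr_fun fun j => ?_
  rw [testCoeff_fderiv p hφ hsupp, ← add_smul]
  congr 1
  ring

theorem fourierL2_of_hasWeakDeriv (h : HasWeakDeriv v u.1 g.1) (j : Dirac) :
    fourierL2 p g j = I * pairing (j.1 + p) v * fourierL2 p u j := by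
  obtain ⟨φ, hφ, hsupp, hne⟩ := exists_testCoeff_ne_zero p j
  -- Testing against all the translates of `φ` separates the frequencies.
  have hzero := eq_zero_of_hasSum_character_mul_smul_single (c := fun j =>
    (fourierL2 p g j - I * pairing (j.1 + p) v * fourierL2 p u j) * testCoeff p φ j)
    (fun w => by
      have hφw : ContDiff ℝ ∞ fun z => φ (z - w) := hφ.comp (contDiff_id.sub contDiff_const)
      have hsuppw : HasCompactSupport fun z => φ (z - w) :=
        hsupp.comp_homeomorph (Homeomorph.subRight w)
      have hsum := (hasSum_integral_fderiv_smul_add hφw hsuppw v u g).const_smul (character (-p) w)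
      rw [h _ hφw hsuppw, neg_add_cancel, smul_zero] at hsum
      refine hsum.congr_fun fun i => ?_
      rw [testCoeff_comp_sub_right, smul_smul, character_add_left, character_neg_left]
      congr 1
      field_simp [character_ne_zero p w]) j
  exact sub_eq_zero.mp ((mul_eq_zero.mp hzero).resolve_right hne)

theorem hasWeakDeriv_of_fourierL2
    (h : ∀ j : Dirac, fourierL2 p g j = I * pairing (j.1 + p) v * fourierL2 p u j) :
    HasWeakDeriv v u.1 g.1 := by
  intro φ hφ hsupp
  have hsum := hasSum_integral_fderiv_smul_add hφ hsupp v u g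
  simp only [h, sub_self, zero_mul, zero_smul] at hsum
  exact eq_neg_of_add_eq_zero_left (hsum.unique hasSum_zero)

end WeakDerivative

theorem fourierL2_weakDeriv {p : ℂ} (v : ℂ) (u : H1 p) (j : Dirac) :
    fourierL2 p (weakDeriv p v u) j = I * pairing (j.1 + p) v * fourierL2 p u.1 j :=
  fourierL2_of_hasWeakDeriv (hasWeakDeriv_weakDeriv v u) j

theorem fourierL2_dbarMap {p : ℂ} (u : H1 p) (j : Dirac) :
    fourierL2 p (dbarMap p u) j = (j.1 + p) * fourierL2 p u.1 j := by
  change fourierL2 p ((-I) • (weakDeriv p 1 u + I • weakDeriv p I u)) j = _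
  simp only [map_smul, map_add]
  change (-I) * (fourierL2 p (weakDeriv p 1 u) j + I * fourierL2 p (weakDeriv p I u) j) = _
  rw [fourierL2_weakDeriv, fourierL2_weakDeriv]
  have hsymbol : ((pairing (j.1 + p) 1 : ℝ) : ℂ) + I * (pairing (j.1 + p) I : ℝ) = j.1 + p := by
    apply Complex.ext <;> simp [pairing]
  linear_combination (fourierL2 p u.1 j) * hsymbol - (fourierL2 p u.1 j) *
    (((pairing (j.1 + p) 1 : ℝ) : ℂ) + I * (pairing (j.1 + p) I : ℝ)) * I_sq

theorem fourierL2_dMap {p : ℂ} (u : H1 p) (j : Dirac) :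
    fourierL2 p (dMap p u) j = conj (j.1 + p) * fourierL2 p u.1 j := by
  change fourierL2 p ((-I) • (weakDeriv p 1 u - I • weakDeriv p I u)) j = _
  simp only [map_smul, map_sub]
  change (-I) * (fourierL2 p (weakDeriv p 1 u) j - I * fourierL2 p (weakDeriv p I u) j) = _
  rw [fourierL2_weakDeriv, fourierL2_weakDeriv]
  have hsymbol : ((pairing (j.1 + p) 1 : ℝ) : ℂ) - I * (pairing (j.1 + p) I : ℝ) =
      conj (j.1 + p) := by
    apply Complex.ext <;> simp [pairing, add_comm]
  linear_combination (fourierL2 p u.1 j) * hsymbol - (fourierL2 p u.1 j) *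
    (((pairing (j.1 + p) 1 : ℝ) : ℂ) - I * (pairing (j.1 + p) I : ℝ)) * I_sq

theorem abs_pairing_le (z w : ℂ) : |pairing z w| ≤ ‖z‖ * ‖w‖ :=
  (abs_re_le_norm _).trans_eq (by rw [norm_mul, norm_conj])

theorem mem_H1_of_norm_mul_le {p : ℂ} {u : L2 p} (y : DiracSeq)
    (h : ∀ j : Dirac, ‖j.1 + p‖ * ‖fourierL2 p u j‖ ≤ ‖y j‖) : u ∈ H1 p := by
  intro v
  have hmem : Memℓp (fun j : Dirac => I * pairing (j.1 + p) v * fourierL2 p u j) 2 := by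
    refine memlp_two_iff.mpr (((summable_norm_sq y).mul_left (‖v‖ ^ 2)).of_nonneg_of_le
      (fun _ => by positivity) fun j => ?_)
    rw [← mul_pow]
    gcongr
    calc ‖I * pairing (j.1 + p) v * fourierL2 p u j‖
        = |pairing (j.1 + p) v| * ‖fourierL2 p u j‖ := by simp
      _ ≤ ‖j.1 + p‖ * ‖v‖ * ‖fourierL2 p u j‖ := by
          gcongr
          exact abs_pairing_le _ _
      _ = ‖v‖ * (‖j.1 + p‖ * ‖fourierL2 p u j‖) := by ring
      _ ≤ ‖v‖ * ‖y j‖ := by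
          gcongr
          exact h j
  let g : L2 p := (fourierL2 p).symm ⟨_, hmem⟩
  refine ⟨g.1, g.2.1, hasWeakDeriv_of_fourierL2 fun j => ?_⟩
  change fourierL2 p ((fourierL2 p).symm _) j = _
  rw [LinearIsometryEquiv.apply_symm_apply]

/-! ### Potentials in Fourier variables -/

theorem act_single_apply (M : Matrix (Fin 2) (Fin 2) ℂ) (i k : Fin 2) :
    act M (EuclideanSpace.single i 1) k = M k i := by
  simp

/-- The Fourier coefficient of `M` that couples the plane wave `j` to the plane wave `i`. -/
def matCoeff (M : ℂ → Matrix (Fin 2) (Fin 2) ℂ) (i j : Dirac) : ℂ :=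
  ((√cellArea)⁻¹ : ℝ) * ((√cellArea)⁻¹ : ℝ) *
    ∫ z in cell, character (j.1 - i.1) z * M z i.comp j.comp

section Multiplication

variable {M : ℂ → Matrix (Fin 2) (Fin 2) ℂ} (hM : Continuous M)
  (hMγ : ∀ γ ∈ lattice, ∀ z, twist γ * M (z + γ) = M z * twist γ)

theorem coeFn_mulOp {p : ℂ} (u : L2 p) :
    (mulOp p M hM hMγ u).1 =ᵐ[volume] fun z => act (M z) (u.1 z) :=
  L2.coeFn_mk _ (u.2.1.act hM) (u.2.2.act hMγ)

theorem fourierL2_mulOp_waveL2 (p : ℂ) (i j : Dirac) :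
    fourierL2 p (mulOp p M hM hMγ (waveL2 p j)) i = matCoeff M i j := by
  rw [fourierL2_apply, matCoeff, mul_assoc, ← integral_const_mul (((√cellArea)⁻¹ : ℝ) : ℂ)
    (fun z => character (j.1 - i.1) z * M z i.comp j.comp)]
  congr 1
  refine integral_congr_ae (ae_restrict_of_ae ?_)
  filter_upwards [coeFn_mulOp hM hMγ (waveL2 p j), coeFn_waveL2 p j] with z hmul hwave
  have hcharacter : character (j.1 - i.1) z =
      character (-(i.1 + p)) z * character (j.1 + p) z := by
    rw [← character_add_left]
    congr 1
    ring
  rw [hmul, hwave, wave, map_smul, PiLp.smul_apply, act_single_apply, smul_eq_mul, hcharacter]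
  ring

/-- A multiplication operator in Fourier variables. It is defined through `L²_0`, but represents
multiplication on every `L²_p`, see `fourierL2_mulOp`. -/
def modelOp : DiracSeq →L[ℂ] DiracSeq :=
  ((fourierL2 0).toContinuousLinearEquiv.toContinuousLinearMap.comp (mulOp 0 M hM hMγ)).comp
    (fourierL2 0).symm.toContinuousLinearEquiv.toContinuousLinearMap

theorem entry_modelOp [DecidableEq Dirac] (i j : Dirac) :
    entry (modelOp hM hMγ) i j = matCoeff M i j := by
  change fourierL2 0 (mulOp 0 M hM hMγ ((fourierL2 0).symm (lp.single 2 j 1))) i = _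
  rw [fourierL2_symm_single, fourierL2_mulOp_waveL2]

theorem fourierL2_mulOp (p : ℂ) (u : L2 p) :
    fourierL2 p (mulOp p M hM hMγ u) = modelOp hM hMγ (fourierL2 p u) := by
  classical
  have hmodel : ((fourierL2 p).toContinuousLinearEquiv.toContinuousLinearMap.comp
      (mulOp p M hM hMγ)).comp
      (fourierL2 p).symm.toContinuousLinearEquiv.toContinuousLinearMap = modelOp hM hMγ := by
    refine ext_entry fun i j => ?_
    rw [entry_modelOp, ← fourierL2_mulOp_waveL2 hM hMγ p, ← fourierL2_symm_single]
    rfl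
  rw [← hmodel]
  change _ = fourierL2 p (mulOp p M hM hMγ ((fourierL2 p).symm (fourierL2 p u)))
  rw [LinearIsometryEquiv.symm_apply_apply]

end Multiplication

theorem character_mul_apply_add {M : ℂ → Matrix (Fin 2) (Fin 2) ℂ}
    (hMγ : ∀ γ ∈ lattice, ∀ z, twist γ * M (z + γ) = M z * twist γ) (i j : Dirac) {γ : ℂ}
    (hγ : γ ∈ lattice) (z : ℂ) :
    character (j.1 - i.1) (z + γ) * M (z + γ) i.comp j.comp =
      character (j.1 - i.1) z * M z i.comp j.comp := by
  have htwist (k : Dirac) : ![character γ K, (character γ K)⁻¹] k.comp = (character k.1 γ)⁻¹ := by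
    simpa [act_twist_apply] using congrArg (fun x : C2 => x k.comp) (act_twist_single k hγ)
  have hentry := congrFun (congrFun (hMγ γ hγ z) i.comp) j.comp
  rw [twist_eq_diagonal, Matrix.diagonal_mul, Matrix.mul_diagonal, htwist, htwist] at hentry
  have hi := character_ne_zero i.1 γ
  have hj := character_ne_zero j.1 γ
  rw [character_add_right, sub_eq_add_neg, character_add_left j.1 _ γ, character_neg_left]
  field_simp at hentry ⊢
  linear_combination character (j.1 - i.1) z * hentry

theorem Dirac.comp_rotPerm (j₀ j : Dirac) : (rotPerm j₀ j).comp = j.comp :=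
  comp_eq_of_add (omega_sub_one_mul_sub_mem j₀ j) (coe_rotPerm j₀ j)

theorem Dirac.comp_shiftPerm (q : ℂ) (hq : q ∈ dualLattice) (j : Dirac) :
    (shiftPerm q hq j).comp = j.comp :=
  comp_eq_of_add hq (coe_shiftPerm q hq j)

theorem character_omega_mul (q z : ℂ) : character (omega * q) (omega * z) = character q z := by
  have homega : omega * conj omega = 1 := by
    rw [mul_conj, normSq_eq_norm_sq, norm_omega]
    simp
  have hmul : omega * q * conj (omega * z) = q * conj z := by
    rw [map_mul]
    linear_combination q * conj z * homega
  rw [character, character, pairing, pairing, hmul]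

theorem matCoeff_conjTranspose (M : ℂ → Matrix (Fin 2) (Fin 2) ℂ) (i j : Dirac) :
    matCoeff (fun z => (M z).conjTranspose) i j = conj (matCoeff M j i) := by
  rw [matCoeff, matCoeff, map_mul, map_mul, conj_ofReal, ← integral_conj]
  congr 2 with z
  rw [map_mul, conj_character, neg_sub, Matrix.conjTranspose_apply]
  rfl

theorem matCoeff_shiftPerm (M : ℂ → Matrix (Fin 2) (Fin 2) ℂ) (q : ℂ) (hq : q ∈ dualLattice)
    (i j : Dirac) :
    matCoeff M (Dirac.shiftPerm q hq i) (Dirac.shiftPerm q hq j) = matCoeff M i j := by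
  simp only [matCoeff, Dirac.comp_shiftPerm, Dirac.coe_shiftPerm, add_sub_add_right_eq_sub]

namespace Potential

variable (V : Potential)

/-- Multiplication by `V` in Fourier variables. -/
def model : DiracSeq →L[ℂ] DiracSeq := modelOp V.continuous_mat V.mat_translate

theorem entry_model [DecidableEq Dirac] (i j : Dirac) : entry V.model i j = matCoeff V.mat i j :=
  entry_modelOp V.continuous_mat V.mat_translate i j

theorem fourierL2_mul (p : ℂ) (u : L2 p) : fourierL2 p (V.mul p u) = V.model (fourierL2 p u) :=
  fourierL2_mulOp V.continuous_mat V.mat_translate p u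

theorem modelOp_conjTranspose :
    modelOp V.continuous_mat.matrix_conjTranspose V.mat_conjTranspose_translate =
      ContinuousLinearMap.adjoint V.model := by
  classical
  refine ext_entry fun i j => ?_
  rw [entry_modelOp, matCoeff_conjTranspose, entry_adjoint, entry_model]

theorem fourierL2_mulStar (p : ℂ) (u : L2 p) :
    fourierL2 p (V.mulStar p u) = ContinuousLinearMap.adjoint V.model (fourierL2 p u) := by
  rw [← V.modelOp_conjTranspose]
  exact fourierL2_mulOp V.continuous_mat.matrix_conjTranspose V.mat_conjTranspose_translate p u

theorem mat_omega_mul (z : ℂ) : V.mat (omega * z) = omega • V.mat z := by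
  ext i j
  fin_cases i <;> fin_cases j <;> simp [mat, V.rot_plus, V.rot_minus]

theorem mat_apply_self (z : ℂ) (i : Fin 2) : V.mat z i i = 0 := by
  fin_cases i <;> rfl

theorem matCoeff_rotPerm (j₀ i j : Dirac) :
    matCoeff V.mat (Dirac.rotPerm j₀ i) (Dirac.rotPerm j₀ j) = omega * matCoeff V.mat i j := by
  have hrot := setIntegral_cell_omega_mul
    (F := fun z => character ((Dirac.rotPerm j₀ j).1 - (Dirac.rotPerm j₀ i).1) z *
      V.mat z (Dirac.rotPerm j₀ i).comp (Dirac.rotPerm j₀ j).comp)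
    fun γ hγ z => character_mul_apply_add V.mat_translate _ _ hγ z
  rw [matCoeff, matCoeff, ← hrot, mul_left_comm omega, ← integral_const_mul omega]
  congr 2 with z
  have hsub : (Dirac.rotPerm j₀ j).1 - (Dirac.rotPerm j₀ i).1 = omega * (j.1 - i.1) := by
    rw [Dirac.coe_rotPerm, Dirac.coe_rotPerm]
    ring
  rw [hsub, character_omega_mul, V.mat_omega_mul, Matrix.smul_apply, smul_eq_mul,
    Dirac.comp_rotPerm, Dirac.comp_rotPerm, mul_left_comm]

theorem matCoeff_eq_zero {i j : Dirac} (h : i.comp = j.comp) : matCoeff V.mat i j = 0 := by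
  simp [matCoeff, h, V.mat_apply_self]

theorem matCoeff_negPerm (i j : Dirac) :
    matCoeff V.mat (Dirac.negPerm i) (Dirac.negPerm j) = matCoeff V.mat j i := by
  by_cases h : i.comp = j.comp
  · rw [V.matCoeff_eq_zero h.symm, V.matCoeff_eq_zero
      (by rw [Dirac.comp_negPerm, Dirac.comp_negPerm, h])]
  · have hflip : ∀ a b : Fin 2, a ≠ b → 1 - a = b := by decide
    simp only [matCoeff, Dirac.comp_negPerm, Dirac.coe_negPerm, neg_sub_neg, hflip _ _ h,
      hflip _ _ (Ne.symm h)]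

theorem isPotentialMatrix_model : IsPotentialMatrix V.model where
  shift q hq i j := by rw [entry_model, entry_model, matCoeff_shiftPerm]
  rot j₀ i j := by rw [entry_model, entry_model, matCoeff_rotPerm]
  neg i j := by rw [entry_model, entry_model, matCoeff_negPerm]
  off_diag i j h := by rw [entry_model, V.matCoeff_eq_zero h]

end Potential

/-! ### Eigenvalues, resolvents and singular values -/

section PencilResolvent

variable {E : Type*} [NormedAddCommGroup E] [NormedSpace ℂ E] {S V : E →L[ℂ] E} {a k : ℂ}

theorem pencilResolvent_apply_eq_iff (h : IsUnit (pencil S V a k)) {f x : E} :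
    pencilResolvent S V a k f = x ↔ pencil S V a k x = S f := by
  refine ⟨fun hx => hx ▸ pencil_pencilResolvent_apply h f, fun hx => ?_⟩
  change Ring.inverse (pencil S V a k) (S f) = x
  rw [← hx]
  exact congrArg (· x) (Ring.inverse_mul_cancel _ h)

theorem pencilResolvent_ne_zero (h : IsUnit (pencil S V a k)) (hS : S ≠ 0) :
    pencilResolvent S V a k ≠ 0 := by
  intro h0
  rw [← pencil_pencilResolvent h, h0, mul_zero] at hS
  exact hS rfl

theorem pencilResolvent_apply_eq_smul_iff (h : IsUnit (pencil S V a k)) {z : ℂ} (hz : z ≠ 0)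
    {x : E} : pencilResolvent S V a k (V x) = z • x ↔ pencil S V (a - z⁻¹) k x = 0 := by
  have hsub : pencil S V a k (z • x) - S (V x) = z • pencil S V (a - z⁻¹) k x := by
    simp only [pencil_apply, map_sub, map_smul, sub_smul, smul_sub, smul_add, smul_smul,
      mul_inv_cancel₀ hz, one_smul, mul_comm z]
    abel
  rw [pencilResolvent_apply_eq_iff h, ← sub_eq_zero, hsub, smul_eq_zero_iff_right hz]

end PencilResolvent

section AdjointPencil

open ContinuousLinearMap

variable {E : Type*} [NormedAddCommGroup E] [InnerProductSpace ℂ E] [CompleteSpace E]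
  {S V : E →L[ℂ] E} {a k : ℂ}

theorem star_pencil : star (pencil S V a k) = 1 + (conj a • star V - conj k • 1) * star S := by
  simp [pencil]

theorem isUnit_pencil_adjoint (h : IsUnit (pencil S V a k)) :
    IsUnit (pencil (adjoint S) (adjoint V) (conj a) (conj k)) := by
  have hcomm := spectrum.unit_mem_mul_comm (R := ℂ) (r := 1) (a := star S)
    (b := -(conj a • star V - conj k • 1))
  rw [spectrum.mem_iff, spectrum.mem_iff, not_iff_not] at hcomm
  simp only [Units.val_one, map_one, mul_neg, neg_mul, sub_neg_eq_add] at hcomm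
  exact hcomm.mpr (star_pencil (S := S) ▸ h.star)

theorem adjoint_pencilResolvent (h : IsUnit (pencil S V a k)) :
    adjoint (pencilResolvent S V a k) =
      pencilResolvent (adjoint S) (adjoint V) (conj a) (conj k) := by
  have hswap : pencil (star S) (star V) (conj a) (conj k) * star S =
      star S * star (pencil S V a k) := by
    rw [star_pencil, pencil]
    noncomm_ring
  ext f
  refine ((pencilResolvent_apply_eq_iff (isUnit_pencil_adjoint h)).mpr ?_).symm
  have hmul : pencil (star S) (star V) (conj a) (conj k) * star (pencilResolvent S V a k) =
      star S := by
    rw [pencilResolvent, star_mul, ← mul_assoc, hswap, mul_assoc, ← Ring.inverse_star,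
      Ring.mul_inverse_cancel _ h.star, mul_one]
  exact congrArg (· f) hmul

end AdjointPencil

namespace SkewPencil

variable {E : Type*} [NormedAddCommGroup E] [NormedSpace ℂ E] {S V : E →L[ℂ] E} {D : Set ℂ}
  {B : E →L[ℂ] E →L[ℂ] ℂ} {a c : ℂ}

theorem exists_pairing_ne_zero (h : SkewPencil S V D B) (hd : ¬ Degenerate S V D B a c)
    (hc : c ∈ D) :
    ∃ y, pencil S V a (-c) y = 0 ∧ ∀ x ≠ 0, pencil S V a c x = 0 → B x y ≠ 0 := by
  obtain ⟨y, hy0, hy⟩ := h.eigenvalue (-c) (h.neg_mem c hc) a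
  exact ⟨y, hy, fun x hx0 hx hxy => hd ⟨x, hx0, hx, Or.inr ⟨y, hy0, hy, hxy⟩⟩⟩

theorem mem_span_of_pencil_eq_zero (h : SkewPencil S V D B) (hd : ¬ Degenerate S V D B a c)
    (hc : c ∈ D) {u x : E} (hu0 : u ≠ 0) (hu : pencil S V a c u = 0)
    (hx : pencil S V a c x = 0) : x ∈ Submodule.span ℂ {u} := by
  obtain ⟨y, -, hpair⟩ := h.exists_pairing_ne_zero hd hc
  refine Submodule.mem_span_singleton.mpr ⟨B x y / B u y, ?_⟩
  by_contra hne
  refine hpair (x - (B x y / B u y) • u) (sub_ne_zero.mpr (Ne.symm hne))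
    (by rw [map_sub, map_smul, hu, hx, smul_zero, sub_zero]) ?_
  simp [hpair u hu0 hu]

theorem eq_zero_of_pencil_eq (h : SkewPencil S V D B) (hd : ¬ Degenerate S V D B a c)
    (hc : c ∈ D) {w f : E} (hw : pencil S V a c w = S f) (hf : pencil S V a c f = 0) : f = 0 := by
  obtain ⟨y, hy, hpair⟩ := h.exists_pairing_ne_zero hd hc
  by_contra hf0
  exact hpair f hf0 hf (by simp [h.skew a c (-c) w f y hw hy])

end SkewPencil

section UnboundedOperators

variable {E : Type*} [NormedAddCommGroup E] [NormedSpace ℂ E] {A : E →ₗ.[ℂ] E} {z : ℂ}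

theorem IsResolventAt.eq {R R' : E →L[ℂ] E} (h : IsResolventAt A z R) (h' : IsResolventAt A z R') :
    R = R' := by
  ext f
  obtain ⟨hmem, hR⟩ := h.1 f
  have hR' := h'.2 ⟨R f, hmem⟩
  rw [hR] at hR'
  exact hR'.symm

theorem IsResolventAt.resolventOf_eq {R : E →L[ℂ] E} (h : IsResolventAt A z R) :
    resolventOf A z = R := by
  have hz : z ∈ resolventSetOf A := ⟨R, h⟩
  rw [resolventOf, dif_pos hz]
  exact hz.choose_spec.eq h

theorem isSimpleEigenvalue_of_forall_mem_span {u : A.domain} (hu0 : (u : E) ≠ 0)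
    (hu : A u = z • (u : E))
    (hker : ∀ w : A.domain, A w = z • (w : E) → (w : E) ∈ Submodule.span ℂ {(u : E)})
    (hchain : ∀ w : A.domain, A w - z • (w : E) ∈ Submodule.span ℂ {(u : E)} →
      A w = z • (w : E)) : IsSimpleEigenvalue A z := by
  have hle (n : ℕ) : genKer A z n ≤ Submodule.span ℂ {(u : E)} := by
    induction n with
    | zero => exact bot_le
    | succ n ih =>
      rintro _ ⟨w, hw, rfl⟩
      exact hker w (hchain w (ih hw))
  have hmem : (u : E) ∈ genKer A z 1 := ⟨u, (sub_eq_zero.mpr hu : A u - z • (u : E) = 0), rfl⟩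
  have hsup : (⨆ n, genKer A z n) = Submodule.span ℂ {(u : E)} :=
    le_antisymm (iSup_le hle) <|
      (Submodule.span_singleton_le_iff_mem _ _).mpr (Submodule.mem_iSup_of_mem 1 hmem)
  rw [IsSimpleEigenvalue, hsup]
  exact finrank_span_singleton hu0

end UnboundedOperators

theorem zero_mem_spectrum_of_isCompactOperator {𝕜 E : Type*} [NontriviallyNormedField 𝕜]
    [CompleteSpace 𝕜] [NormedAddCommGroup E] [NormedSpace 𝕜 E] {C : E →L[𝕜] E}
    (hC : IsCompactOperator C) (hE : ¬ FiniteDimensional 𝕜 E) : (0 : 𝕜) ∈ spectrum 𝕜 C := by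
  rw [spectrum.zero_mem_iff]
  rintro ⟨e, rfl⟩
  refine hE (FiniteDimensional.of_isCompactOperator_id (𝕜 := 𝕜) ?_)
  have hid : ((e⁻¹ : (E →L[𝕜] E)ˣ).1 ∘ e.1 : E → E) = id :=
    congrArg DFunLike.coe e.inv_mul
  exact hid ▸ hC.clm_comp (e⁻¹ : (E →L[𝕜] E)ˣ).1

section SingularValue

open ContinuousLinearMap

variable {𝕜 E F : Type*} [RCLike 𝕜] [NormedAddCommGroup E] [InnerProductSpace 𝕜 E]
  [CompleteSpace E] [NormedAddCommGroup F] [InnerProductSpace 𝕜 F] [CompleteSpace F]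
  {Q : E →L[𝕜] F}

theorem exists_pos_hasEigenvalue_comp_adjoint (hQ : IsCompactOperator Q) (hQ0 : Q ≠ 0) :
    ∃ μ : ℝ, 0 < μ ∧ Module.End.HasEigenvalue (Q ∘L adjoint Q : F →ₗ[𝕜] F) (μ : 𝕜) := by
  have hpos : (Q ∘L adjoint Q).IsPositive := isPositive_self_comp_adjoint Q
  have hne : Q ∘L adjoint Q ≠ 0 := by
    intro h0
    have hnorm := norm_adjoint_comp_self (adjoint Q)
    rw [adjoint_adjoint, h0, norm_zero, eq_comm, mul_self_eq_zero, norm_eq_zero] at hnorm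
    exact hQ0 ((map_eq_zero_iff adjoint adjoint.injective).mp hnorm)
  obtain ⟨μ, hμ, hμ0⟩ : ∃ μ, Module.End.HasEigenvalue (Q ∘L adjoint Q : F →ₗ[𝕜] F) μ ∧ μ ≠ 0 := by
    contrapose! hne
    exact (eq_zero_of_forall_hasEigenvalue_eq_zero (hQ.comp_clm _) hpos.isSymmetric).mp hne
  have hreal : ((RCLike.re μ : ℝ) : 𝕜) = μ :=
    RCLike.conj_eq_iff_re.mp (hpos.isSymmetric.conj_eigenvalue_eq_self hμ)
  rw [← hreal] at hμ hμ0
  exact ⟨RCLike.re μ, (eigenvalue_nonneg_of_nonneg hμ hpos.re_inner_nonneg_right).lt_of_ne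
    fun h0 => hμ0 (by rw [← h0, RCLike.ofReal_zero]), hμ⟩

theorem exists_pos_apply_smul_eq (hQ : IsCompactOperator Q) (hQ0 : Q ≠ 0) :
    ∃ c : ℝ, 0 < c ∧ ∃ x ≠ 0, ∃ y, Q ((c : 𝕜) • y) = x ∧ adjoint Q ((c : 𝕜) • x) = y := by
  obtain ⟨μ, hμ, heig⟩ := exists_pos_hasEigenvalue_comp_adjoint hQ hQ0
  obtain ⟨x, hx⟩ := heig.exists_hasEigenvector
  refine ⟨√μ⁻¹, Real.sqrt_pos.mpr (inv_pos.mpr hμ), x, hx.2, _, ?_, rfl⟩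
  have hxμ : Q (adjoint Q x) = (μ : 𝕜) • x := hx.apply_eq_smul
  rw [map_smul, map_smul, map_smul, hxμ, smul_smul, smul_smul, ← RCLike.ofReal_mul,
    Real.mul_self_sqrt (inv_pos.mpr hμ).le, ← RCLike.ofReal_mul, inv_mul_cancel₀ hμ.ne',
    RCLike.ofReal_one, one_smul]

theorem one_le_mul_norm_of_apply_smul_eq {c : ℝ} (hc : 0 ≤ c) {x : F} {y : E}
    (hxy : (x, y) ≠ 0) (hx : Q ((c : 𝕜) • y) = x) (hy : adjoint Q ((c : 𝕜) • x) = y) :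
    1 ≤ c * ‖Q‖ := by
  have hxle : ‖x‖ ≤ c * ‖Q‖ * ‖y‖ := by
    rw [← hx]
    refine (Q.le_opNorm _).trans_eq ?_
    rw [norm_smul, RCLike.norm_ofReal, abs_of_nonneg hc]
    ring
  have hyle : ‖y‖ ≤ c * ‖Q‖ * ‖x‖ := by
    rw [← hy]
    refine ((adjoint Q).le_opNorm _).trans_eq ?_
    rw [norm_smul, RCLike.norm_ofReal, abs_of_nonneg hc, LinearIsometryEquiv.norm_map]
    ring
  have hpos : 0 < ‖x‖ + ‖y‖ := by
    refine (by positivity : 0 ≤ ‖x‖ + ‖y‖).lt_of_ne' fun h0 => hxy ?_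
    rw [add_eq_zero_iff_of_nonneg (norm_nonneg _) (norm_nonneg _), norm_eq_zero,
      norm_eq_zero] at h0
    exact Prod.ext h0.1 h0.2
  exact le_of_mul_le_mul_right (by linarith) hpos

end SingularValue

/-! ### The operators `D_V(α)` and `T_k` in Fourier variables -/

theorem diagInv_zero_ne_zero : diagInv 0 ≠ 0 := by
  classical
  obtain ⟨j, -⟩ := Dirac.exists_comp_eq 0
  intro h0
  have hj : (j.1 - 0)⁻¹ * (lp.single 2 j (1 : ℂ) : DiracSeq) j = 0 :=
    congrFun (congrArg Subtype.val (DFunLike.congr_fun h0 (lp.single 2 j 1))) j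
  rw [single_one_apply, if_pos rfl, mul_one, sub_zero] at hj
  exact inv_ne_zero j.ne_zero hj

theorem pencil_adjoint_diagInv_eq_iff {W : DiracSeq →L[ℂ] DiracSeq} {a k : ℂ} {x f : DiracSeq} :
    pencil (ContinuousLinearMap.adjoint (diagInv 0)) W a k x =
        ContinuousLinearMap.adjoint (diagInv 0) f ↔
      ∀ j, conj j.1 * x j + a * W x j - k * x j = f j := by
  rw [diagInv, adjoint_diag]
  refine (pencil_diag_eq_iff fun j => ?_).trans ?_
  · simpa using j.ne_zero
  · simp only [sub_zero, map_inv₀, inv_inv]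

namespace Potential

variable (V : Potential)

/-- `(2D_z̄)⁻¹ (D_V(α) - k)` in Fourier variables, as an operator on `ℓ²(𝒦₀)`. On `L²_p` the
frequencies are shifted by `p`, so that `D_V(α) - z` is represented by the parameter `k = z - p`. -/
def pencil (α k : ℂ) : DiracSeq →L[ℂ] DiracSeq := ChiralTBG.pencil (diagInv 0) V.model α k

/-- `(D_V(α) - k)⁻¹` in Fourier variables. -/
def modelResolvent (α k : ℂ) : DiracSeq →L[ℂ] DiracSeq :=
  pencilResolvent (diagInv 0) V.model α k

theorem isCompactOperator_modelResolvent (α k : ℂ) : IsCompactOperator (V.modelResolvent α k) :=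
  (isCompactOperator_diagInv 0).clm_comp _

theorem fourierL2_D {α p : ℂ} (u : H1 p) (j : Dirac) : fourierL2 p (D V α p u) j =
    (j.1 + p) * fourierL2 p u.1 j + α * V.model (fourierL2 p u.1) j := by
  change fourierL2 p (dbarMap p u + α • V.mul p u.1) j = _
  rw [map_add, map_smul, V.fourierL2_mul, ← fourierL2_dbarMap]
  rfl

theorem fourierL2_Dstar {α p : ℂ} (u : H1 p) (j : Dirac) : fourierL2 p (Dstar V α p u) j =
    conj (j.1 + p) * fourierL2 p u.1 j +
      conj α * ContinuousLinearMap.adjoint V.model (fourierL2 p u.1) j := by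
  change fourierL2 p (dMap p u + conj α • V.mulStar p u.1) j = _
  rw [map_add, map_smul, V.fourierL2_mulStar, ← fourierL2_dMap]
  rfl

theorem D_sub_smul_eq_iff {α p z : ℂ} {u : H1 p} {f : L2 p} :
    D V α p u - z • (u : L2 p) = f ↔
      V.pencil α (z - p) (fourierL2 p u) = diagInv 0 (fourierL2 p f) := by
  rw [pencil, pencil_diagInv_eq_iff, ← (fourierL2 p).injective.eq_iff]
  refine Subtype.ext_iff.trans (funext_iff.trans (forall_congr' fun j => ?_))
  rw [map_sub, map_smul, lp.coeFn_sub, Pi.sub_apply, V.fourierL2_D, lp.coeFn_smul, Pi.smul_apply,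
    smul_eq_mul]
  exact ⟨fun h => by linear_combination h, fun h => by linear_combination h⟩

theorem exists_D_sub_smul_eq_iff {α p z : ℂ} {u f : L2 p} :
    (∃ hu : u ∈ H1 p, D V α p ⟨u, hu⟩ - z • u = f) ↔
      V.pencil α (z - p) (fourierL2 p u) = diagInv 0 (fourierL2 p f) := by
  refine ⟨fun ⟨hu, h⟩ => (V.D_sub_smul_eq_iff (u := ⟨u, hu⟩)).mp h, fun h => ?_⟩
  suffices hu : u ∈ H1 p from ⟨hu, (V.D_sub_smul_eq_iff (u := ⟨u, hu⟩)).mpr h⟩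
  rw [pencil, pencil_diagInv_eq_iff] at h
  refine mem_H1_of_norm_mul_le (fourierL2 p f + z • fourierL2 p u -
    α • V.model (fourierL2 p u)) fun j => le_of_eq ?_
  rw [← norm_mul]
  congr 1
  change _ = fourierL2 p f j + z * fourierL2 p u j - α * V.model (fourierL2 p u) j
  linear_combination h j

theorem exists_Dstar_eq_iff {α p : ℂ} {u f : L2 p} :
    (∃ hu : u ∈ H1 p, Dstar V α p ⟨u, hu⟩ = f) ↔
      ChiralTBG.pencil (ContinuousLinearMap.adjoint (diagInv 0))
        (ContinuousLinearMap.adjoint V.model) (conj α) (conj (-p)) (fourierL2 p u) =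
        ContinuousLinearMap.adjoint (diagInv 0) (fourierL2 p f) := by
  rw [pencil_adjoint_diagInv_eq_iff]
  refine ⟨?_, fun h => ?_⟩
  · rintro ⟨hu, rfl⟩ j
    refine .trans ?_ (V.fourierL2_Dstar ⟨u, hu⟩ j).symm
    rw [map_add, map_neg]
    ring
  have heq (j : Dirac) : conj (j.1 + p) * fourierL2 p u j +
      conj α * ContinuousLinearMap.adjoint V.model (fourierL2 p u) j = fourierL2 p f j := by
    rw [← h j, map_add, map_neg]
    ring
  have hu : u ∈ H1 p := mem_H1_of_norm_mul_le
    (fourierL2 p f - conj α • ContinuousLinearMap.adjoint V.model (fourierL2 p u)) fun j => by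
      rw [← norm_conj, ← norm_mul]
      exact (congrArg norm (eq_sub_of_add_eq (heq j))).le
  exact ⟨hu, (fourierL2 p).injective (lp.ext (funext fun j =>
    (V.fourierL2_Dstar ⟨u, hu⟩ j).trans (heq j)))⟩

/-- `(D_V(α) - z)⁻¹` on `L²_p`. -/
def resolventD (α p z : ℂ) : L2 p →L[ℂ] L2 p :=
  ((fourierL2 p).symm.toContinuousLinearEquiv.toContinuousLinearMap.comp
    (V.modelResolvent α (z - p))).comp (fourierL2 p).toContinuousLinearEquiv.toContinuousLinearMap

theorem fourierL2_resolventD (α p z : ℂ) (f : L2 p) :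
    fourierL2 p (V.resolventD α p z f) = V.modelResolvent α (z - p) (fourierL2 p f) :=
  (fourierL2 p).apply_symm_apply _

theorem isCompactOperator_resolventD (α p z : ℂ) : IsCompactOperator (V.resolventD α p z) :=
  ((V.isCompactOperator_modelResolvent α (z - p)).clm_comp
    (fourierL2 p).symm.toContinuousLinearEquiv.toContinuousLinearMap).comp_clm
    (fourierL2 p).toContinuousLinearEquiv.toContinuousLinearMap

theorem resolventD_apply_eq_iff {α p z : ℂ} (h : IsUnit (V.pencil α (z - p))) {f u : L2 p} :
    V.resolventD α p z f = u ↔ ∃ hu : u ∈ H1 p, D V α p ⟨u, hu⟩ - z • u = f := by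
  rw [exists_D_sub_smul_eq_iff, ← (fourierL2 p).injective.eq_iff, fourierL2_resolventD]
  exact pencilResolvent_apply_eq_iff h

theorem isResolventAt_resolventD {α p z : ℂ} (h : IsUnit (V.pencil α (z - p))) :
    IsResolventAt (D V α p) z (V.resolventD α p z) :=
  ⟨fun _ => (V.resolventD_apply_eq_iff h).mp rfl,
    fun u => (V.resolventD_apply_eq_iff h).mpr ⟨u.2, rfl⟩⟩

theorem exists_ne_zero_D_eq_smul {α p z : ℂ} (h : ¬ IsUnit (V.pencil α (z - p))) :
    ∃ u : H1 p, u ≠ 0 ∧ D V α p u = z • (u : L2 p) := by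
  obtain ⟨x, hx0, hx⟩ := (not_isUnit_pencil_iff (isCompactOperator_diagInv 0)).mp h
  obtain ⟨hu, hD⟩ := (V.exists_D_sub_smul_eq_iff (α := α) (p := p) (z := z)
    (u := (fourierL2 p).symm x) (f := 0)).mpr (by
      rw [LinearIsometryEquiv.apply_symm_apply, map_zero, map_zero]
      exact hx)
  refine ⟨⟨_, hu⟩, fun h0 => hx0 ?_, sub_eq_zero.mp hD⟩
  exact (LinearIsometryEquiv.map_eq_zero_iff _).mp (congrArg Subtype.val h0)

theorem mem_Spec_D_iff {α p z : ℂ} :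
    z ∈ Spec (D V α p) ↔ ¬ IsUnit (V.pencil α (z - p)) := by
  refine ⟨fun hz h => hz ⟨_, V.isResolventAt_resolventD h⟩, fun h ⟨R, hR⟩ => ?_⟩
  obtain ⟨u, hu0, hu⟩ := V.exists_ne_zero_D_eq_smul h
  have hRu := hR.2 u
  rw [hu, sub_self, map_zero] at hRu
  exact hu0 (Subtype.ext hRu.symm)

theorem skewPencil : SkewPencil (diagInv 0) V.model diracPoints skewForm :=
  V.isPotentialMatrix_model.skewPencil

theorem isUnit_pencil_zero {k : ℂ} (hk : k ∉ diracPoints) : IsUnit (V.pencil 0 k) :=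
  V.skewPencil.isUnit_of_not_degenerate hk (V.skewPencil.zero k)

theorem isUnit_pencil_of_isUnit {α k k' : ℂ} (h : IsUnit (V.pencil α k)) (hk' : k' ∉ diracPoints) :
    IsUnit (V.pencil α k') :=
  V.skewPencil.isUnit_of_not_degenerate hk' (V.skewPencil.not_degenerate h k')

theorem twoDbar_eq (p : ℂ) : twoDbar p = D V 0 p := by
  rw [twoDbar, D, zero_smul, add_zero]

theorem isResolventAt_twoDbar {p k : ℂ} (hk : k - p ∉ diracPoints) :
    IsResolventAt (twoDbar p) k (V.resolventD 0 p k) :=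
  V.twoDbar_eq p ▸ V.isResolventAt_resolventD (V.isUnit_pencil_zero hk)

theorem T_eq {p k : ℂ} (hk : k - p ∉ diracPoints) :
    T V p k = (V.resolventD 0 p k).comp (V.mul p) := by
  rw [T, (V.isResolventAt_twoDbar hk).resolventOf_eq]

theorem isCompactOperator_T {p k : ℂ} (hk : k - p ∉ diracPoints) :
    IsCompactOperator (T V p k) := by
  rw [V.T_eq hk]
  exact (V.isCompactOperator_resolventD 0 p k).comp_clm _

theorem T_apply_eq_smul_iff {p k z : ℂ} (hk : k - p ∉ diracPoints) (hz : z ≠ 0) (u : L2 p) :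
    T V p k u = z • u ↔ V.pencil (-z⁻¹) (k - p) (fourierL2 p u) = 0 := by
  rw [V.T_eq hk, ← (fourierL2 p).injective.eq_iff, ContinuousLinearMap.comp_apply,
    fourierL2_resolventD, fourierL2_mul, map_smul, ← zero_sub z⁻¹]
  exact pencilResolvent_apply_eq_smul_iff (V.isUnit_pencil_zero hk) hz

theorem mem_spectrum_T_iff {p k z : ℂ} (hk : k - p ∉ diracPoints) (hz : z ≠ 0) :
    z ∈ spectrum ℂ (T V p k) ↔ ¬ IsUnit (V.pencil z⁻¹ (k - p)) := by
  rw [← (V.isCompactOperator_T hk).hasEigenvalue_iff_mem_spectrum hz, pencil,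
    ← V.isPotentialMatrix_model.isUnit_pencil_neg_iff,
    not_isUnit_pencil_iff (isCompactOperator_diagInv 0)]
  constructor
  · intro h
    obtain ⟨u, hu⟩ := h.exists_hasEigenvector
    exact ⟨fourierL2 p u, (LinearIsometryEquiv.map_eq_zero_iff _).not.mpr hu.2,
      (V.T_apply_eq_smul_iff hk hz u).mp hu.apply_eq_smul⟩
  · rintro ⟨x, hx0, hx⟩
    refine Module.End.hasEigenvalue_of_hasEigenvector (x := (fourierL2 p).symm x)
      ⟨Module.End.mem_eigenspace_iff.mpr ((V.T_apply_eq_smul_iff hk hz _).mpr ?_),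
        (LinearIsometryEquiv.map_eq_zero_iff _).not.mpr hx0⟩
    rwa [LinearIsometryEquiv.apply_symm_apply]

end Potential

instance : Infinite Dirac := by
  obtain ⟨j, -⟩ := Dirac.exists_comp_eq 0
  refine Infinite.of_injective (fun n : ℤ => Dirac.shiftPerm (dualScale * n)
    (mem_dualLattice_iff.mpr ⟨0, n, by simp⟩) j) fun m n h => ?_
  simpa [dualScale_ne_zero] using congrArg Subtype.val h

theorem not_finiteDimensional_L2 (p : ℂ) : ¬ FiniteDimensional ℂ (L2 p) := by
  classical
  intro h
  have : FiniteDimensional ℂ DiracSeq := (fourierL2 p).toLinearEquiv.finiteDimensional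
  have horth : Orthonormal ℂ fun j : Dirac => (lp.single 2 j 1 : DiracSeq) := by
    rw [orthonormal_iff_ite]
    intro i j
    rw [lp.inner_single_left, single_one_apply]
    by_cases h : i = j
    · simp [h]
    · simp [h, Ne.symm h]
  exact not_finite_iff_infinite.mpr inferInstance horth.linearIndependent.finite

namespace Potential

variable (V : Potential)

theorem spectrum_T_eq {p k p' k' : ℂ} (hk : k - p ∉ diracPoints) (hk' : k' - p' ∉ diracPoints) :
    spectrum ℂ (T V p k) = spectrum ℂ (T V p' k') := by
  ext z
  by_cases hz : z = 0
  · rw [hz]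
    exact iff_of_true
      (zero_mem_spectrum_of_isCompactOperator (V.isCompactOperator_T hk)
        (not_finiteDimensional_L2 p))
      (zero_mem_spectrum_of_isCompactOperator (V.isCompactOperator_T hk')
        (not_finiteDimensional_L2 p'))
  · rw [V.mem_spectrum_T_iff hk hz, V.mem_spectrum_T_iff hk' hz, not_iff_not]
    exact ⟨fun h => V.isUnit_pencil_of_isUnit h hk', fun h => V.isUnit_pencil_of_isUnit h hk⟩

/-! ### The first band -/

/-- The non-negative eigenvalues of `H(α)` on `L²_k(ℂ/Λ; ℂ⁴)`. -/
def energies (α k : ℂ) : Set ℝ := {E : ℝ | 0 ≤ E ∧ ∃ w : (H V α k).domain, w ≠ 0 ∧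
    H V α k w = (E : ℂ) • (w : L2 k × L2 k)}

section IsUnit

variable {α k : ℂ}

theorem exists_D_eq_iff (h : IsUnit (V.pencil α (-k))) {u f : L2 k} :
    (∃ hu : u ∈ H1 k, D V α k ⟨u, hu⟩ = f) ↔
      V.modelResolvent α (-k) (fourierL2 k f) = fourierL2 k u := by
  have hiff := V.exists_D_sub_smul_eq_iff (α := α) (z := 0) (u := u) (f := f)
  simp only [zero_smul, sub_zero, zero_sub] at hiff
  exact hiff.trans (pencilResolvent_apply_eq_iff h).symm

theorem exists_Dstar_eq_iff_adjoint (h : IsUnit (V.pencil α (-k))) {u f : L2 k} :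
    (∃ hu : u ∈ H1 k, Dstar V α k ⟨u, hu⟩ = f) ↔
      ContinuousLinearMap.adjoint (V.modelResolvent α (-k)) (fourierL2 k f) = fourierL2 k u := by
  rw [modelResolvent, adjoint_pencilResolvent h,
    pencilResolvent_apply_eq_iff (isUnit_pencil_adjoint h), exists_Dstar_eq_iff]

theorem mem_energies_iff (h : IsUnit (V.pencil α (-k))) {E : ℝ} :
    E ∈ V.energies α k ↔ 0 ≤ E ∧ ∃ x y : DiracSeq, (x, y) ≠ 0 ∧
      V.modelResolvent α (-k) ((E : ℂ) • y) = x ∧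
      ContinuousLinearMap.adjoint (V.modelResolvent α (-k)) ((E : ℂ) • x) = y := by
  refine and_congr_right fun _ => ⟨?_, ?_⟩
  · rintro ⟨⟨⟨u, v⟩, hu, hv⟩, hw0, hw⟩
    refine ⟨fourierL2 k u, fourierL2 k v, fun h0 => hw0 (Subtype.ext ?_), ?_, ?_⟩
    · simpa using h0
    · rw [← map_smul, ← V.exists_D_eq_iff h]
      exact ⟨hu, congrArg Prod.snd hw⟩
    · rw [← map_smul, ← V.exists_Dstar_eq_iff_adjoint h]
      exact ⟨hv, congrArg Prod.fst hw⟩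
  · rintro ⟨x, y, hxy, hx, hy⟩
    obtain ⟨u, rfl⟩ := (fourierL2 k).surjective x
    obtain ⟨v, rfl⟩ := (fourierL2 k).surjective y
    rw [← map_smul, ← V.exists_D_eq_iff h] at hx
    rw [← map_smul, ← V.exists_Dstar_eq_iff_adjoint h] at hy
    obtain ⟨hu, hD⟩ := hx
    obtain ⟨hv, hDstar⟩ := hy
    refine ⟨⟨(u, v), hu, hv⟩, fun h0 => hxy ?_, Prod.ext hDstar hD⟩
    simpa using congrArg Subtype.val h0

theorem E1_pos (h : IsUnit (V.pencil α (-k))) : 0 < E1 V α k := by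
  obtain ⟨E₀, hE₀, x, hx0, y, hx, hy⟩ := exists_pos_apply_smul_eq
    (V.isCompactOperator_modelResolvent α (-k)) (pencilResolvent_ne_zero h diagInv_zero_ne_zero)
  have hmem : E₀ ∈ V.energies α k :=
    (V.mem_energies_iff h).mpr ⟨hE₀.le, x, y, fun h0 => hx0 (congrArg Prod.fst h0), hx, hy⟩
  have hbound : ∀ E ∈ V.energies α k, 1 ≤ E * ‖V.modelResolvent α (-k)‖ := fun E hE => by
    obtain ⟨hE0, x, y, hxy, hx, hy⟩ := (V.mem_energies_iff h).mp hE
    exact one_le_mul_norm_of_apply_smul_eq hE0 hxy hx hy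
  have hnorm : 0 < ‖V.modelResolvent α (-k)‖ :=
    pos_of_mul_pos_right (one_pos.trans_le (hbound E₀ hmem)) hE₀.le
  exact (inv_pos.mpr hnorm).trans_le
    (le_csInf ⟨E₀, hmem⟩ fun E hE => (inv_le_iff_one_le_mul₀ hnorm).mpr (hbound E hE))

theorem E1_eq_zero (h : ¬ IsUnit (V.pencil α (-k))) : E1 V α k = 0 := by
  obtain ⟨u, hu0, hu⟩ := V.exists_ne_zero_D_eq_smul (α := α) (p := k) (z := 0) (by rwa [zero_sub])
  have hleast : IsLeast (V.energies α k) 0 := by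
    refine ⟨⟨le_rfl, ⟨(u.1, 0), u.2, zero_mem _⟩, fun h0 => hu0 ?_, Prod.ext ?_ ?_⟩,
      fun E hE => hE.1⟩
    · exact Subtype.ext (congrArg (fun w : (H V α k).domain => w.1.1) h0)
    · change Dstar V α k 0 = ((0 : ℝ) : ℂ) • u.1
      rw [LinearPMap.map_zero, ofReal_zero, zero_smul]
    · change D V α k u = ((0 : ℝ) : ℂ) • (0 : L2 k)
      rw [hu, zero_smul, smul_zero]
  exact hleast.csInf_eq

end IsUnit

theorem mem_magicSet_iff {α : ℂ} : α ∈ magicSet V ↔ ∀ k, ¬ IsUnit (V.pencil α k) := by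
  refine ⟨fun h k hk => ?_, fun h k => V.E1_eq_zero (h (-k))⟩
  rw [← neg_neg k] at hk
  exact (V.E1_pos hk).ne' (h (-k))

theorem magicSet_eq {p k : ℂ} (hk : k - p ∉ diracPoints) :
    magicSet V = {α : ℂ | α ≠ 0 ∧ α⁻¹ ∈ spectrum ℂ (T V p k)} := by
  ext α
  rw [V.mem_magicSet_iff]
  constructor
  · intro h
    have hα : α ≠ 0 := by
      rintro rfl
      exact h _ (V.isUnit_pencil_zero hk)
    refine ⟨hα, (V.mem_spectrum_T_iff hk (inv_ne_zero hα)).mpr ?_⟩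
    rw [inv_inv]
    exact h _
  · rintro ⟨hα, h⟩ k' hk'
    rw [V.mem_spectrum_T_iff hk (inv_ne_zero hα), inv_inv] at h
    exact h (V.isUnit_pencil_of_isUnit hk' hk)

theorem exists_isUnit_pencil_of_notMem {α : ℂ} (hα : α ∉ magicSet V) :
    ∃ k, IsUnit (V.pencil α k) := by
  rw [V.mem_magicSet_iff] at hα
  push Not at hα
  exact hα

theorem Spec_D_eq_diracPoints {α : ℂ} (hα : α ∉ magicSet V) :
    Spec (D V α 0) = diracPoints := by
  obtain ⟨k, hk⟩ := V.exists_isUnit_pencil_of_notMem hα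
  ext z
  rw [mem_Spec_D_iff, sub_zero]
  exact ⟨fun h => by_contra fun hz => h (V.isUnit_pencil_of_isUnit hk hz),
    fun hz h => V.skewPencil.notMem_of_isUnit h hz⟩

theorem Spec_D_eq_univ {α : ℂ} (hα : α ∈ magicSet V) : Spec (D V α 0) = Set.univ :=
  Set.eq_univ_of_forall fun z => V.mem_Spec_D_iff.mpr (V.mem_magicSet_iff.mp hα (z - 0))

theorem isSimpleEigenvalue_D {α z : ℂ} (hα : α ∉ magicSet V) (hz : z ∈ diracPoints) :
    IsSimpleEigenvalue (D V α 0) z := by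
  obtain ⟨k, hk⟩ := V.exists_isUnit_pencil_of_notMem hα
  have hnd := V.skewPencil.not_degenerate hk z
  obtain ⟨u, hu0, hu⟩ := V.exists_ne_zero_D_eq_smul (α := α) (p := 0) (z := z)
    fun h => V.skewPencil.notMem_of_isUnit h (by rwa [sub_zero])
  have hu0' : (u : L2 0) ≠ 0 := fun h0 => hu0 (Subtype.ext h0)
  have hpencil {w : H1 0} {f : L2 0} (hw : D V α 0 w - z • (w : L2 0) = f) :
      V.pencil α z (fourierL2 0 w) = diagInv 0 (fourierL2 0 f) := by
    simpa using V.D_sub_smul_eq_iff.mp hw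
  have hzero {w : H1 0} (hw : D V α 0 w = z • (w : L2 0)) : V.pencil α z (fourierL2 0 w) = 0 := by
    simpa using hpencil (sub_eq_zero.mpr hw)
  refine isSimpleEigenvalue_of_forall_mem_span hu0' hu (fun w hw => ?_) fun w hw => ?_
  · have hspan := V.skewPencil.mem_span_of_pencil_eq_zero hnd hz
      ((LinearIsometryEquiv.map_eq_zero_iff _).not.mpr hu0') (hzero hu) (hzero hw)
    obtain ⟨c, hc⟩ := Submodule.mem_span_singleton.mp hspan
    rw [← map_smul] at hc
    exact Submodule.mem_span_singleton.mpr ⟨c, (fourierL2 0).injective hc⟩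
  · obtain ⟨c, hc⟩ := Submodule.mem_span_singleton.mp hw
    have hf : V.pencil α z (fourierL2 0 (c • (u : L2 0))) = 0 := by
      rw [map_smul, map_smul, hzero hu, smul_zero]
    have hf0 := V.skewPencil.eq_zero_of_pencil_eq hnd hz (hpencil hc.symm) hf
    rw [LinearIsometryEquiv.map_eq_zero_iff] at hf0
    exact sub_eq_zero.mp (hc.symm.trans hf0)

end Potential

end ChiralTBG
end

theorem proposition2p2 (V : ChiralTBG.Potential) :
    -- the operators `R(k)` and `T_k` are well defined, and `T_k` is compact
    (∀ p k : ℂ, k - p ∉ ChiralTBG.diracPoints →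
      k ∈ ChiralTBG.resolventSetOf (ChiralTBG.twoDbar p) ∧
        IsCompactOperator (ChiralTBG.T V p k)) ∧
    -- the spectrum of `T_k` does not depend on `k` and `p`
    (∀ p q k k' : ℂ, k - p ∉ ChiralTBG.diracPoints → k' - q ∉ ChiralTBG.diracPoints →
      spectrum ℂ (ChiralTBG.T V p k) = spectrum ℂ (ChiralTBG.T V q k')) ∧
    -- spectral characterization of the magic set
    (∀ p k : ℂ, k - p ∉ ChiralTBG.diracPoints →
      ChiralTBG.magicSet V = {α : ℂ | α ≠ 0 ∧ α⁻¹ ∈ spectrum ℂ (ChiralTBG.T V p k)}) ∧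
    -- the spectrum of `D_V(α)` on `L²_0`
    (∀ α : ℂ, α ∉ ChiralTBG.magicSet V →
      ChiralTBG.Spec (ChiralTBG.D V α 0) = ChiralTBG.diracPoints ∧
        ∀ z ∈ ChiralTBG.diracPoints, ChiralTBG.IsSimpleEigenvalue (ChiralTBG.D V α 0) z) ∧
    (∀ α : ℂ, α ∈ ChiralTBG.magicSet V →
      ChiralTBG.Spec (ChiralTBG.D V α 0) = Set.univ) := by
  refine ⟨fun p k hk => ⟨⟨_, V.isResolventAt_twoDbar hk⟩, V.isCompactOperator_T hk⟩,
    fun p q k k' hk hk' => V.spectrum_T_eq hk hk', fun p k hk => V.magicSet_eq hk,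
    fun α hα => ⟨V.Spec_D_eq_diracPoints hα, fun z hz => V.isSimpleEigenvalue_D hα hz⟩,
    fun α hα => V.Spec_D_eq_univ hα⟩
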